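/- **Theorem (contact exponential map).** Let $Q$ be a smooth $n$-dimensional manifold (Hausdorff, second countable, without boundary) and let $L:TQ\times\mathbb R\to\mathbb R$ be a smooth regular Lagrangian, i.e. the Hessian $\left(\frac{\partial^2L}{\partial\dot q^i\partial\dot q^j}\right)$ is everywhere nondegenerate. Let $\eta_L=\mathrm dz-\frac{\partial L}{\partial\dot q^i}\mathrm dq^i$, let $E_L=\dot q^i\frac{\partial L}{\partial\dot q^i}-L$, let $\mathcal R_L$ be the Reeb field of the contact form $\eta_L$ ($i_{\mathcal R_L}\mathrm d\eta_L=0$, $\eta_L(\mathcal R_L)=1$), and let $\xi_L$ be the contact Hamiltonian vector field of $E_L$, defined by $i_{\xi_L}\mathrm d\eta_L+\eta_L(\xi_L)\eta_L=\mathrm dE_L-(\mathcal R_L(E_L)+E_L)\eta_L$. For $h>0$ let $U_h\subseteq TQ\times\mathbb R$ be the set of points from which the flow $\phi_t^{\xi_L}$ of $\xi_L$ is defined for all $t\in[0,h]$, and let $$\exp_h^{\xi_L}:U_h\to Q\times Q\times\mathbb R,\qquad (q_0,\dot q_0,z_0)\mapsto(q_0,q_1,z_0),$$ where $q_1$ is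 the base point in $Q$ of $\phi_h^{\xi_L}(q_0,\dot q_0,z_0)$. Let $\pi:T(Q\times\mathbb R)\to TQ\times\mathbb R$, $(q,z,\dot q,\dot z)\mapsto(q,\dot q,z)$, let $\widetilde L=L\circ\pi$, $\Phi=\dot z-L\circ\pi$ and $M_L=\Phi^{-1}(0)$. Let $\Gamma$ be the vector field on $M_L$ whose integral curves are the velocity lifts of the motions of the nonholonomic system $(\widetilde L,M_L)$, i.e. of the curves $(q(t),z(t))$ with velocity in $M_L$ which satisfy, for some multiplier $\lambda(t)$, $$\frac{\mathrm d}{\mathrm dt}\frac{\partial\widetilde L}{\partial\dot q^i}-\frac{\partial\widetilde L}{\partial q^i}=\lambda\frac{\partial\Phi}{\partial\dot q^i},\qquad \frac{\mathrm d}{\mathrm dt}\frac{\partial\widetilde L}{\partial\dot z}-\frac{\partial\widetilde L}{\partial z}=\lambda\frac{\partial\Phi}{\partial\dot z}.$$ Let $M_{L,h}\subseteq M_L$ be the set of points from which the flow of $\Gamma$ is defined on $[0,h]$, let $\exp_h^{\Gamma}:M_{L,h}\to(Q\times\mathbb R)\times(Q\times\mathbb R)$ be $(q_0,z_0,\dot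 q_0,\dot z_0)\mapsto(q_0,z_0,q(h),z(h))$, where $(q(t),z(t))$ is the motion with this initial velocity, and let $\widetilde{\mathrm{pr}}_1(q_0,z_0,q_1,z_1)=(q_0,q_1,z_0)$. 1. Let $h>0$ be arbitrary, let $N_h$ be an open subset of $M_L$ contained in $M_{L,h}$ such that $\exp_h^\Gamma|_{N_h}$ is a smooth embedding, and let $M_d=\exp_h^\Gamma(N_h)$. Then $\widetilde{\mathrm{pr}}_1|_{M_d}:M_d\to Q\times Q\times\mathbb R$ is a local diffeomorphism. Moreover, $\pi(N_h)$ is an open subset of $TQ\times\mathbb R$ contained in $U_h$, and $\exp_h^{\xi_L}|_{\pi(N_h)}$ is a local diffeomorphism. 2. For every point $x\in TQ\times\mathbb R$ there is $h_0>0$ such that for every $h\in(0,h_0)$ there is an open subset $N_h$ of $M_L$ contained in $M_{L,h}$, on which $\exp_h^\Gamma$ is a smooth embedding, such that the set $V_h=\pi(N_h)$ is an open subset of $TQ\times\mathbb R$ with $x\in V_h\subseteq U_h$, and $\exp_h^{\xi_L}|_{V_h}$ is a diffeomorphism onto an open subset of $Q\times Q\times\mathbb R$. -/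

import Mathlib

open Set Filter Topology Manifold
open scoped ContDiff

noncomputable section

namespace ContactMechanics

/-! ### Generic notions on a manifold `M` modelled on `J` -/

section Generic

variable {F : Type*} [NormedAddCommGroup F] [NormedSpace ℝ F]
  {G : Type*} [TopologicalSpace G] (J : ModelWithCorners ℝ F G)
  {M : Type*} [TopologicalSpace M] [ChartedSpace G M]
  {F' : Type*} [NormedAddCommGroup F'] [NormedSpace ℝ F']
  {G' : Type*} [TopologicalSpace G'] (J' : ModelWithCorners ℝ F' G')
  {M' : Type*} [TopologicalSpace M'] [ChartedSpace G' M']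

/-- The coordinate expression of a one-form `α` in the chart at `x`. -/
def chartForm (α : (x : M) → TangentSpace J x →L[ℝ] ℝ) (x : M) (y : F) : F →L[ℝ] ℝ :=
  (α ((extChartAt J x).symm y)).comp (mfderiv 𝓘(ℝ, F) J (extChartAt J x).symm y)

/-- The exterior derivative `dα` of a one-form, computed in the chart at `x`:
`dα(u, w) = D_u α(w) - D_w α(u)`, so that `d(a db) = da ∧ db`. -/
def extDerivOneForm (α : (x : M) → TangentSpace J x →L[ℝ] ℝ) (x : M)
    (u w : TangentSpace J x) : ℝ :=
  let T : TangentSpace J x →L[ℝ] F := mfderiv J 𝓘(ℝ, F) (extChartAt J x) x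
  fderiv ℝ (chartForm J α x) (extChartAt J x x) (T u) (T w)
    - fderiv ℝ (chartForm J α x) (extChartAt J x x) (T w) (T u)

/-- The map `♭` of a contact form `η`: `♭(v) = i_v dη + η(v) η`. -/
def flat (η : (x : M) → TangentSpace J x →L[ℝ] ℝ) (x : M) (v w : TangentSpace J x) : ℝ :=
  extDerivOneForm J η x v w + η x v * η x w

/-- The Reeb vector field of a contact form `η`: the unique solution of
`i_R dη = 0`, `η(R) = 1`. -/
def reebField (η : (x : M) → TangentSpace J x →L[ℝ] ℝ) (x : M) : TangentSpace J x :=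
  Classical.epsilon fun R => (∀ w, extDerivOneForm J η x R w = 0) ∧ η x R = 1

/-- The differential of a real function. -/
def differential (f : M → ℝ) (x : M) : TangentSpace J x →L[ℝ] ℝ :=
  mfderiv J 𝓘(ℝ, ℝ) f x

/-- The contact Hamiltonian vector field `X_f` of `f`: the unique solution of
`♭(X_f) = df - (f + R(f)) η`. -/
def contactHamiltonianField (η : (x : M) → TangentSpace J x →L[ℝ] ℝ) (f : M → ℝ) (x : M) :
    TangentSpace J x :=
  Classical.epsilon fun X => ∀ w, flat J η x X w =
    differential J f x w - (f x + differential J f x (reebField J η x)) * η x w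

/-- The flow of `X` starting at `x` is defined for all `t ∈ [0, h]`. -/
def FlowDefined (X : (x : M) → TangentSpace J x) (h : ℝ) (x : M) : Prop :=
  ∃ γ : ℝ → M, γ 0 = x ∧ IsMIntegralCurveOn γ X (Icc 0 h)

open Classical in
/-- The time-`h` flow of `X` (where it is defined). -/
def flow (X : (x : M) → TangentSpace J x) (h : ℝ) (x : M) : M :=
  if H : FlowDefined J X h x then H.choose h else x

/-- The velocity lift of a curve. -/
def velocity (c : ℝ → M) (t : ℝ) : TangentBundle J M :=
  ⟨c t, mfderiv 𝓘(ℝ, ℝ) J c t (1 : ℝ)⟩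

/-- The coordinate expression of a function on `TM` in the bundle chart of `TM` induced by the
chart of `M` at `x`. -/
def inChart (Λ : TangentBundle J M → ℝ) (x : M) (y v : F) : ℝ :=
  Λ ⟨(extChartAt J x).symm y, mfderiv 𝓘(ℝ, F) J (extChartAt J x).symm y v⟩

/-- The Euler-Lagrange expression `d/dt (∂Λ/∂v) - ∂Λ/∂y` of `Λ` along `c` at time `t`, in the
chart at `c t`. -/
def eulerLagrange (Λ : TangentBundle J M → ℝ) (c : ℝ → M) (t : ℝ) : F →L[ℝ] ℝ :=
  let y : ℝ → F := fun s => extChartAt J (c t) (c s)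
  deriv (fun s => fderiv ℝ (inChart J Λ (c t) (y s)) (deriv y s)) t
    - fderiv ℝ (fun y' => inChart J Λ (c t) y' (deriv y t)) (y t)

/-- The fibre derivative `∂Φ/∂v` along the velocity of `c` at time `t`, in the chart at `c t`. -/
def constraintForce (Φ : TangentBundle J M → ℝ) (c : ℝ → M) (t : ℝ) : F →L[ℝ] ℝ :=
  let y : ℝ → F := fun s => extChartAt J (c t) (c s)
  fderiv ℝ (inChart J Φ (c t) (y t)) (deriv y t)

/-- `c` is, over the open interval `s`, a motion of the nonholonomic system with Lagrangian `Λ` and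
constraint `Φ = 0` under Chetaev's principle:
`d/dt (∂Λ/∂v) - ∂Λ/∂y = lam * ∂Φ/∂v` with a multiplier `lam` depending on time, and `Φ = 0`. -/
def IsNonholonomicMotion (Λ Φ : TangentBundle J M → ℝ) (c : ℝ → M) (s : Set ℝ) : Prop :=
  ContMDiffOn 𝓘(ℝ, ℝ) J ∞ c s ∧
  ∀ t ∈ s, Φ (velocity J c t) = 0 ∧
    ∃ lam : ℝ, eulerLagrange J Λ c t = lam • constraintForce J Φ c t

/-- `w` is the initial velocity of a motion of the nonholonomic system that is defined for all
`t ∈ [0, h]`; `c` is such a motion. -/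
def IsMotionFrom (Λ Φ : TangentBundle J M → ℝ) (h : ℝ) (w : TangentBundle J M)
    (c : ℝ → M) : Prop :=
  ∃ a b : ℝ, a < 0 ∧ h < b ∧ IsNonholonomicMotion J Λ Φ c (Ioo a b) ∧ velocity J c 0 = w

/-- The domain of the nonholonomic exponential map at time `h`: the points `w` of the constraint
submanifold `Φ = 0` from which the nonholonomic dynamics is defined for all `t ∈ [0, h]`. -/
def nonholonomicDomain (Λ Φ : TangentBundle J M → ℝ) (h : ℝ) : Set (TangentBundle J M) :=
  {w | Φ w = 0 ∧ ∃ c, IsMotionFrom J Λ Φ h w c}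

open Classical in
/-- The time-`h` flow of the nonholonomic dynamics (the vector field on `Φ = 0` whose integral
curves are the velocity lifts of the motions), where it is defined. -/
def nonholonomicFlow (Λ Φ : TangentBundle J M → ℝ) (h : ℝ) (w : TangentBundle J M) :
    TangentBundle J M :=
  if H : ∃ c, IsMotionFrom J Λ Φ h w c then velocity J H.choose h else w

/-- The nonholonomic exponential map: the initial and the final position. -/
def nonholonomicExp (Λ Φ : TangentBundle J M → ℝ) (h : ℝ) (w : TangentBundle J M) : M × M :=
  (w.proj, (nonholonomicFlow J Λ Φ h w).proj)

/-- For an embedded submanifold `S` (in particular for an open set): `f` restricts to a smooth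
diffeomorphism of `S` onto an open subset of `M'`. A map into an embedded submanifold is smooth
iff it is smooth as a map into the ambient manifold. -/
def IsDiffeoOntoOpen (f : M → M') (S : Set M) : Prop :=
  ContMDiffOn J J' ∞ f S ∧ IsOpen (f '' S) ∧
    ∃ g : M' → M, ContMDiffOn J' J ∞ g (f '' S) ∧ LeftInvOn g f S

/-- For an embedded submanifold `S` (in particular for an open set): `f` restricted to `S` is a
local diffeomorphism into `M'`. -/
def IsLocalDiffeoOn (f : M → M') (S : Set M) : Prop :=
  ∀ x ∈ S, ∃ W : Set M, IsOpen W ∧ x ∈ W ∧ IsDiffeoOntoOpen J J' f (S ∩ W)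

/-- `f` restricted to the open set `V` is a smooth embedding: smooth, with injective differential,
and a homeomorphism onto its image. -/
def IsSmoothEmbeddingOn (f : M → M') (V : Set M) : Prop :=
  ContMDiffOn J J' ∞ f V ∧ (∀ x ∈ V, Function.Injective (mfderiv J J' f x)) ∧
    IsEmbedding (V.domRestrict f)

end Generic

/-! ### Contact Lagrangian systems on a configuration manifold `Q` -/

section Lagrangian

set_option linter.unusedSectionVars false

variable {E : Type*} [NormedAddCommGroup E] [NormedSpace ℝ E]
  {H : Type*} [TopologicalSpace H] (I : ModelWithCorners ℝ E H)
  {Q : Type*} [TopologicalSpace Q] [ChartedSpace H Q] [IsManifold I ∞ Q]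
  (L : TangentBundle I Q × ℝ → ℝ)

/-- The fibre derivative `∂L/∂q̇` at `x = (q, q̇, z)`, a covector on `T_q Q`. -/
def fiberDeriv (x : TangentBundle I Q × ℝ) : TangentSpace I x.1.proj →L[ℝ] ℝ :=
  fderiv ℝ (fun u : TangentSpace I x.1.proj => L (⟨x.1.proj, u⟩, x.2)) x.1.2

/-- The Hessian `∂²L/∂q̇∂q̇` at `x = (q, q̇, z)`, a bilinear form on `T_q Q`. -/
def fiberHessian (x : TangentBundle I Q × ℝ) :
    TangentSpace I x.1.proj →L[ℝ] TangentSpace I x.1.proj →L[ℝ] ℝ :=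
  fderiv ℝ (fun v : TangentSpace I x.1.proj =>
    fderiv ℝ (fun u : TangentSpace I x.1.proj => L (⟨x.1.proj, u⟩, x.2)) v) x.1.2

/-- `L` is regular: its Hessian with respect to the velocities is everywhere nondegenerate. -/
def IsRegular : Prop :=
  ∀ (x : TangentBundle I Q × ℝ) (a : TangentSpace I x.1.proj),
    (∀ b, fiberHessian I L x a b = 0) → a = 0

/-- The model with corners of `TQ × ℝ`. -/
abbrev phaseModel : ModelWithCorners ℝ ((E × E) × ℝ) (ModelProd (ModelProd H E) ℝ) :=
  I.tangent.prod 𝓘(ℝ, ℝ)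

/-- The one-form `θ_L = S^*(dL) = ∂L/∂q̇ dq` on `TQ × ℝ`: as `S w` is the vertical lift of the
projection of `w` to `TQ`, `θ_L(w)` is the fibre derivative of `L` applied to this projection. -/
def thetaL (x : TangentBundle I Q × ℝ) : TangentSpace (phaseModel I) x →L[ℝ] ℝ :=
  (fiberDeriv I L x).comp
    (mfderiv (phaseModel I) I (fun y : TangentBundle I Q × ℝ => y.1.proj) x)

/-- The one-form `η_L = dz - θ_L` on `TQ × ℝ`. -/
def etaL (x : TangentBundle I Q × ℝ) : TangentSpace (phaseModel I) x →L[ℝ] ℝ :=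
  differential (phaseModel I) (fun y : TangentBundle I Q × ℝ => y.2) x - thetaL I L x

/-- The energy `E_L = q̇ ∂L/∂q̇ - L`. -/
def energy (x : TangentBundle I Q × ℝ) : ℝ :=
  fiberDeriv I L x x.1.2 - L x

/-- The Lagrangian (Herglotz) vector field `ξ_L`, the contact Hamiltonian vector field of the
energy `E_L` for `η_L`. -/
def xiL (x : TangentBundle I Q × ℝ) : TangentSpace (phaseModel I) x :=
  contactHamiltonianField (phaseModel I) (etaL I L) (energy I L) x

/-- The set `U_h` of the points of `TQ × ℝ` from which the flow of `ξ_L` is defined on `[0, h]`. -/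
def contactDomain (h : ℝ) : Set (TangentBundle I Q × ℝ) :=
  {x | FlowDefined (phaseModel I) (xiL I L) h x}

/-- The contact exponential map `(q₀, q̇₀, z₀) ↦ (q₀, q(h), z₀)`. -/
def contactExp (h : ℝ) (x : TangentBundle I Q × ℝ) : Q × Q × ℝ :=
  (x.1.proj, (flow (phaseModel I) (xiL I L) h x).1.proj, x.2)

/-- The model with corners of `Q × ℝ`. -/
abbrev extModel : ModelWithCorners ℝ (E × ℝ) (ModelProd H ℝ) := I.prod 𝓘(ℝ, ℝ)

/-- The projection `π : T(Q × ℝ) → TQ × ℝ`, `(q, z, q̇, ż) ↦ (q, q̇, z)`. -/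
def projTQ (w : TangentBundle (extModel I) (Q × ℝ)) : TangentBundle I Q × ℝ :=
  (tangentMap (extModel I) I Prod.fst w, w.proj.2)

/-- The function `Φ(q, z, q̇, ż) = ż - L(q, q̇, z)` on `T(Q × ℝ)`. -/
def constraint (w : TangentBundle (extModel I) (Q × ℝ)) : ℝ :=
  differential (extModel I) (fun y : Q × ℝ => y.2) w.proj w.2 - L (projTQ I w)

/-- The constraint submanifold `M_L = {ż = L(q, q̇, z)}` of `T(Q × ℝ)`. -/
def constraintSet : Set (TangentBundle (extModel I) (Q × ℝ)) :=
  {w | constraint I L w = 0}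

/-- The map `(q, q̇, z) ↦ (q, z, q̇, L(q, q̇, z))`, a diffeomorphism of `TQ × ℝ` onto `M_L`,
inverse to the restriction of `π`. -/
def graphL (x : TangentBundle I Q × ℝ) : TangentBundle (extModel I) (Q × ℝ) :=
  (equivTangentBundleProd I Q 𝓘(ℝ, ℝ) ℝ).symm (x.1, ⟨x.2, L x⟩)

theorem projTQ_graphL (x : TangentBundle I Q × ℝ) : projTQ I (graphL I L x) = x := by
  simp [projTQ, graphL, tangentMap, mfderiv_fst]
  rfl

theorem graphL_mem (x : TangentBundle I Q × ℝ) : graphL I L x ∈ constraintSet I L := by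
  have h := projTQ_graphL I L x
  simp only [constraintSet, constraint, Set.mem_ofPred_eq, h]
  simp only [differential, mfderiv_snd]
  exact sub_self (L x)

theorem graphL_projTQ {w : TangentBundle (extModel I) (Q × ℝ)} (hw : w ∈ constraintSet I L) :
    graphL I L (projTQ I w) = w := by
  have h1 : L (projTQ I w) = w.2.2 := by
    have := hw
    simp only [constraintSet, constraint, Set.mem_ofPred_eq, differential, mfderiv_snd] at this
    exact (sub_eq_zero.1 this).symm
  have h2 : projTQ I w = (⟨w.proj.1, w.2.1⟩, w.proj.2) := by
    simp only [projTQ, tangentMap, mfderiv_fst]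
    rfl
  simp only [graphL, h1]
  rw [h2]
  rfl

/-- The domain `M_{L,h}` of the exponential map of the nonholonomic system with Lagrangian
`L ∘ π` and constraint submanifold `M_L`. -/
def nhDomain (h : ℝ) : Set (TangentBundle (extModel I) (Q × ℝ)) :=
  nonholonomicDomain (extModel I) (L ∘ projTQ I) (constraint I L) h

/-- The exponential map of the nonholonomic system with Lagrangian `L ∘ π` and constraint
submanifold `M_L`: `(q₀, z₀, q̇₀, ż₀) ↦ (q₀, z₀, q(h), z(h))`. -/
def nhExp (h : ℝ) (w : TangentBundle (extModel I) (Q × ℝ)) : (Q × ℝ) × (Q × ℝ) :=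
  nonholonomicExp (extModel I) (L ∘ projTQ I) (constraint I L) h w

/-- `N` is a (relatively) open subset of `M_L` contained in `M_{L,h}`, and the nonholonomic
exponential map restricted to `N` is a smooth embedding. The manifold `M_L` is identified with
`TQ × ℝ` through the diffeomorphism `graphL`. -/
structure IsEmbeddingDomain (h : ℝ) (N : Set (TangentBundle (extModel I) (Q × ℝ))) : Prop where
  subset : N ⊆ nhDomain I L h
  isOpen : ∃ O : Set (TangentBundle (extModel I) (Q × ℝ)),
    IsOpen O ∧ N = constraintSet I L ∩ O
  embedding : IsSmoothEmbeddingOn (phaseModel I) ((extModel I).prod (extModel I))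
    (nhExp I L h ∘ graphL I L) (projTQ I '' N)

/-- The projection `(q₀, z₀, q₁, z₁) ↦ (q₀, q₁, z₀)`. -/
def prTilde (p : (Q × ℝ) × (Q × ℝ)) : Q × Q × ℝ := (p.1.1, p.2.1, p.1.2)

end Lagrangian

end ContactMechanics

end

/-!
The proof compares two dynamical systems that are the same system in two guises, and then uses that
the flow of the Herglotz vector field `ξ_L` is a contact flow.

*Charts.* In a chart of `TQ × ℝ` with coordinates `(q, v, z)` and with `p = ∂ℓ/∂v`, the form `η_L` is
`dz - p dq`, and for a regular Lagrangian the vector field `ξ_L` is the unique solution of the Herglotz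
equations `q̇ = v`, `ż = ℓ`, `ṗ = ∂ℓ/∂q + (∂ℓ/∂z) p` (`IsHerglotz`, `chartDeriv_xiL`). In particular it
is smooth. The `z`-component of Chetaev's equations for `(L ∘ π, M_L)` says that the multiplier is
`-∂ℓ/∂z`; with this multiplier the other components are the Herglotz equations
(`chetaev_iff_isHerglotz`). So `π` carries the nonholonomic flow on `M_L` to the flow `φ_t` of `ξ_L`,
and with `exp(x) = (q₀, z₀, q₁, z₁)` for the nonholonomic exponential map, transported to `TQ × ℝ`,
the contact exponential map is `prTilde ∘ exp` (`flowDefined_and_nhExp_eq`).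

*Arbitrary times.* From the Herglotz equations, the Lie derivative of `η_L` along `ξ_L` is
`(∂L/∂z) η_L` (`lieDeriv_contactForm`), and so `φ_h` preserves the kernel of `η_L`
(`IsSmoothField.mdifferentiableAt_flow`). If a vector `δ` satisfies `δq₀ = δz₀ = 0`, then
`η_L(δ) = 0`, hence `δz₁ = p₁ δq₁`. So, if the derivative of `(q₀, q₁, z₀)` annihilates `δ`, then so does
the derivative of `exp`, and `δ = 0` where `exp` is an immersion (`injective_mfderiv_contactExp`). The
dimensions of `TQ × ℝ` and `Q × Q × ℝ` agree, and the inverse function theorem gives both local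
diffeomorphisms (`isLocalDiffeo_of_isEmbeddingDomain`).

*Short times.* By `q̇ = v`, the derivative of `q(h)` with respect to the initial velocity is `h + o(h)`
at a given point (`hasDerivAt_position_velocity`), so that the contact exponential map is an immersion
there for small `h > 0`, and a diffeomorphism from a neighbourhood onto an open set. As it factors
through `exp`, the map `exp` is an embedding on this neighbourhood (`exists_isEmbeddingDomain`).

Mathlib has the existence of integral curves, but neither the smooth dependence of a flow on the
initial value nor an exterior derivative of forms on manifolds. The smooth dependence is proved by
applying the inverse function theorem to the integral equation in the Banach space of continuous
curves (`exists_local_flow`). For the exterior derivative, only its independence of the chart is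
needed (`extDerivOneForm_eq`).
-/

noncomputable section

namespace ContactMechanics

/-! ### Composition as a smooth operation on curves -/

section CompositionOperator

universe u
variable {K : Type*} [TopologicalSpace K] [CompactSpace K]

/-- Pointwise application of a continuous family of operators to a continuous curve. -/
def pointwiseApply (K : Type*) [TopologicalSpace K] [CompactSpace K] (E F : Type*)
    [NormedAddCommGroup E] [NormedSpace ℝ E] [NormedAddCommGroup F] [NormedSpace ℝ F] :
    C(K, E →L[ℝ] F) →L[ℝ] C(K, E) →L[ℝ] C(K, F) :=
  LinearMap.mkContinuous₂
    (LinearMap.mk₂ ℝ (fun (A : C(K, E →L[ℝ] F)) (g : C(K, E)) =>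
        (⟨fun s => A s (g s), A.continuous.clm_apply g.continuous⟩ : C(K, F)))
      (fun _ _ _ => by ext; simp) (fun _ _ _ => by ext; simp)
      (fun _ _ _ => by ext; simp) (fun _ _ _ => by ext; simp)) 1
    (fun A g => by
      rw [one_mul]
      refine (ContinuousMap.norm_le _ (by positivity)).2 fun s => ?_
      exact ((A s).le_opNorm _).trans
        (mul_le_mul (A.norm_coe_le_norm s) (g.norm_coe_le_norm s) (norm_nonneg _) (norm_nonneg A)))

theorem hasFDerivAt_postcomp {E F : Type*}
    [NormedAddCommGroup E] [NormedSpace ℝ E] [NormedAddCommGroup F] [NormedSpace ℝ F]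
    {f : E → F} (hf : ContDiff ℝ 1 f) (g : C(K, E)) :
    HasFDerivAt (fun g : C(K, E) => (ContinuousMap.mk f hf.continuous).comp g)
      (pointwiseApply K E F
        ((ContinuousMap.mk (fderiv ℝ f) (hf.continuous_fderiv one_ne_zero)).comp g)) g := by
  rw [hasFDerivAt_iff_isLittleO_nhds_zero, Asymptotics.isLittleO_iff]
  intro c hc
  -- `f'` is uniformly continuous near the compact image of `g`
  have hK : IsCompact (range g) := isCompact_range g.continuous
  have hu := hK.uniformContinuousAt_of_continuousAt (fderiv ℝ f)
    (fun a _ => (hf.continuous_fderiv one_ne_zero).continuousAt) (Metric.dist_mem_uniformity hc)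
  obtain ⟨r, hr, hru⟩ := Metric.mem_uniformity_dist.1 hu
  filter_upwards [Metric.ball_mem_nhds (0 : C(K, E)) hr] with d hd
  rw [mem_ball_zero_iff] at hd
  refine (ContinuousMap.norm_le _ (by positivity)).2 fun s => ?_
  have hds : ‖d s‖ < r := (d.norm_coe_le_norm s).trans_lt hd
  have key := (convex_ball (g s) r).norm_image_sub_le_of_norm_fderiv_le' (𝕜 := ℝ) (f := f)
    (φ := fderiv ℝ f (g s)) (C := c) (x := g s) (y := g s + d s)
    (fun x _ => (hf.differentiable one_ne_zero).differentiableAt)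
    (fun x hx => by
      have := hru (a := g s) (b := x) (by rw [dist_comm]; exact hx) (mem_range_self s)
      rw [← dist_eq_norm, dist_comm]; exact this.le)
    (Metric.mem_ball_self hr) (by simpa [Metric.mem_ball, dist_eq_norm] using hds)
  simp only [add_sub_cancel_left] at key
  exact key.trans (mul_le_mul_of_nonneg_left (d.norm_coe_le_norm s) hc.le)

/-- The induction on the order of differentiability runs over all pairs `E`, `F`, as it passes from
`F` to `E →L[ℝ] F`; this is why both spaces lie in one universe. -/
theorem contDiff_nat_postcomp (n : ℕ) : ∀ {E F : Type u}
    [NormedAddCommGroup E] [NormedSpace ℝ E] [NormedAddCommGroup F] [NormedSpace ℝ F]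
    {f : E → F} (hf : ContDiff ℝ ∞ f),
    ContDiff ℝ n (fun g : C(K, E) => (ContinuousMap.mk f hf.continuous).comp g) := by
  induction n with
  | zero =>
    intro E F _ _ _ _ f hf
    exact contDiff_zero.2 (ContinuousMap.continuous_postcomp _)
  | succ n ih =>
    intro E F _ _ _ _ f hf
    have h1 : ContDiff ℝ 1 f := hf.of_le (by exact_mod_cast le_top)
    have h2 : ContDiff ℝ ∞ (fderiv ℝ f) := hf.fderiv_right (by simp)
    have h3 := (pointwiseApply K E F).contDiff.comp (ih (F := E →L[ℝ] F) h2)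
    refine (contDiff_succ_iff_hasFDerivAt (n := n)).2
      ⟨fun g => pointwiseApply K E F ((ContinuousMap.mk (fderiv ℝ f) h2.continuous).comp g),
        h3, fun g => hasFDerivAt_postcomp h1 g⟩

/-- Composition with a smooth map is a smooth operation on continuous curves. -/
theorem contDiff_postcomp {E F : Type u}
    [NormedAddCommGroup E] [NormedSpace ℝ E] [NormedAddCommGroup F] [NormedSpace ℝ F]
    {f : E → F} (hf : ContDiff ℝ ∞ f) :
    ContDiff ℝ ∞ (fun g : C(K, E) => (ContinuousMap.mk f hf.continuous).comp g) :=
  contDiff_infty.2 fun n => contDiff_nat_postcomp n hf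

end CompositionOperator

/-! ### The inverse function theorem with a smooth inverse -/

section InverseFunction

variable {E : Type*} [NormedAddCommGroup E] [NormedSpace ℝ E] [CompleteSpace E]
  {F : Type*} [NormedAddCommGroup F] [NormedSpace ℝ F]

/-- The inverse function theorem, with the inverse smooth on an open set: `ContDiffAt ℝ ∞` at a
point does not give smoothness on a neighbourhood, so invertibility of the derivative is used at
all nearby points. -/
theorem exists_openPartialHomeomorph_contDiffOn_symm {f : E → F} {U : Set E} (hU : IsOpen U)
    (hf : ContDiffOn ℝ ∞ f U) {a : E} (ha : a ∈ U) (f' : E ≃L[ℝ] F)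
    (hf' : HasFDerivAt f (f' : E →L[ℝ] F) a) :
    ∃ e : OpenPartialHomeomorph E F, a ∈ e.source ∧ e.source ⊆ U ∧ (∀ x, e x = f x) ∧
      ContDiffOn ℝ ∞ e.symm e.target := by
  have hfa : ∀ x ∈ U, ContDiffAt ℝ ∞ f x := fun x hx => hf.contDiffAt (hU.mem_nhds hx)
  have hn : (∞ : WithTop ℕ∞) ≠ 0 := by simp
  let e₀ := (hfa a ha).toOpenPartialHomeomorph f hf' hn
  have hcont : ContinuousOn (fderiv ℝ f) U := hf.continuousOn_fderiv_of_isOpen hU (by simp)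
  have hO : IsOpen (range ((↑) : (E ≃L[ℝ] F) → E →L[ℝ] F)) := ContinuousLinearEquiv.isOpen
  have hV : IsOpen (U ∩ fderiv ℝ f ⁻¹' range ((↑) : (E ≃L[ℝ] F) → E →L[ℝ] F)) :=
    hcont.isOpen_inter_preimage hU hO
  refine ⟨e₀.restrOpen _ hV, ⟨(hfa a ha).mem_toOpenPartialHomeomorph_source hf' hn, ha, ?_⟩, ?_,
    fun x => rfl, ?_⟩
  · exact ⟨f', hf'.fderiv.symm⟩
  · exact fun x hx => hx.2.1
  · intro y hy
    have hx := (e₀.restrOpen _ hV).map_target hy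
    obtain ⟨g, hg⟩ := hx.2.2
    refine ContDiffAt.contDiffWithinAt
      ((e₀.restrOpen _ hV).contDiffAt_symm hy (f₀' := g) ?_ (hfa _ hx.2.1))
    rw [hg]
    exact ((hfa _ hx.2.1).differentiableAt hn).hasFDerivAt

end InverseFunction

/-! ### Smooth dependence of local flows on the initial value -/

section LocalFlow

/-- The integration operator `g ↦ (s ↦ ∫₀ˢ g)` on curves over `[-1, 1]`. The integrand is extended
to `ℝ` by constants, which does not affect the values at `s ∈ [-1, 1]`. -/
def integrate (E : Type*) [NormedAddCommGroup E] [NormedSpace ℝ E] [CompleteSpace E] :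
    C(Icc (-1 : ℝ) 1, E) →L[ℝ] C(Icc (-1 : ℝ) 1, E) :=
  have hc (g : C(Icc (-1 : ℝ) 1, E)) : Continuous fun τ : ℝ => g (projIcc (-1) 1 (by norm_num) τ) :=
    g.continuous.comp continuous_projIcc
  LinearMap.mkContinuous
    { toFun := fun g => ⟨fun s => ∫ τ in (0 : ℝ)..s, g (projIcc (-1) 1 (by norm_num) τ),
        (intervalIntegral.continuous_primitive (fun a b => (hc g).intervalIntegrable a b) 0).comp
          continuous_subtype_val⟩
      map_add' := fun g g' => by
        ext s
        exact intervalIntegral.integral_add ((hc g).intervalIntegrable _ _)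
          ((hc g').intervalIntegrable _ _)
      map_smul' := fun c g => by
        ext s
        exact intervalIntegral.integral_smul c _ } 1
    (fun g => by
      rw [one_mul]
      refine (ContinuousMap.norm_le _ (norm_nonneg g)).2 fun s => ?_
      have h := intervalIntegral.norm_integral_le_of_norm_le_const (a := 0) (b := (s : ℝ))
        (C := ‖g‖) (f := fun τ : ℝ => g (projIcc (-1) 1 (by norm_num) τ))
        fun τ _ => g.norm_coe_le_norm _
      refine h.trans (mul_le_of_le_one_right (norm_nonneg g) ?_)
      rw [sub_zero, abs_le]
      exact s.2)

variable {E : Type*} [NormedAddCommGroup E] [NormedSpace ℝ E] [CompleteSpace E]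

theorem integrate_apply (g : C(Icc (-1 : ℝ) 1, E)) (s : Icc (-1 : ℝ) 1) :
    integrate E g s = ∫ τ in (0 : ℝ)..s, g (projIcc (-1) 1 (by norm_num) τ) := rfl

/-- The local flow of a smooth vector field on a Banach space is smooth jointly in time and initial
value. The curve `s ↦ φ(hs, x)`, `s ∈ [-1, 1]`, solves `g = x + h ∫ f(g)`, a smooth equation in
`C([-1, 1], E)` whose derivative in `g` is the identity at `h = 0`; so it depends smoothly on
`(h, x)` by the inverse function theorem. -/
theorem exists_local_flow_of_contDiff {f : E → E} (hf : ContDiff ℝ ∞ f) (x₀ : E) :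
    ∃ ε > 0, ∃ W : Set E, IsOpen W ∧ x₀ ∈ W ∧ ∃ φ : ℝ × E → E,
      ContDiffOn ℝ ∞ φ (Ioo (-ε) ε ×ˢ W) ∧ (∀ x ∈ W, φ (0, x) = x) ∧
      ∀ t ∈ Ioo (-ε) ε, ∀ x ∈ W, HasDerivAt (fun t => φ (t, x)) (f (φ (t, x))) t := by
  let Γ := C(Icc (-1 : ℝ) 1, E)
  let N : Γ → Γ := fun g => (ContinuousMap.mk f hf.continuous).comp g
  have hN : ContDiff ℝ ∞ N := contDiff_postcomp hf
  let κ : E →L[ℝ] Γ := LinearMap.mkContinuous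
    { toFun := fun x => ContinuousMap.const _ x, map_add' := fun _ _ => rfl,
      map_smul' := fun _ _ => rfl } 1
    (fun x => by
      rw [one_mul]
      exact (ContinuousMap.norm_le _ (norm_nonneg x)).2 fun s => le_rfl)
  have hκ : ∀ x s, κ x s = x := fun _ _ => rfl
  let H : (ℝ × E) × Γ → (ℝ × E) × Γ :=
    fun u => (u.1, u.2 - κ u.1.2 - u.1.1 • integrate E (N u.2))
  have hH : ContDiff ℝ ∞ H := by
    refine contDiff_fst.prodMk ((contDiff_snd.sub (κ.contDiff.comp contDiff_fst.snd)).sub ?_)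
    exact contDiff_fst.fst.smul ((integrate E).contDiff.comp (hN.comp contDiff_snd))
  let B : ℝ × E →L[ℝ] Γ := κ.comp (.snd ℝ ℝ E) +
    (ContinuousLinearMap.fst ℝ ℝ E).smulRight (integrate E (N (κ x₀)))
  let H' : ((ℝ × E) × Γ) ≃L[ℝ] (ℝ × E) × Γ :=
    (ContinuousLinearEquiv.refl ℝ (ℝ × E)).skewProd (.refl ℝ Γ) (-B)
  have hH' : HasFDerivAt H (H' : (ℝ × E) × Γ →L[ℝ] (ℝ × E) × Γ) ((0, x₀), κ x₀) := by
    have h1 : HasFDerivAt (fun u : (ℝ × E) × Γ => integrate E (N u.2))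
        ((integrate E).comp ((fderiv ℝ N (κ x₀)).comp (.snd ℝ _ _))) ((0, x₀), κ x₀) := by
      have h : HasFDerivAt N (fderiv ℝ N (κ x₀)) (((0, x₀), κ x₀) : (ℝ × E) × Γ).2 :=
        (hN.differentiable (by simp) (κ x₀)).hasFDerivAt
      exact (integrate E).hasFDerivAt.comp (((0, x₀), κ x₀) : (ℝ × E) × Γ)
        (h.comp (((0, x₀), κ x₀) : (ℝ × E) × Γ) hasFDerivAt_snd)
    have h2 : HasFDerivAt (fun u : (ℝ × E) × Γ => u.1.1)
        ((ContinuousLinearMap.fst ℝ ℝ E).comp (.fst ℝ _ _)) ((0, x₀), κ x₀) :=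
      ((ContinuousLinearMap.fst ℝ ℝ E).comp (.fst ℝ (ℝ × E) Γ)).hasFDerivAt
    have h3 : HasFDerivAt (fun u : (ℝ × E) × Γ => u.2 - κ u.1.2)
        (.snd ℝ _ _ - κ.comp ((ContinuousLinearMap.snd ℝ ℝ E).comp (.fst ℝ _ _)))
        ((0, x₀), κ x₀) :=
      (ContinuousLinearMap.snd ℝ (ℝ × E) Γ -
        κ.comp ((ContinuousLinearMap.snd ℝ ℝ E).comp (.fst ℝ _ _))).hasFDerivAt
    refine (hasFDerivAt_fst.prodMk (h3.sub (h2.smul h1))).congr_fderiv ?_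
    refine ContinuousLinearMap.ext fun u => Prod.ext rfl ?_
    change u.2 - κ u.1.2 - ((0 : ℝ) • _ + u.1.1 • integrate E (N (κ x₀))) =
      u.2 + -(κ u.1.2 + u.1.1 • integrate E (N (κ x₀)))
    rw [zero_smul, zero_add]
    abel
  obtain ⟨e, hae, -, heH, hesymm⟩ := exists_openPartialHomeomorph_contDiffOn_symm isOpen_univ
    hH.contDiffOn (mem_univ _) H' hH'
  have hH0 : H ((0, x₀), κ x₀) = ((0, x₀), 0) := by simp [H]
  let ψ : ℝ × E → Γ := fun w => (e.symm (w, 0)).2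
  have htarget : IsOpen {w : ℝ × E | (w, (0 : Γ)) ∈ e.target} :=
    e.open_target.preimage (by fun_prop)
  have ht0 : ((0, x₀), (0 : Γ)) ∈ e.target := by
    rw [← hH0, ← heH]; exact e.map_source hae
  have hψ0 : ψ (0, x₀) = κ x₀ := by
    have := e.left_inv hae
    rw [heH, hH0] at this
    simp only [ψ, this]
  -- `ψ w` is a solution, and the only one near `κ x₀`
  have hsol : ∀ w : ℝ × E, (w, (0 : Γ)) ∈ e.target →
      ψ w = κ w.2 + w.1 • integrate E (N (ψ w)) := by
    intro w hw
    have h1 := e.right_inv hw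
    rw [heH] at h1
    have h2 : (e.symm (w, 0)).1 = w := congrArg Prod.fst h1
    have h3 := congrArg Prod.snd h1
    simp only [H, h2] at h3
    rw [sub_eq_zero] at h3
    change (e.symm (w, 0)).2 = _
    rw [← h3]
    simp
  have huniq : ∀ (w : ℝ × E) (g : Γ), (w, g) ∈ e.source →
      g = κ w.2 + w.1 • integrate E (N g) → ψ w = g := by
    intro w g hwg hg
    have h1 : e (w, g) = (w, 0) := by
      rw [heH]
      refine Prod.ext rfl ?_
      change g - κ w.2 - w.1 • integrate E (N g) = 0
      rw [sub_sub, sub_eq_zero]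
      exact hg
    have h2 := e.left_inv hwg
    rw [h1] at h2
    simp only [ψ, h2]
  have hψs : ContDiffOn ℝ ∞ ψ {w : ℝ × E | (w, (0 : Γ)) ∈ e.target} :=
    (hesymm.comp (contDiff_prodMk_left (𝕜 := ℝ) (0 : Γ)).contDiffOn fun w hw => hw).snd
  obtain ⟨r, hr, hball⟩ := Metric.isOpen_iff.1 e.open_source _ hae
  have hnear : {w : ℝ × E | (w, (0 : Γ)) ∈ e.target} ∩ ψ ⁻¹' Metric.ball (κ x₀) r ∈ 𝓝 (0, x₀) := by
    refine (hψs.continuousOn.isOpen_inter_preimage htarget Metric.isOpen_ball).mem_nhds ⟨ht0, ?_⟩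
    simp only [mem_preimage, hψ0]
    exact Metric.mem_ball_self hr
  obtain ⟨δ, hδ, hδs⟩ := Metric.mem_nhds_iff.1 hnear
  set ε := min δ r with hε
  have hε0 : 0 < ε := lt_min hδ hr
  have hin : ∀ t ∈ Ioo (-ε) ε, ∀ x ∈ Metric.ball x₀ ε, ((t, x), (0 : Γ)) ∈ e.target ∧
      ψ (t, x) ∈ Metric.ball (κ x₀) r := by
    intro t ht x hx
    refine hδs ?_
    rw [← ball_prod_same]
    refine ⟨?_, Metric.ball_subset_ball (min_le_left _ _) hx⟩
    rw [Metric.mem_ball, dist_zero_right, Real.norm_eq_abs]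
    exact (abs_lt.2 ht).trans_le (min_le_left _ _)
  -- rescaling of time
  have hscale : ∀ h ∈ Ioo (-ε) ε, ∀ x ∈ Metric.ball x₀ ε, ∀ l : Icc (-1 : ℝ) 1,
      ψ (l * h, x) ⟨1, by norm_num⟩ = ψ (h, x) l := by
    intro h hh x hx l
    have hl : |(l : ℝ)| ≤ 1 := abs_le.2 l.2
    let m : C(Icc (-1 : ℝ) 1, Icc (-1 : ℝ) 1) :=
      ⟨fun s => ⟨l * s, abs_le.1 (by
        rw [abs_mul]; exact mul_le_one₀ hl (abs_nonneg _) (abs_le.2 s.2))⟩, by fun_prop⟩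
    have hd := (hin h hh x hx).2
    have hlh : |(l : ℝ) * h| < ε := by
      rw [abs_mul]
      exact (mul_le_of_le_one_left (abs_nonneg _) hl).trans_lt (abs_lt.2 hh)
    have hu : ψ (l * h, x) = (ψ (h, x)).comp m := by
      refine huniq _ _ (hball ?_) ?_
      · rw [← ball_prod_same, ← ball_prod_same]
        refine ⟨⟨?_, Metric.ball_subset_ball (min_le_right _ _) hx⟩, ?_⟩
        · rw [Metric.mem_ball, dist_zero_right, Real.norm_eq_abs]
          exact hlh.trans_le (min_le_right _ _)
        · rw [Metric.mem_ball, dist_eq_norm] at hd ⊢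
          refine lt_of_le_of_lt ((ContinuousMap.norm_le _ (norm_nonneg _)).2 fun s => ?_) hd
          exact (ψ (h, x) - κ x₀).norm_coe_le_norm (m s)
      · ext s
        have h1 := DFunLike.congr_fun (hsol (h, x) (hin h hh x hx).1) (m s)
        change ψ (h, x) (m s) = x + (l * h) • integrate E (N ((ψ (h, x)).comp m)) s
        refine h1.trans ?_
        change x + h • integrate E (N (ψ (h, x))) (m s) = _
        rw [mul_comm, mul_smul]
        congr 2
        rw [integrate_apply, integrate_apply]
        change ∫ τ in (0 : ℝ)..(l * s), _ = _
        rw [← mul_zero (l : ℝ), ← intervalIntegral.smul_integral_comp_mul_left, mul_zero]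
        congr 1
        refine intervalIntegral.integral_congr fun τ hτ => ?_
        have hτ1 : τ ∈ Icc (-1 : ℝ) 1 :=
          (convex_Icc (-1 : ℝ) 1).ordConnected.uIcc_subset (by norm_num) s.2 hτ
        have hτ2 : (l : ℝ) * τ ∈ Icc (-1 : ℝ) 1 := (m ⟨τ, hτ1⟩).2
        change f (ψ (h, x) (projIcc _ _ _ _)) = f (ψ (h, x) (m (projIcc _ _ _ _)))
        rw [projIcc_of_mem _ hτ1, projIcc_of_mem _ hτ2]
        rfl
    rw [hu]
    change ψ (h, x) (m ⟨1, _⟩) = _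
    congr 1
    exact Subtype.ext (mul_one _)
  refine ⟨ε, hε0, Metric.ball x₀ ε, Metric.isOpen_ball, Metric.mem_ball_self hε0,
    fun w => ψ w ⟨1, by norm_num⟩, ?_, ?_, ?_⟩
  · have hev : ContDiff ℝ ∞ fun g : Γ => g ⟨1, by norm_num⟩ :=
      (ContinuousMap.evalCLM ℝ (M := E) (⟨1, by norm_num⟩ : Icc (-1 : ℝ) 1)).contDiff
    exact hev.comp_contDiffOn (hψs.mono fun w hw => (hin w.1 hw.1 w.2 hw.2).1)
  · intro x hx
    have h := hsol (0, x) (hin 0 ⟨by linarith, hε0⟩ x hx).1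
    rw [zero_smul, add_zero] at h
    simp only [h]
    rfl
  · intro t ht x hx
    -- rescale from a time `h` that is larger than `|t|`
    obtain ⟨h, hth, hhε⟩ := exists_between (abs_lt.2 ht)
    have h0 : 0 < h := (abs_nonneg t).trans_lt hth
    have hh : h ∈ Ioo (-ε) ε := ⟨by linarith, hhε⟩
    have hmem : ∀ s : ℝ, |s| < h → s / h ∈ Icc (-1 : ℝ) 1 := fun s hs => abs_le.1 (by
      rw [abs_div, abs_of_pos h0]; exact (div_le_one h0).2 hs.le)
    have hφ : ∀ s : ℝ, |s| < h →
        ψ (s, x) ⟨1, by norm_num⟩ = ψ (h, x) (projIcc (-1) 1 (by norm_num) (s / h)) := by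
      intro s hs
      have := hscale h hh x hx ⟨s / h, hmem s hs⟩
      rw [div_mul_cancel₀ _ h0.ne'] at this
      rw [this, projIcc_of_mem _ (hmem s hs)]
    have hψ' : ∀ s : ℝ, |s| < h → ψ (s, x) ⟨1, by norm_num⟩ =
        x + h • ∫ τ in (0 : ℝ)..(s / h), f (ψ (h, x) (projIcc (-1) 1 (by norm_num) τ)) := by
      intro s hs
      rw [hφ s hs, projIcc_of_mem _ (hmem s hs)]
      exact DFunLike.congr_fun (hsol (h, x) (hin h hh x hx).1) _
    have hc : Continuous fun τ : ℝ => f (ψ (h, x) (projIcc (-1) 1 (by norm_num) τ)) :=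
      hf.continuous.comp ((ψ (h, x)).continuous.comp continuous_projIcc)
    have hd : HasDerivAt (fun s : ℝ => x + h • ∫ τ in (0 : ℝ)..(s / h),
        f (ψ (h, x) (projIcc (-1) 1 (by norm_num) τ)))
        (h • ((1 / h) • f (ψ (h, x) (projIcc (-1) 1 (by norm_num) (t / h))))) t := by
      have h1 := intervalIntegral.integral_hasDerivAt_right (hc.intervalIntegrable 0 (t / h))
        hc.stronglyMeasurable.stronglyMeasurableAtFilter hc.continuousAt
      exact ((h1.scomp t ((hasDerivAt_id t).div_const h)).const_smul h).const_add x
    rw [smul_smul, mul_one_div_cancel h0.ne', one_smul, ← hφ t hth] at hd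
    refine hd.congr_of_eventuallyEq ?_
    filter_upwards [(isOpen_lt continuous_abs continuous_const).mem_nhds hth] with s hs
    exact hψ' s hs

/-- The local flow of a vector field that is smooth on an open set: a bump function extends the
vector field smoothly to the whole space without changing it near `x₀`. -/
theorem exists_local_flow [FiniteDimensional ℝ E] {f : E → E} {U : Set E} (hU : IsOpen U)
    (hf : ContDiffOn ℝ ∞ f U) {x₀ : E} (hx₀ : x₀ ∈ U) :
    ∃ ε > 0, ∃ W : Set E, IsOpen W ∧ x₀ ∈ W ∧ ∃ φ : ℝ × E → E,
      ContDiffOn ℝ ∞ φ (Ioo (-ε) ε ×ˢ W) ∧ (∀ x ∈ W, φ (0, x) = x) ∧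
      ∀ t ∈ Ioo (-ε) ε, ∀ x ∈ W,
        φ (t, x) ∈ U ∧ HasDerivAt (fun t => φ (t, x)) (f (φ (t, x))) t := by
  obtain ⟨R, hR, hRU⟩ := Metric.isOpen_iff.1 hU x₀ hx₀
  let χ : ContDiffBump x₀ := ⟨R / 3, R / 2, by positivity, by linarith⟩
  have hχ : ContDiff ℝ ∞ fun x => χ x • f x := by
    refine contDiff_iff_contDiffAt.2 fun x => ?_
    by_cases hx : x ∈ U
    · exact χ.contDiff.contDiffAt.smul (hf.contDiffAt (hU.mem_nhds hx))
    · have h0 : (fun x => χ x • f x) =ᶠ[𝓝 x] fun _ => 0 := by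
        have hxs : x ∉ tsupport χ := by
          rw [χ.tsupport_eq]
          exact fun h => hx (hRU (Metric.closedBall_subset_ball (by simp [χ, hR]) h))
        filter_upwards [(isClosed_tsupport χ).isOpen_compl.mem_nhds hxs] with y hy
        rw [image_eq_zero_of_notMem_tsupport hy, zero_smul]
      exact contDiffAt_const.congr_of_eventuallyEq h0
  obtain ⟨ε, hε, W, hW, hxW, φ, hφ, hφ0, hφd⟩ := exists_local_flow_of_contDiff hχ x₀
  have hopen : IsOpen (Ioo (-ε) ε ×ˢ W) := isOpen_Ioo.prod hW
  have h0 : ((0 : ℝ), x₀) ∈ Ioo (-ε) ε ×ˢ W := ⟨⟨by linarith, hε⟩, hxW⟩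
  have hn : (Ioo (-ε) ε ×ˢ W) ∩ φ ⁻¹' Metric.ball x₀ (R / 3) ∈ 𝓝 ((0 : ℝ), x₀) := by
    refine (hφ.continuousOn.isOpen_inter_preimage hopen Metric.isOpen_ball).mem_nhds ⟨h0, ?_⟩
    simp only [mem_preimage, hφ0 _ hxW]
    exact Metric.mem_ball_self (by positivity)
  obtain ⟨δ, hδ, hδs⟩ := Metric.mem_nhds_iff.1 hn
  have hδ' : ∀ t ∈ Ioo (-δ) δ, ∀ x ∈ Metric.ball x₀ δ, (t, x) ∈
      (Ioo (-ε) ε ×ˢ W) ∩ φ ⁻¹' Metric.ball x₀ (R / 3) := by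
    intro t ht x hx
    refine hδs ?_
    rw [← ball_prod_same]
    refine ⟨?_, hx⟩
    rw [Metric.mem_ball, dist_zero_right, Real.norm_eq_abs]
    exact abs_lt.2 ht
  refine ⟨δ, hδ, Metric.ball x₀ δ, Metric.isOpen_ball, Metric.mem_ball_self hδ, φ,
    hφ.mono fun w hw => (hδ' w.1 hw.1 w.2 hw.2).1,
    fun x hx => hφ0 x (hδ' 0 ⟨by linarith, hδ⟩ x hx).1.2, fun t ht x hx => ?_⟩
  have h := hδ' t ht x hx
  have hb : φ (t, x) ∈ Metric.ball x₀ (R / 3) := h.2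
  refine ⟨hRU (Metric.ball_subset_ball (by linarith) hb), ?_⟩
  have hd := hφd t h.1.1 x h.1.2
  have h1 : χ (φ (t, x)) = 1 := χ.one_of_mem_closedBall (Metric.ball_subset_closedBall hb)
  rwa [h1, one_smul] at hd

end LocalFlow

/-! ### The equation of variation -/

section Variation

variable {E : Type*} [NormedAddCommGroup E] [NormedSpace ℝ E]

/-- The equation of variation: `y(t) = ∂φ/∂x · δ` solves `y' = Df(φ) y`. -/
theorem hasDerivAt_fderiv_flow {f : E → E} {U : Set E} (hU : IsOpen U) (hf : ContDiffOn ℝ ∞ f U)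
    {T : Set ℝ} (hT : IsOpen T) {W : Set E} (hW : IsOpen W) {φ : ℝ × E → E}
    (hφ : ContDiffOn ℝ ∞ φ (T ×ˢ W))
    (hφd : ∀ t ∈ T, ∀ x ∈ W, φ (t, x) ∈ U ∧ HasDerivAt (fun t => φ (t, x)) (f (φ (t, x))) t)
    {t : ℝ} (ht : t ∈ T) {x : E} (hx : x ∈ W) (d : E) :
    HasDerivAt (fun t => fderiv ℝ φ (t, x) (0, d))
      (fderiv ℝ f (φ (t, x)) (fderiv ℝ φ (t, x) (0, d))) t := by
  have hO : IsOpen (T ×ˢ W) := hT.prod hW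
  have hmem : (t, x) ∈ T ×ˢ W := ⟨ht, hx⟩
  have hφa : ∀ w ∈ T ×ˢ W, ContDiffAt ℝ ∞ φ w := fun w hw => hφ.contDiffAt (hO.mem_nhds hw)
  have hφda : ∀ w ∈ T ×ˢ W, DifferentiableAt ℝ φ w := fun w hw =>
    (hφa w hw).differentiableAt (by simp)
  have hD : DifferentiableAt ℝ (fderiv ℝ φ) (t, x) :=
    ((hφa _ hmem).fderiv_right (m := ∞) (by simp)).differentiableAt (by simp)
  have hsymm : IsSymmSndFDerivAt ℝ φ (t, x) :=
    (hφa _ hmem).isSymmSndFDerivAt (by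
      rw [minSmoothness_of_isRCLikeNormedField]; exact WithTop.coe_le_coe.2 (le_top : (2 : ℕ∞) ≤ ⊤))
  -- the time derivative of `φ` is `f ∘ φ`
  have htime : ∀ w ∈ T ×ˢ W, fderiv ℝ φ w (1, 0) = f (φ w) := by
    rintro ⟨s, y⟩ hw
    have h1 : HasDerivAt (fun s => φ (s, y)) (fderiv ℝ φ (s, y) (1, 0)) s :=
      (hφda (s, y) hw).hasFDerivAt.comp_hasDerivAt s
        ((hasDerivAt_id s).prodMk (hasDerivAt_const s y))
    exact h1.unique (hφd s hw.1 y hw.2).2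
  have h0 : HasDerivAt (fun t => fderiv ℝ φ (t, x)) (fderiv ℝ (fderiv ℝ φ) (t, x) (1, 0)) t :=
    hD.hasFDerivAt.comp_hasDerivAt t ((hasDerivAt_id t).prodMk (hasDerivAt_const t x))
  have h1 : HasDerivAt (fun t => fderiv ℝ φ (t, x) (0, d))
      (fderiv ℝ (fderiv ℝ φ) (t, x) (1, 0) (0, d)) t :=
    (ContinuousLinearMap.apply ℝ E ((0 : ℝ), d)).hasFDerivAt.comp_hasDerivAt t h0
  have h2 : HasFDerivAt (fun w => fderiv ℝ φ w (1, 0))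
      ((ContinuousLinearMap.apply ℝ E ((1 : ℝ), (0 : E))).comp (fderiv ℝ (fderiv ℝ φ) (t, x)))
      (t, x) :=
    (ContinuousLinearMap.apply ℝ E ((1 : ℝ), (0 : E))).hasFDerivAt.comp (t, x) hD.hasFDerivAt
  have hfd : HasFDerivAt f (fderiv ℝ f (φ (t, x))) (φ (t, x)) :=
    ((hf.contDiffAt (hU.mem_nhds (hφd t ht x hx).1)).differentiableAt (by simp)).hasFDerivAt
  have h3 : HasFDerivAt (fun w => fderiv ℝ φ w (1, 0))
      ((fderiv ℝ f (φ (t, x))).comp (fderiv ℝ φ (t, x))) (t, x) := by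
    refine (hfd.comp (t, x) (hφda _ hmem).hasFDerivAt).congr_of_eventuallyEq ?_
    filter_upwards [hO.mem_nhds hmem] with w hw using htime w hw
  have h4 := DFunLike.congr_fun (h2.unique h3) ((0 : ℝ), d)
  refine h1.congr_deriv ?_
  rw [hsymm.eq]
  exact h4

/-- At time `0`, the derivative of a flow with respect to the initial value is the identity. -/
theorem fderiv_flow_zero {T : Set ℝ} (hT : IsOpen T) (h0 : (0 : ℝ) ∈ T) {W : Set E} (hW : IsOpen W)
    {φ : ℝ × E → E} (hφ : ContDiffOn ℝ ∞ φ (T ×ˢ W)) (hφ0 : ∀ x ∈ W, φ (0, x) = x) {x : E}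
    (hx : x ∈ W) (d : E) : fderiv ℝ φ (0, x) (0, d) = d := by
  have h1 : HasFDerivAt (fun y => φ (0, y)) ((fderiv ℝ φ (0, x)).comp (.inr ℝ ℝ E)) x := by
    have h2 : HasFDerivAt φ (fderiv ℝ φ (0, x)) (0, x) := ((hφ.contDiffAt
      ((hT.prod hW).mem_nhds ⟨h0, hx⟩)).differentiableAt (by simp)).hasFDerivAt
    exact h2.comp x (hasFDerivAt_prodMk_right (0 : ℝ) x)
  have h2 : HasFDerivAt (fun y => φ (0, y)) (ContinuousLinearMap.id ℝ E) x :=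
    (hasFDerivAt_id x).congr_of_eventuallyEq
      (by filter_upwards [hW.mem_nhds hx] with y hy using hφ0 y hy)
  exact DFunLike.congr_fun (h1.unique h2) d

/-- If the Lie derivative of a one-form `α` along a vector field `f` is a multiple of `α`, then the
flow of `f` preserves the kernel of `α`. -/
theorem flow_preserves_ker {f : E → E} {U : Set E} (hU : IsOpen U) (hf : ContDiffOn ℝ ∞ f U)
    {α : E → E →L[ℝ] ℝ} (hα : ∀ y ∈ U, DifferentiableAt ℝ α y) {g : E → ℝ} (hg : ContinuousOn g U)
    (hlie : ∀ y ∈ U, ∀ w, fderiv ℝ α y (f y) w + α y (fderiv ℝ f y w) = g y * α y w)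
    {ε : ℝ} {W : Set E} (hW : IsOpen W) {φ : ℝ × E → E}
    (hφ : ContDiffOn ℝ ∞ φ (Ioo (-ε) ε ×ˢ W)) (hφ0 : ∀ x ∈ W, φ (0, x) = x)
    (hφd : ∀ t ∈ Ioo (-ε) ε, ∀ x ∈ W,
      φ (t, x) ∈ U ∧ HasDerivAt (fun t => φ (t, x)) (f (φ (t, x))) t)
    {x : E} (hx : x ∈ W) {d : E} (hd : α x d = 0) {t : ℝ} (ht : t ∈ Ico 0 ε) :
    α (φ (t, x)) (fderiv ℝ φ (t, x) (0, d)) = 0 := by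
  have hIcc : ∀ s ∈ Icc 0 t, s ∈ Ioo (-ε) ε := fun s hs =>
    ⟨by linarith [hs.1, ht.1, ht.2], hs.2.trans_lt ht.2⟩
  have h0 : (0 : ℝ) ∈ Ioo (-ε) ε := hIcc 0 ⟨le_rfl, ht.1⟩
  let w : ℝ → ℝ := fun s => α (φ (s, x)) (fderiv ℝ φ (s, x) (0, d))
  have hw : ∀ s ∈ Ioo (-ε) ε, HasDerivAt w (g (φ (s, x)) * w s) s := by
    intro s hs
    have h := hφd s hs x hx
    have h1 : HasDerivAt (fun s => α (φ (s, x))) (fderiv ℝ α (φ (s, x)) (f (φ (s, x)))) s :=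
      (hα _ h.1).hasFDerivAt.comp_hasDerivAt s h.2
    have h2 := hasDerivAt_fderiv_flow hU hf isOpen_Ioo hW hφ hφd hs hx d
    exact (h1.clm_apply h2).congr_deriv (hlie _ h.1 _)
  have hw0 : w 0 = 0 := by
    simp only [w, fderiv_flow_zero isOpen_Ioo h0 hW hφ hφ0 hx, hφ0 x hx, hd]
  have hcont : ContinuousOn (fun s => g (φ (s, x))) (Icc 0 t) :=
    hg.comp (fun s hs => (hφd s (hIcc s hs) x hx).2.continuousAt.continuousWithinAt)
      fun s hs => (hφd s (hIcc s hs) x hx).1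
  -- Gronwall's inequality for `w' = g w`
  obtain ⟨K, hK⟩ := isCompact_Icc.exists_bound_of_continuousOn hcont
  refine eq_zero_of_abs_deriv_le_mul_abs_self_of_eq_zero_right (f := w)
    (f' := fun s => g (φ (s, x)) * w s) (K := K) (a := 0) (b := t)
    (fun s hs => (hw s (hIcc s hs)).continuousAt.continuousWithinAt)
    (fun s hs => (hw s (hIcc s (Ico_subset_Icc_self hs))).hasDerivWithinAt) hw0 (fun s hs => ?_) t
    ⟨ht.1, le_rfl⟩
  rw [norm_mul]
  exact mul_le_mul_of_nonneg_right (hK s (Ico_subset_Icc_self hs)) (norm_nonneg _)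

end Variation

/-! ### Vector fields and integral curves in charts -/

section Charts

set_option linter.unusedSectionVars false

variable {F : Type*} [NormedAddCommGroup F] [NormedSpace ℝ F]
  {G : Type*} [TopologicalSpace G] (J : ModelWithCorners ℝ F G) [J.Boundaryless]
  {M : Type*} [TopologicalSpace M] [ChartedSpace G M] [IsManifold J ∞ M]

theorem hasMFDerivAt_extChartAt' {x₀ x : M} (hx : x ∈ (extChartAt J x₀).source) :
    HasMFDerivAt J 𝓘(ℝ, F) (extChartAt J x₀) x (mfderiv J 𝓘(ℝ, F) (extChartAt J x₀) x) := by
  have : IsManifold J 1 M := .of_le (n := ∞) (by simp)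
  exact (mdifferentiableAt_extChartAt (by rwa [extChartAt_source] at hx)).hasMFDerivAt

theorem hasMFDerivAt_extChartAt_symm {x₀ : M} {y : F} (hy : y ∈ (extChartAt J x₀).target) :
    HasMFDerivAt 𝓘(ℝ, F) J (extChartAt J x₀).symm y
      (mfderiv 𝓘(ℝ, F) J (extChartAt J x₀).symm y) := by
  have : IsManifold J 1 M := .of_le (n := ∞) (by simp)
  have h := mdifferentiableWithinAt_extChartAt_symm (I := J) hy
  rw [J.range_eq_univ, mdifferentiableWithinAt_univ] at h
  exact h.hasMFDerivAt

theorem mfderiv_extChartAt_symm_apply {x₀ : M} {y : F} (hy : y ∈ (extChartAt J x₀).target)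
    (v : F) : mfderiv J 𝓘(ℝ, F) (extChartAt J x₀) ((extChartAt J x₀).symm y)
      (mfderiv 𝓘(ℝ, F) J (extChartAt J x₀).symm y v) = v := by
  have : IsManifold J 1 M := .of_le (n := ∞) (by simp)
  have h := mfderiv_extChartAt_comp_mfderivWithin_extChartAt_symm (I := J) hy
  rw [J.range_eq_univ, mfderivWithin_univ] at h
  exact DFunLike.congr_fun h v

theorem mfderiv_symm_extChartAt_apply {x₀ x : M} (hx : x ∈ (extChartAt J x₀).source)
    (v : TangentSpace J x) : mfderiv 𝓘(ℝ, F) J (extChartAt J x₀).symm (extChartAt J x₀ x)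
      (mfderiv J 𝓘(ℝ, F) (extChartAt J x₀) x v) = v := by
  have : IsManifold J 1 M := .of_le (n := ∞) (by simp)
  have h := mfderivWithin_extChartAt_symm_comp_mfderiv_extChartAt' (I := J) hx
  rw [J.range_eq_univ, mfderivWithin_univ] at h
  exact DFunLike.congr_fun h v

/-- The derivative at `x` of the chart at `x₀`, with values in the model space. -/
def chartDeriv (x₀ x : M) : TangentSpace J x →L[ℝ] F := mfderiv J 𝓘(ℝ, F) (extChartAt J x₀) x

/-- The derivative at `y` of the inverse of the chart at `x₀`, defined on the model space. -/
def chartDerivSymm (x₀ : M) (y : F) : F →L[ℝ] TangentSpace J ((extChartAt J x₀).symm y) :=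
  mfderiv 𝓘(ℝ, F) J (extChartAt J x₀).symm y

/-- The coordinate expression of a vector field in the chart at `x₀`. -/
def chartField (X : (x : M) → TangentSpace J x) (x₀ : M) (y : F) : F :=
  mfderiv J 𝓘(ℝ, F) (extChartAt J x₀) ((extChartAt J x₀).symm y) (X ((extChartAt J x₀).symm y))

/-- A vector field is smooth if its expressions in all charts are. -/
def IsSmoothField (X : (x : M) → TangentSpace J x) : Prop :=
  ∀ x₀ : M, ContDiffOn ℝ ∞ (chartField J X x₀) (extChartAt J x₀).target

variable {J}
variable {X : (x : M) → TangentSpace J x}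

theorem hasDerivWithinAt_extChartAt_comp {γ : ℝ → M} {s : Set ℝ} {t : ℝ} {x₀ : M}
    (ht : γ t ∈ (extChartAt J x₀).source)
    (hγ : HasMFDerivWithinAt 𝓘(ℝ, ℝ) J γ s t ((1 : ℝ →L[ℝ] ℝ).smulRight (X (γ t)))) :
    HasDerivWithinAt (fun s => extChartAt J x₀ (γ s))
      (chartField J X x₀ (extChartAt J x₀ (γ t))) s t := by
  have h := (hasMFDerivAt_extChartAt' J ht).comp_hasMFDerivWithinAt t hγ
  have h1 : chartField J X x₀ (extChartAt J x₀ (γ t)) =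
      mfderiv J 𝓘(ℝ, F) (extChartAt J x₀) (γ t) (X (γ t)) := by
    rw [chartField, (extChartAt J x₀).left_inv ht]
  have h2 : HasFDerivWithinAt (fun s => extChartAt J x₀ (γ s))
      ((1 : ℝ →L[ℝ] ℝ).smulRight (chartField J X x₀ (extChartAt J x₀ (γ t)))) s t := by
    refine (h.congr_mfderiv (ContinuousLinearMap.ext fun a => ?_)).hasFDerivWithinAt
    rw [h1]
    exact (mfderiv J 𝓘(ℝ, F) (extChartAt J x₀) (γ t)).map_smul (show ℝ from a) (X (γ t))
  have h3 := h2.hasDerivWithinAt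
  rwa [ContinuousLinearMap.smulRight_apply, one_apply_eq_self, one_smul] at h3

theorem hasMFDerivAt_extChartAt_symm_comp {c : ℝ → F} {t : ℝ} {x₀ : M}
    (ht : c t ∈ (extChartAt J x₀).target) (hc : HasDerivAt c (chartField J X x₀ (c t)) t) :
    HasMFDerivAt 𝓘(ℝ, ℝ) J (fun s => (extChartAt J x₀).symm (c s)) t
      ((1 : ℝ →L[ℝ] ℝ).smulRight (X ((extChartAt J x₀).symm (c t)))) := by
  have h := (hasMFDerivAt_extChartAt_symm J ht).comp t hc.hasFDerivAt.hasMFDerivAt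
  refine h.congr_mfderiv (ContinuousLinearMap.ext fun a => ?_)
  have h2 := mfderiv_symm_extChartAt_apply J ((extChartAt J x₀).map_target ht)
    (X ((extChartAt J x₀).symm (c t)))
  rw [(extChartAt J x₀).right_inv ht] at h2
  have h3 := (show F →L[ℝ] TangentSpace J ((extChartAt J x₀).symm (c t)) from
    mfderiv 𝓘(ℝ, F) J (extChartAt J x₀).symm (c t)).map_smul (show ℝ from a)
    (chartField J X x₀ (c t))
  exact h3.trans (congrArg (fun v => (show ℝ from a) • v) h2)

/-- Integral curves on a closed interval, with one-sided derivatives at the ends, are determined by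
their initial value. -/
theorem IsSmoothField.eqOn_of_isMIntegralCurveOn_Icc [T2Space M] (hX : IsSmoothField J X)
    {γ γ' : ℝ → M} {a b : ℝ} (hγ : IsMIntegralCurveOn γ X (Icc a b))
    (hγ' : IsMIntegralCurveOn γ' X (Icc a b)) (ha : γ a = γ' a) : EqOn γ γ' (Icc a b) := by
  by_cases hab : a ≤ b
  swap
  · rw [Icc_eq_empty hab]; exact eqOn_empty _ _
  refine IsClosed.Icc_subset_of_forall_exists_gt (s := {t | γ t = γ' t}) ?_ ha ?_
  · rw [inter_comm]
    have h := (hγ.continuousOn.prodMk hγ'.continuousOn).preimage_isClosed_of_isClosed isClosed_Icc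
      isClosed_diagonal
    exact h
  rintro t ⟨hte, hta, htb⟩ u (htu : t < u)
  set x₀ := γ t with hx₀
  have hte' : γ' t = x₀ := hte.symm
  have htab : t ∈ Icc a b := ⟨hta, htb.le⟩
  have htgt : (extChartAt J x₀).target ∈ 𝓝 (extChartAt J x₀ x₀) := extChartAt_target_mem_nhds x₀
  obtain ⟨K, S, hS, hlip⟩ := (((hX x₀).contDiffAt htgt).of_le
    (m := 1) (by exact_mod_cast le_top)).exists_lipschitzOnWith
  have hSn : (extChartAt J x₀).source ∩ extChartAt J x₀ ⁻¹' S ∈ 𝓝 x₀ :=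
    inter_mem (extChartAt_source_mem_nhds x₀) ((continuousAt_extChartAt x₀).preimage_mem_nhds hS)
  have h1 : γ ⁻¹' ((extChartAt J x₀).source ∩ extChartAt J x₀ ⁻¹' S) ∈ 𝓝[Icc a b] t :=
    hγ.continuousOn t htab hSn
  have h2 : γ' ⁻¹' ((extChartAt J x₀).source ∩ extChartAt J x₀ ⁻¹' S) ∈ 𝓝[Icc a b] t :=
    hγ'.continuousOn t htab (by rw [hte']; exact hSn)
  obtain ⟨r, hr, hrs⟩ := Metric.mem_nhdsWithin_iff.1 (inter_mem h1 h2)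
  set b' := min (min (t + r / 2) u) b with hb'
  have htb' : t < b' := lt_min (lt_min (by linarith) htu) htb
  have hsub : Icc t b' ⊆ Icc a b := Icc_subset_Icc hta (min_le_right _ _)
  have hin : ∀ s ∈ Icc t b', s ∈ Metric.ball t r ∩ Icc a b := fun s hs => by
    refine ⟨?_, hsub hs⟩
    have : b' ≤ t + r / 2 := (min_le_left _ _).trans (min_le_left _ _)
    rw [Metric.mem_ball, Real.dist_eq, abs_of_nonneg (by linarith [hs.1])]
    linarith [hs.2]
  have key : ∀ δ : ℝ → M, IsMIntegralCurveOn δ X (Icc a b) →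
      (∀ s ∈ Icc t b', δ s ∈ (extChartAt J x₀).source ∩ extChartAt J x₀ ⁻¹' S) →
      ContinuousOn (fun s => extChartAt J x₀ (δ s)) (Icc t b') ∧
      ∀ s ∈ Ico t b', HasDerivWithinAt (fun s => extChartAt J x₀ (δ s))
        (chartField J X x₀ (extChartAt J x₀ (δ s))) (Ici s) s := by
    intro δ hδ hδS
    have hd : ∀ s ∈ Icc t b', HasDerivWithinAt (fun s => extChartAt J x₀ (δ s))
        (chartField J X x₀ (extChartAt J x₀ (δ s))) (Icc t b') s := fun s hs =>
      (hasDerivWithinAt_extChartAt_comp (hδS s hs).1 (hδ s (hsub hs))).mono hsub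
    refine ⟨fun s hs => (hd s hs).continuousWithinAt, fun s hs => ?_⟩
    exact (hd s (Ico_subset_Icc_self hs)).mono_of_mem_nhdsWithin (Icc_mem_nhdsGE_of_mem hs)
  have k1 := key γ hγ fun s hs => (hrs (hin s hs)).1
  have k2 := key γ' hγ' fun s hs => (hrs (hin s hs)).2
  have heq := ODE_solution_unique_of_mem_Icc_right (v := fun _ => chartField J X x₀)
    (s := fun _ => S) (K := K) (fun _ _ => hlip) k1.1 k1.2
    (fun s hs => (hrs (hin s (Ico_subset_Icc_self hs))).1.2) k2.1 k2.2
    (fun s hs => (hrs (hin s (Ico_subset_Icc_self hs))).2.2) (congrArg (extChartAt J x₀) hte)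
  have hb'mem : b' ∈ Icc t b' := ⟨htb'.le, le_rfl⟩
  refine ⟨b', ?_, htb', (min_le_left _ _).trans (min_le_right _ _)⟩
  exact (extChartAt J x₀).injOn (hrs (hin b' hb'mem)).1.1 (hrs (hin b' hb'mem)).2.1 (heq hb'mem)

end Charts

/-! ### The exterior derivative does not depend on the chart -/

section ExteriorDerivative

variable {F : Type*} [NormedAddCommGroup F] [NormedSpace ℝ F]
  {G : Type*} [TopologicalSpace G] {J : ModelWithCorners ℝ F G} [J.Boundaryless]
  {M : Type*} [TopologicalSpace M] [ChartedSpace G M] [IsManifold J ∞ M]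

theorem chartForm_mfderiv_apply (α : (x : M) → TangentSpace J x →L[ℝ] ℝ) {x₀ x : M}
    (hx : x ∈ (extChartAt J x₀).source) (v : TangentSpace J x) :
    chartForm J α x₀ (extChartAt J x₀ x) (chartDeriv J x₀ x v) = α x v := by
  have h := mfderiv_symm_extChartAt_apply J hx v
  have h2 := (extChartAt J x₀).left_inv hx
  change α ((extChartAt J x₀).symm (extChartAt J x₀ x)) (mfderiv 𝓘(ℝ, F) J (extChartAt J x₀).symm
    (extChartAt J x₀ x) (mfderiv J 𝓘(ℝ, F) (extChartAt J x₀) x v)) = α x v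
  refine (congrArg (α ((extChartAt J x₀).symm (extChartAt J x₀ x))) h).trans ?_
  -- the base points agree, and the tangent spaces are all the model space
  exact congrArg (fun p : M => (α p : F →L[ℝ] ℝ) v) h2

/-- The exterior derivative of a one-form may be computed in any chart: it is natural under the
change of charts `κ`, as the second derivative of `κ` is symmetric. -/
theorem extDerivOneForm_eq (α : (x : M) → TangentSpace J x →L[ℝ] ℝ) {x₀ x : M}
    (hx : x ∈ (extChartAt J x₀).source)
    (hα : DifferentiableAt ℝ (chartForm J α x₀) (extChartAt J x₀ x)) (u w : TangentSpace J x) :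
    extDerivOneForm J α x u w =
      fderiv ℝ (chartForm J α x₀) (extChartAt J x₀ x) (chartDeriv J x₀ x u) (chartDeriv J x₀ x w) -
      fderiv ℝ (chartForm J α x₀) (extChartAt J x₀ x) (chartDeriv J x₀ x w)
        (chartDeriv J x₀ x u) := by
  set y₀ := extChartAt J x x with hy₀
  have hy₀t : y₀ ∈ (extChartAt J x).target := mem_extChartAt_target x
  have hsx : (extChartAt J x).symm y₀ = x := extChartAt_to_inv x
  let κ : F → F := fun y => extChartAt J x₀ ((extChartAt J x).symm y)
  have hκ : ContDiffAt ℝ ∞ κ y₀ := by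
    rw [← contMDiffAt_iff_contDiffAt]
    have h1 : ContMDiffAt 𝓘(ℝ, F) J ∞ (extChartAt J x).symm y₀ :=
      (contMDiffOn_extChartAt_symm x).contMDiffAt (extChartAt_target_mem_nhds x)
    refine ContMDiffAt.comp (I' := J) (g := extChartAt J x₀) y₀ ?_ h1
    rw [hsx]
    exact contMDiffAt_extChartAt' (by rwa [extChartAt_source] at hx)
  have hO : ∀ᶠ y in 𝓝 y₀, y ∈ (extChartAt J x).target ∧
      (extChartAt J x).symm y ∈ (extChartAt J x₀).source := by
    refine Filter.Eventually.and (extChartAt_target_mem_nhds x) ?_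
    refine (continuousAt_extChartAt_symm x).preimage_mem_nhds ?_
    rw [hsx]
    exact (isOpen_extChartAt_source x₀).mem_nhds hx
  have hDκ : ∀ y, y ∈ (extChartAt J x).target → (extChartAt J x).symm y ∈ (extChartAt J x₀).source →
      ∀ v : F, fderiv ℝ κ y v =
        chartDeriv J x₀ ((extChartAt J x).symm y) (chartDerivSymm J x y v) := by
    intro y hy hy' v
    have h := (hasMFDerivAt_extChartAt' J hy').comp y (hasMFDerivAt_extChartAt_symm J hy)
    have h' : HasFDerivAt κ ((chartDeriv J x₀ ((extChartAt J x).symm y)).comp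
      (chartDerivSymm J x y)) y := h.hasFDerivAt
    exact DFunLike.congr_fun h'.fderiv v
  have hpull : chartForm J α x =ᶠ[𝓝 y₀] fun y => (chartForm J α x₀ (κ y)).comp (fderiv ℝ κ y) := by
    filter_upwards [hO] with y hy
    ext v
    rw [ContinuousLinearMap.comp_apply, hDκ y hy.1 hy.2]
    exact (chartForm_mfderiv_apply α hy.2 _).symm
  have hD2 : DifferentiableAt ℝ (fderiv ℝ κ) y₀ :=
    (hκ.fderiv_right (m := ∞) (by simp)).differentiableAt (by simp)
  have hsymm : IsSymmSndFDerivAt ℝ κ y₀ := hκ.isSymmSndFDerivAt (by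
    rw [minSmoothness_of_isRCLikeNormedField]; exact WithTop.coe_le_coe.2 (le_top : (2 : ℕ∞) ≤ ⊤))
  have hκ0 : κ y₀ = extChartAt J x₀ x := by simp only [κ, hsx]
  have hA : HasFDerivAt (fun y => chartForm J α x₀ (κ y))
      ((fderiv ℝ (chartForm J α x₀) (κ y₀)).comp (fderiv ℝ κ y₀)) y₀ := by
    rw [← hκ0] at hα
    exact hα.hasFDerivAt.comp y₀ (hκ.differentiableAt (by simp)).hasFDerivAt
  have hform : ∀ a b : F, fderiv ℝ (chartForm J α x) y₀ a b =
      fderiv ℝ (chartForm J α x₀) (κ y₀) (fderiv ℝ κ y₀ a) (fderiv ℝ κ y₀ b) +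
        chartForm J α x₀ (κ y₀) (fderiv ℝ (fderiv ℝ κ) y₀ a b) := by
    intro a b
    rw [hpull.fderiv_eq, (hA.clm_comp hD2.hasFDerivAt).fderiv]
    simp [add_comm]
  have hT : ∀ v : TangentSpace J x, fderiv ℝ κ y₀ (chartDeriv J x x v) = chartDeriv J x₀ x v := by
    intro v
    rw [hDκ y₀ hy₀t (by rwa [hsx])]
    have h1 := mfderiv_symm_extChartAt_apply J (mem_extChartAt_source (I := J) x) v
    refine (congrArg (chartDeriv J x₀ ((extChartAt J x).symm y₀)) h1).trans ?_
    exact congrArg (fun p : M => (chartDeriv J x₀ p : F →L[ℝ] F) v) hsx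
  change fderiv ℝ (chartForm J α x) y₀ (chartDeriv J x x u) (chartDeriv J x x w) -
    fderiv ℝ (chartForm J α x) y₀ (chartDeriv J x x w) (chartDeriv J x x u) = _
  rw [hform, hform, hT, hT, hsymm.eq, hκ0]
  abel

end ExteriorDerivative

/-! ### Flows that preserve the kernel of a one-form -/

section ManifoldFlow

set_option linter.unusedSectionVars false

variable {F : Type*} [NormedAddCommGroup F] [NormedSpace ℝ F] [FiniteDimensional ℝ F]
  {G : Type*} [TopologicalSpace G] {J : ModelWithCorners ℝ F G} [J.Boundaryless]
  {M : Type*} [TopologicalSpace M] [ChartedSpace G M] [IsManifold J ∞ M]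
  {X : (x : M) → TangentSpace J x}

/-- The Lie derivative of the one-form `α` along the vector field `X` is a multiple `g α` of `α`,
in the charts of `M`. -/
def LieDerivProportional (X : (x : M) → TangentSpace J x) (α : (x : M) → TangentSpace J x →L[ℝ] ℝ) :
    Prop :=
  ∀ x₀ : M, (∀ y ∈ (extChartAt J x₀).target, DifferentiableAt ℝ (chartForm J α x₀) y) ∧
    ∃ g : F → ℝ, ContinuousOn g (extChartAt J x₀).target ∧ ∀ y ∈ (extChartAt J x₀).target, ∀ w : F,
      fderiv ℝ (chartForm J α x₀) y (chartField J X x₀ y) w +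
        chartForm J α x₀ y (fderiv ℝ (chartField J X x₀) y w) = g y * chartForm J α x₀ y w

/-- A local flow of `X` near `p`, up to time `ε`, that is differentiable in the initial value and
preserves the kernel of `α`. -/
def HasLocalFlow (X : (x : M) → TangentSpace J x) (α : (x : M) → TangentSpace J x →L[ℝ] ℝ)
    (ε : ℝ) (p : M) : Prop :=
  ∃ W : Set M, IsOpen W ∧ p ∈ W ∧ ∃ θ : ℝ → M → M, ∀ y ∈ W, θ 0 y = y ∧
    IsMIntegralCurveOn (fun t => θ t y) X (Ico 0 ε) ∧
    ∀ t ∈ Ico 0 ε, MDifferentiableAt J J (θ t) y ∧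
      ∀ v : TangentSpace J y, α y v = 0 → α (θ t y) (mfderiv J J (θ t) y v) = 0

theorem HasLocalFlow.mono {α : (x : M) → TangentSpace J x →L[ℝ] ℝ} {ε ε' : ℝ} {p : M}
    (h : HasLocalFlow X α ε p) (hε : ε' ≤ ε) : HasLocalFlow X α ε' p := by
  obtain ⟨W, hW, hp, θ, hθ⟩ := h
  have hs : Ico 0 ε' ⊆ Ico 0 ε := Ico_subset_Ico_right hε
  exact ⟨W, hW, hp, θ, fun y hy => ⟨(hθ y hy).1, (hθ y hy).2.1.mono hs,
    fun t ht => (hθ y hy).2.2 t (hs ht)⟩⟩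

theorem IsSmoothField.hasLocalFlow (hX : IsSmoothField J X)
    {α : (x : M) → TangentSpace J x →L[ℝ] ℝ} (hα : LieDerivProportional X α) (p : M) :
    ∃ ε > 0, ∀ᶠ q in 𝓝 p, HasLocalFlow X α ε q := by
  have : CompleteSpace F := FiniteDimensional.complete ℝ F
  obtain ⟨hαd, g, hg, hlie⟩ := hα p
  obtain ⟨ε, hε, W, hW, hpW, φ, hφ, hφ0, hφd⟩ := exists_local_flow (isOpen_extChartAt_target p)
    (hX p) (mem_extChartAt_target (I := J) p)
  have hWM : IsOpen ((extChartAt J p).source ∩ extChartAt J p ⁻¹' W) :=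
    (continuousOn_extChartAt p).isOpen_inter_preimage (isOpen_extChartAt_source p) hW
  have hIco : Ico 0 ε ⊆ Ioo (-ε) ε := fun t ht => ⟨by linarith [ht.1, ht.2], ht.2⟩
  refine ⟨ε, hε, ?_⟩
  filter_upwards [hWM.mem_nhds ⟨mem_extChartAt_source p, hpW⟩] with q hq
  refine ⟨_, hWM, hq, fun t y => (extChartAt J p).symm (φ (t, extChartAt J p y)),
    fun y hy => ⟨?_, ?_, fun t ht => ?_⟩⟩
  · change (extChartAt J p).symm (φ (0, extChartAt J p y)) = y
    rw [hφ0 _ hy.2, (extChartAt J p).left_inv hy.1]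
  · intro t ht
    have h := hφd t (hIco ht) _ hy.2
    exact (hasMFDerivAt_extChartAt_symm_comp h.1 h.2).hasMFDerivWithinAt
  · have hyW : extChartAt J p y ∈ W := hy.2
    have h := hφd t (hIco ht) _ hyW
    have hd : HasFDerivAt (fun z => φ (t, z))
        ((fderiv ℝ φ (t, extChartAt J p y)).comp (.inr ℝ ℝ F)) (extChartAt J p y) := by
      have h2 : HasFDerivAt φ (fderiv ℝ φ (t, extChartAt J p y)) (t, extChartAt J p y) :=
        ((hφ.contDiffAt ((isOpen_Ioo.prod hW).mem_nhds
          ⟨hIco ht, hyW⟩)).differentiableAt (by simp)).hasFDerivAt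
      exact h2.comp (extChartAt J p y) (hasFDerivAt_prodMk_right t (extChartAt J p y))
    have hm := (hasMFDerivAt_extChartAt_symm J h.1).comp y
      (hd.hasMFDerivAt.comp y (hasMFDerivAt_extChartAt' J hy.1))
    refine ⟨hm.mdifferentiableAt, fun v hv => ?_⟩
    rw [← chartForm_mfderiv_apply α hy.1] at hv
    have key := flow_preserves_ker (isOpen_extChartAt_target p) (hX p) hαd hg hlie hW hφ hφ0 hφd
      hyW hv ht
    refine Eq.trans ?_ key
    exact congrArg (α ((extChartAt J p).symm (φ (t, extChartAt J p y))))
      (DFunLike.congr_fun hm.mfderiv v)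

/-- Differentiable dependence on the initial value along a whole interval `[0, h]`, by composing
local flows: the interval is subdivided so finely that each step stays in a local flow. -/
theorem IsSmoothField.mdifferentiableAt_flow [T2Space M] (hX : IsSmoothField J X)
    {α : (x : M) → TangentSpace J x →L[ℝ] ℝ} (hα : LieDerivProportional X α) {h : ℝ} {V : Set M}
    (hV : IsOpen V) {Ψ : M → ℝ → M} (hΨ0 : ∀ y ∈ V, Ψ y 0 = y)
    (hΨ : ∀ y ∈ V, IsMIntegralCurveOn (Ψ y) X (Icc 0 h)) {x : M} (hx : x ∈ V) :
    ∀ t ∈ Icc 0 h, MDifferentiableAt J J (fun y => Ψ y t) x ∧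
      ∀ v : TangentSpace J x, α x v = 0 → α (Ψ x t) (mfderiv J J (fun y => Ψ y t) x v) = 0 := by
  -- a uniform lifespan of the local flows along the compact curve
  have hunif : ∃ ε > 0, ∀ q ∈ Ψ x '' Icc 0 h, HasLocalFlow X α ε q := by
    refine (isCompact_Icc.image_of_continuousOn (hΨ x hx).continuousOn).induction_on
      (p := fun A => ∃ ε > 0, ∀ q ∈ A, HasLocalFlow X α ε q) ⟨1, one_pos, by simp⟩ ?_ ?_ ?_
    · rintro A B hAB ⟨ε, hε, hB⟩
      exact ⟨ε, hε, fun q hq => hB q (hAB hq)⟩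
    · rintro A B ⟨ε, hε, hA⟩ ⟨ε', hε', hB⟩
      refine ⟨min ε ε', lt_min hε hε', fun q hq => hq.elim (fun hq => ?_) fun hq => ?_⟩
      · exact (hA q hq).mono (min_le_left _ _)
      · exact (hB q hq).mono (min_le_right _ _)
    · intro q _
      obtain ⟨ε, hε, hq⟩ := hX.hasLocalFlow hα q
      exact ⟨_, mem_nhdsWithin_of_mem_nhds hq, ε, hε, fun q hq => hq⟩
  obtain ⟨ε, hε, hflow⟩ := hunif
  have step : ∀ n : ℕ, ∀ t ∈ Icc 0 h, t ≤ n * (ε / 2) →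
      MDifferentiableAt J J (fun y => Ψ y t) x ∧
      ∀ v : TangentSpace J x, α x v = 0 → α (Ψ x t) (mfderiv J J (fun y => Ψ y t) x v) = 0 := by
    intro n
    induction n with
    | zero =>
      intro t ht htn
      obtain rfl : t = 0 := le_antisymm (by simpa using htn) ht.1
      have hid : (fun y => Ψ y 0) =ᶠ[𝓝 x] id := by
        filter_upwards [hV.mem_nhds hx] with y hy using hΨ0 y hy
      have hm : HasMFDerivAt J J (fun y => Ψ y 0) x (ContinuousLinearMap.id ℝ (TangentSpace J x)) :=
        (hasMFDerivAt_id x).congr_of_eventuallyEq hid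
      refine ⟨hm.mdifferentiableAt, fun v hv => ?_⟩
      refine (congrArg (α (Ψ x 0)) (DFunLike.congr_fun hm.mfderiv v)).trans ?_
      exact (congrArg (fun p : M => (α p : F →L[ℝ] ℝ) v) (hΨ0 x hx)).trans hv
    | succ n ih =>
      intro t ht htn
      set t₀ := max 0 (t - ε / 2) with ht₀
      have ht₀t : t₀ ≤ t := max_le ht.1 (by linarith)
      have ht₀h : t₀ ∈ Icc 0 h := ⟨le_max_left _ _, ht₀t.trans ht.2⟩
      have hgap : t - t₀ ∈ Ico 0 ε :=
        ⟨by linarith, by linarith [le_max_right 0 (t - ε / 2)]⟩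
      obtain ⟨hd, hker⟩ := ih t₀ ht₀h (max_le (by positivity) (by push_cast at htn; linarith))
      obtain ⟨W, hW, hxW, θ, hθ⟩ := hflow (Ψ x t₀) (mem_image_of_mem _ ht₀h)
      have heq : (fun y => Ψ y t) =ᶠ[𝓝 x] fun y => θ (t - t₀) (Ψ y t₀) := by
        filter_upwards [hV.mem_nhds hx, hd.continuousAt.preimage_mem_nhds (hW.mem_nhds hxW)]
          with y hy hyW
        have h1 : IsMIntegralCurveOn (fun s => θ (s - t₀) (Ψ y t₀)) X (Icc t₀ t) := by
          have h2 := IsMIntegralCurveOn.comp_add (hθ _ hyW).2.1 (-t₀)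
          refine IsMIntegralCurveOn.mono h2 fun s hs => ?_
          exact ⟨by linarith [hs.1], by linarith [hs.2, hgap.2]⟩
        refine hX.eqOn_of_isMIntegralCurveOn_Icc
          ((hΨ y hy).mono (Icc_subset_Icc ht₀h.1 ht.2)) h1 ?_ ⟨ht₀t, le_rfl⟩
        rw [sub_self, (hθ _ hyW).1]
      obtain ⟨hθd, hθker⟩ := (hθ _ hxW).2.2 _ hgap
      have hm := (hθd.hasMFDerivAt.comp x hd.hasMFDerivAt).congr_of_eventuallyEq heq
      refine ⟨hm.mdifferentiableAt, fun v hv => ?_⟩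
      refine (congrArg (α (Ψ x t)) (DFunLike.congr_fun hm.mfderiv v)).trans ?_
      refine Eq.trans ?_ (hθker _ (hker v hv))
      exact congrArg (fun p : M => (α p : F →L[ℝ] ℝ) (mfderiv J J (θ (t - t₀)) (Ψ x t₀)
        (mfderiv J J (fun y => Ψ y t₀) x v))) heq.eq_of_nhds
  intro t ht
  obtain ⟨n, hn⟩ := exists_nat_gt (t / (ε / 2))
  exact step n t ht ((div_lt_iff₀ (by positivity)).1 hn).le

end ManifoldFlow

/-! ### The inverse function theorem on manifolds -/

section InverseFunctionManifold

variable {F : Type*} [NormedAddCommGroup F] [NormedSpace ℝ F] [FiniteDimensional ℝ F]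
  {G : Type*} [TopologicalSpace G] {J : ModelWithCorners ℝ F G} [J.Boundaryless]
  {M : Type*} [TopologicalSpace M] [ChartedSpace G M] [IsManifold J ∞ M]
  {F' : Type*} [NormedAddCommGroup F'] [NormedSpace ℝ F'] [FiniteDimensional ℝ F']
  {G' : Type*} [TopologicalSpace G'] {J' : ModelWithCorners ℝ F' G'} [J'.Boundaryless]
  {M' : Type*} [TopologicalSpace M'] [ChartedSpace G' M'] [IsManifold J' ∞ M']

/-- The inverse function theorem on manifolds. For manifolds of the same dimension, it is enough that
the derivative is injective. -/
theorem exists_isDiffeoOntoOpen (hdim : Module.finrank ℝ F = Module.finrank ℝ F') {f : M → M'}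
    {U : Set M} (hU : IsOpen U) (hf : ContMDiffOn J J' ∞ f U) {x : M} (hx : x ∈ U)
    (hinj : Function.Injective (mfderiv J J' f x)) :
    ∃ V : Set M, IsOpen V ∧ x ∈ V ∧ V ⊆ U ∧ IsDiffeoOntoOpen J J' f V := by
  have : CompleteSpace F := FiniteDimensional.complete ℝ F
  let τ := extChartAt J x
  let τ' := extChartAt J' (f x)
  have hτ : IsOpen τ.source := isOpen_extChartAt_source x
  have hτ' : IsOpen τ'.source := isOpen_extChartAt_source (f x)
  let U₁ := U ∩ f ⁻¹' τ'.source
  have hU₁ : IsOpen U₁ := hf.continuousOn.isOpen_inter_preimage hU hτ'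
  have hxU₁ : x ∈ U₁ := ⟨hx, mem_extChartAt_source (f x)⟩
  let O := τ.target ∩ τ.symm ⁻¹' U₁
  have hO : IsOpen O :=
    (continuousOn_extChartAt_symm x).isOpen_inter_preimage (isOpen_extChartAt_target x) hU₁
  have hxx : τ.symm (τ x) = x := extChartAt_to_inv x
  have hxO : τ x ∈ O := ⟨mem_extChartAt_target x, by simp only [mem_preimage, hxx]; exact hxU₁⟩
  let fh : F → F' := fun y => τ' (f (τ.symm y))
  have hfh : ContDiffOn ℝ ∞ fh O := by
    rw [← contMDiffOn_iff_contDiffOn]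
    refine (contMDiffOn_extChartAt (I := J') (x := f x)).comp (t := (chartAt G' (f x)).source)
      ((hf.comp (contMDiffOn_extChartAt_symm x |>.mono inter_subset_left) ?_)) ?_
    · exact fun y hy => hy.2.1
    · intro y hy
      have := hy.2.2
      rwa [mem_preimage, extChartAt_source] at this
  have hmf : HasMFDerivAt J J' f x (mfderiv J J' f x) :=
    ((hf.contMDiffAt (hU.mem_nhds hx)).mdifferentiableAt (by simp)).hasMFDerivAt
  have hfd : ∀ v : F, fderiv ℝ fh (τ x) v = chartDeriv J' (f x) (f x)
      (mfderiv J J' f x (chartDerivSymm J x (τ x) v : F)) := by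
    intro v
    have hmf' : HasMFDerivAt J J' f (τ.symm (τ x)) (mfderiv J J' f (τ.symm (τ x))) := by
      rw [hxx]; exact hmf
    have h1 : HasMFDerivAt J' 𝓘(ℝ, F') τ' (f (τ.symm (τ x)))
        (mfderiv J' 𝓘(ℝ, F') τ' (f (τ.symm (τ x)))) :=
      hasMFDerivAt_extChartAt' J' (by rw [hxx]; exact hxU₁.2)
    have h2 : HasFDerivAt fh ((chartDeriv J' (f x) (f (τ.symm (τ x)))).comp
        ((mfderiv J J' f (τ.symm (τ x))).comp (chartDerivSymm J x (τ x)))) (τ x) :=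
      (h1.comp (τ x) (hmf'.comp (τ x) (hasMFDerivAt_extChartAt_symm J hxO.1))).hasFDerivAt
    refine (DFunLike.congr_fun h2.fderiv v).trans ?_
    exact congrArg (fun p : M => (chartDeriv J' (f x) (f p) : F' →L[ℝ] F')
      ((mfderiv J J' f p : F →L[ℝ] F') (chartDerivSymm J x (τ x) v : F))) hxx
  have hinj' : Function.Injective (fderiv ℝ fh (τ x)) := by
    rw [injective_iff_map_eq_zero]
    intro v hv
    rw [hfd] at hv
    have h1 := mfderiv_symm_extChartAt_apply J' hxU₁.2
      (mfderiv J J' f x (chartDerivSymm J x (τ x) v : F))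
    have h2 : mfderiv J J' f x (chartDerivSymm J x (τ x) v : F) = 0 := by
      refine h1.symm.trans ?_
      refine (congrArg (mfderiv 𝓘(ℝ, F') J' τ'.symm (τ' (f x))) hv).trans ?_
      exact map_zero (mfderiv 𝓘(ℝ, F') J' τ'.symm (τ' (f x)))
    have h3 := hinj (h2.trans (map_zero (mfderiv J J' f x)).symm)
    have h4 := mfderiv_extChartAt_symm_apply J hxO.1 v
    refine h4.symm.trans ?_
    refine (congrArg (mfderiv J 𝓘(ℝ, F) τ (τ.symm (τ x))) h3).trans ?_
    exact map_zero (mfderiv J 𝓘(ℝ, F) τ (τ.symm (τ x)))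
  let L : F ≃L[ℝ] F' := (LinearEquiv.ofInjectiveOfFinrankEq
    (fderiv ℝ fh (τ x) : F →ₗ[ℝ] F') hinj' hdim).toContinuousLinearEquiv
  have hL : HasFDerivAt fh (L : F →L[ℝ] F') (τ x) := by
    have h := ((hfh.contDiffAt (hO.mem_nhds hxO)).differentiableAt (by simp)).hasFDerivAt
    convert! h using 1
  obtain ⟨e, hxe, heO, hef, hes⟩ := exists_openPartialHomeomorph_contDiffOn_symm hO hfh hxO L hL
  have hV : IsOpen (τ.source ∩ τ ⁻¹' e.source) :=
    (continuousOn_extChartAt x).isOpen_inter_preimage hτ e.open_source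
  have hVU : τ.source ∩ τ ⁻¹' e.source ⊆ U₁ := by
    intro y hy
    have := (heO hy.2).2
    rwa [mem_preimage, τ.left_inv hy.1] at this
  have himg : f '' (τ.source ∩ τ ⁻¹' e.source) = τ'.source ∩ τ' ⁻¹' e.target := by
    ext z
    constructor
    · rintro ⟨y, hy, rfl⟩
      refine ⟨(hVU hy).2, ?_⟩
      have h := e.map_source hy.2
      rw [hef] at h
      simp only [fh, τ.left_inv hy.1] at h
      exact h
    · rintro ⟨hz, hz'⟩
      have h1 := e.map_target hz'
      have h2 := e.right_inv hz'
      rw [hef] at h2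
      refine ⟨τ.symm (e.symm (τ' z)), ⟨τ.map_target (heO h1).1, ?_⟩, ?_⟩
      · rw [mem_preimage, τ.right_inv (heO h1).1]; exact h1
      · exact τ'.injOn (heO h1).2.2 hz h2
  refine ⟨_, hV, ⟨mem_extChartAt_source x, hxe⟩, fun y hy => (hVU hy).1,
    hf.mono fun y hy => (hVU hy).1, ?_, fun z => τ.symm (e.symm (τ' z)), ?_, ?_⟩
  · rw [himg]
    exact (continuousOn_extChartAt (f x)).isOpen_inter_preimage hτ' e.open_target
  · rw [himg]
    refine (contMDiffOn_extChartAt_symm (I := J) x).comp (t := τ.target)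
      ((contMDiffOn_iff_contDiffOn.2 hes).comp (t := e.target)
        ((contMDiffOn_extChartAt (I := J') (x := f x)).mono ?_) fun z hz => hz.2) ?_
    · intro z hz
      have := hz.1
      rwa [extChartAt_source] at this
    · exact fun z hz => (heO (e.map_target hz.2)).1
  · intro y hy
    have h := e.left_inv hy.2
    rw [hef] at h
    simp only [fh, τ.left_inv hy.1] at h
    change τ.symm (e.symm (τ' (f y))) = y
    rw [h, τ.left_inv hy.1]

end InverseFunctionManifold

/-! ### The Herglotz equations in coordinates -/

section LocalLagrangian

variable {E : Type*} [NormedAddCommGroup E] [NormedSpace ℝ E]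

variable (E) in
/-- The inclusion `b ↦ (0, b, 0)` of the velocities into the coordinate space of `TQ × ℝ`. -/
def inclVel : E →L[ℝ] (E × E) × ℝ := (ContinuousLinearMap.inl ℝ (E × E) ℝ).comp (.inr ℝ E E)

variable (E) in
/-- The inclusion `a ↦ (a, 0, 0)` of the positions into the coordinate space of `TQ × ℝ`. -/
def inclPos : E →L[ℝ] (E × E) × ℝ := (ContinuousLinearMap.inl ℝ (E × E) ℝ).comp (.inl ℝ E E)

theorem inclVel_apply (b : E) : inclVel E b = ((0, b), 0) := rfl

theorem inclPos_apply (a : E) : inclPos E a = ((a, 0), 0) := rfl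

/-- The momentum `p = ∂ℓ/∂v` of a Lagrangian `ℓ` in coordinates. -/
def momentum (ℓ : (E × E) × ℝ → ℝ) (Y : (E × E) × ℝ) : E →L[ℝ] ℝ :=
  (fderiv ℝ ℓ Y).comp (inclVel E)

/-- The coordinate expression `dz - p dq` of the contact form. -/
def contactForm (ℓ : (E × E) × ℝ → ℝ) (Y : (E × E) × ℝ) : (E × E) × ℝ →L[ℝ] ℝ :=
  .snd ℝ (E × E) ℝ - (momentum ℓ Y).comp ((ContinuousLinearMap.fst ℝ E E).comp (.fst ℝ (E × E) ℝ))

/-- The coordinate expression of the energy. -/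
def localEnergy (ℓ : (E × E) × ℝ → ℝ) (Y : (E × E) × ℝ) : ℝ := momentum ℓ Y Y.1.2 - ℓ Y

/-- The Herglotz equations `q̇ = v`, `ż = ℓ`, `ṗ = ∂ℓ/∂q + (∂ℓ/∂z) p` for a velocity `Z` at `Y`. -/
def IsHerglotz (ℓ : (E × E) × ℝ → ℝ) (Y Z : (E × E) × ℝ) : Prop :=
  Z.1.1 = Y.1.2 ∧ Z.2 = ℓ Y ∧ ∀ a : E, fderiv ℝ (momentum ℓ) Y Z a =
    fderiv ℝ ℓ Y (inclPos E a) + fderiv ℝ ℓ Y (0, 1) * momentum ℓ Y a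

/-- The Hessian of `ℓ` in the velocities is nondegenerate at `Y`. -/
def IsRegularAt (ℓ : (E × E) × ℝ → ℝ) (Y : (E × E) × ℝ) : Prop :=
  ∀ a : E, (∀ b : E, fderiv ℝ (momentum ℓ) Y (inclVel E a) b = 0) → a = 0

/-- The right-hand side of the second-order part of the Herglotz equations, for `v̇`. -/
def herglotzForce (ℓ : (E × E) × ℝ → ℝ) (Y : (E × E) × ℝ) : E →L[ℝ] ℝ :=
  (fderiv ℝ ℓ Y).comp (inclPos E) + fderiv ℝ ℓ Y (0, 1) • momentum ℓ Y -
    fderiv ℝ (momentum ℓ) Y ((Y.1.2, 0), ℓ Y)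

/-- The Herglotz vector field in coordinates. The inverse of the Hessian is `0` by convention where
the Hessian is degenerate, so this is meaningful only at the points where `ℓ` is regular. -/
def herglotzField (ℓ : (E × E) × ℝ → ℝ) (Y : (E × E) × ℝ) : (E × E) × ℝ :=
  ((Y.1.2, ((fderiv ℝ (momentum ℓ) Y).comp (inclVel E)).inverse (herglotzForce ℓ Y)), ℓ Y)

variable {ℓ : (E × E) × ℝ → ℝ} {Y : (E × E) × ℝ}

theorem contactForm_apply (w : (E × E) × ℝ) :
    contactForm ℓ Y w = w.2 - momentum ℓ Y w.1.1 := rfl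

theorem fderiv_apply_eq (w : (E × E) × ℝ) : fderiv ℝ ℓ Y w =
    fderiv ℝ ℓ Y (inclPos E w.1.1) + momentum ℓ Y w.1.2 + w.2 * fderiv ℝ ℓ Y (0, 1) := by
  have hw : w = inclPos E w.1.1 + inclVel E w.1.2 + w.2 • (0, 1) := by
    ext <;> simp [inclPos_apply, inclVel_apply]
  conv_lhs => rw [hw]
  rw [map_add, map_add, map_smul]
  rfl

section Smooth

variable {O : Set ((E × E) × ℝ)} (hO : IsOpen O) (hℓ : ContDiffOn ℝ ∞ ℓ O)

include hO hℓ

theorem contDiffOn_momentum : ContDiffOn ℝ ∞ (momentum ℓ) O :=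
  (hℓ.fderiv_of_isOpen hO (by simp)).clm_comp contDiffOn_const

theorem hasFDerivAt_contactForm (hY : Y ∈ O) : HasFDerivAt (contactForm ℓ)
    (-(((ContinuousLinearMap.compL ℝ ((E × E) × ℝ) E ℝ).flip
      ((ContinuousLinearMap.fst ℝ E E).comp (.fst ℝ (E × E) ℝ))).comp
        (fderiv ℝ (momentum ℓ) Y))) Y := by
  have h : HasFDerivAt (momentum ℓ) (fderiv ℝ (momentum ℓ) Y) Y :=
    (((contDiffOn_momentum hO hℓ).contDiffAt (hO.mem_nhds hY)).differentiableAt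
      (by simp)).hasFDerivAt
  exact (((ContinuousLinearMap.compL ℝ ((E × E) × ℝ) E ℝ).flip
      ((ContinuousLinearMap.fst ℝ E E).comp (.fst ℝ (E × E) ℝ))).hasFDerivAt.comp Y h).const_sub
    (ContinuousLinearMap.snd ℝ (E × E) ℝ)

theorem fderiv_contactForm_apply (hY : Y ∈ O) (u w : (E × E) × ℝ) :
    fderiv ℝ (contactForm ℓ) Y u w = -fderiv ℝ (momentum ℓ) Y u w.1.1 := by
  rw [(hasFDerivAt_contactForm hO hℓ hY).fderiv]
  rfl

theorem fderiv_momentum_symm (hY : Y ∈ O) (a b : E) :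
    fderiv ℝ (momentum ℓ) Y (inclVel E a) b = fderiv ℝ (momentum ℓ) Y (inclVel E b) a := by
  have h1 : ContDiffAt ℝ ∞ ℓ Y := hℓ.contDiffAt (hO.mem_nhds hY)
  have h2 : HasFDerivAt (fderiv ℝ ℓ) (fderiv ℝ (fderiv ℝ ℓ) Y) Y :=
    ((h1.fderiv_right (m := ∞) (by simp)).differentiableAt (by simp)).hasFDerivAt
  have h3 : HasFDerivAt (momentum ℓ)
      (((ContinuousLinearMap.compL ℝ E ((E × E) × ℝ) ℝ).flip (inclVel E)).comp
        (fderiv ℝ (fderiv ℝ ℓ) Y)) Y :=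
    ((ContinuousLinearMap.compL ℝ E ((E × E) × ℝ) ℝ).flip (inclVel E)).hasFDerivAt.comp Y h2
  have hs : IsSymmSndFDerivAt ℝ ℓ Y := h1.isSymmSndFDerivAt (by
    rw [minSmoothness_of_isRCLikeNormedField]; exact WithTop.coe_le_coe.2 (le_top : (2 : ℕ∞) ≤ ⊤))
  rw [h3.fderiv]
  exact hs.eq _ _

theorem fderiv_localEnergy_apply (hY : Y ∈ O) (w : (E × E) × ℝ) :
    fderiv ℝ (localEnergy ℓ) Y w = fderiv ℝ (momentum ℓ) Y w Y.1.2 -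
      fderiv ℝ ℓ Y (inclPos E w.1.1) - fderiv ℝ ℓ Y (0, 1) * w.2 := by
  have h1 : HasFDerivAt ℓ (fderiv ℝ ℓ Y) Y :=
    ((hℓ.contDiffAt (hO.mem_nhds hY)).differentiableAt (by simp)).hasFDerivAt
  have h : HasFDerivAt (momentum ℓ) (fderiv ℝ (momentum ℓ) Y) Y :=
    (((contDiffOn_momentum hO hℓ).contDiffAt (hO.mem_nhds hY)).differentiableAt
      (by simp)).hasFDerivAt
  have h2 : HasFDerivAt (fun Y : (E × E) × ℝ => Y.1.2)
      ((ContinuousLinearMap.snd ℝ E E).comp (.fst ℝ (E × E) ℝ)) Y :=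
    ((ContinuousLinearMap.snd ℝ E E).comp (.fst ℝ (E × E) ℝ)).hasFDerivAt
  have h3 : HasFDerivAt (localEnergy ℓ) _ Y := (h.clm_apply h2).sub h1
  rw [h3.fderiv]
  have h4 := fderiv_apply_eq (ℓ := ℓ) (Y := Y) w
  change momentum ℓ Y w.1.2 + fderiv ℝ (momentum ℓ) Y w Y.1.2 - fderiv ℝ ℓ Y w = _
  rw [h4]
  ring

theorem contDiffOn_localEnergy : ContDiffOn ℝ ∞ (localEnergy ℓ) O :=
  ((contDiffOn_momentum hO hℓ).clm_apply contDiff_fst.snd.contDiffOn).sub hℓ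

/-- The Lie derivative of `dz - p dq` along a solution of the Herglotz equations is
`(∂ℓ/∂z) (dz - p dq)`. -/
theorem lieDeriv_contactForm (hY : Y ∈ O) {Z : (E × E) × ℝ → (E × E) × ℝ}
    (hZ : ∀ Y ∈ O, IsHerglotz ℓ Y (Z Y)) (hZd : DifferentiableAt ℝ Z Y) (w : (E × E) × ℝ) :
    fderiv ℝ (contactForm ℓ) Y (Z Y) w + contactForm ℓ Y (fderiv ℝ Z Y w) =
      fderiv ℝ ℓ Y (0, 1) * contactForm ℓ Y w := by
  have h1 : (fderiv ℝ Z Y w).1.1 = w.1.2 := by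
    have h2 : HasFDerivAt (fun Y => (Z Y).1.1)
        (((ContinuousLinearMap.fst ℝ E E).comp (.fst ℝ (E × E) ℝ)).comp (fderiv ℝ Z Y)) Y :=
      ((ContinuousLinearMap.fst ℝ E E).comp (.fst ℝ (E × E) ℝ)).hasFDerivAt.comp Y
        hZd.hasFDerivAt
    have h3 : HasFDerivAt (fun Y => (Z Y).1.1)
        ((ContinuousLinearMap.snd ℝ E E).comp (.fst ℝ (E × E) ℝ)) Y := by
      refine ((ContinuousLinearMap.snd ℝ E E).comp
        (.fst ℝ (E × E) ℝ)).hasFDerivAt.congr_of_eventuallyEq ?_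
      filter_upwards [hO.mem_nhds hY] with Y' hY' using (hZ Y' hY').1
    exact DFunLike.congr_fun (h2.unique h3) w
  have h2 : (fderiv ℝ Z Y w).2 = fderiv ℝ ℓ Y w := by
    have h3 : HasFDerivAt (fun Y => (Z Y).2)
        ((ContinuousLinearMap.snd ℝ (E × E) ℝ).comp (fderiv ℝ Z Y)) Y :=
      (ContinuousLinearMap.snd ℝ (E × E) ℝ).hasFDerivAt.comp Y hZd.hasFDerivAt
    have h4 : HasFDerivAt (fun Y => (Z Y).2) (fderiv ℝ ℓ Y) Y := by
      refine ((hℓ.contDiffAt (hO.mem_nhds hY)).differentiableAt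
        (by simp)).hasFDerivAt.congr_of_eventuallyEq ?_
      filter_upwards [hO.mem_nhds hY] with Y' hY' using (hZ Y' hY').2.1
    exact DFunLike.congr_fun (h3.unique h4) w
  have h4 := fderiv_apply_eq (ℓ := ℓ) (Y := Y) w
  rw [fderiv_contactForm_apply hO hℓ hY, contactForm_apply, contactForm_apply, h1, h2,
    (hZ Y hY).2.2, h4]
  ring

end Smooth

theorem IsRegularAt.eq_of_isHerglotz (hreg : IsRegularAt ℓ Y) {Z Z' : (E × E) × ℝ}
    (hZ : IsHerglotz ℓ Y Z) (hZ' : IsHerglotz ℓ Y Z') : Z = Z' := by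
  have h1 : Z - Z' = inclVel E (Z.1.2 - Z'.1.2) := by
    ext
    · simp [inclVel_apply, hZ.1, hZ'.1]
    · simp [inclVel_apply]
    · simp [inclVel_apply, hZ.2.1, hZ'.2.1]
  have h2 : Z.1.2 - Z'.1.2 = 0 := hreg _ fun b => by
    rw [← h1, map_sub, _root_.sub_apply, hZ.2.2, hZ'.2.2, sub_self]
  rw [h2, map_zero] at h1
  exact sub_eq_zero.1 h1

variable [FiniteDimensional ℝ E]

/-- A nondegenerate Hessian is an isomorphism onto the dual space. -/
theorem IsRegularAt.exists_equiv (hreg : IsRegularAt ℓ Y) :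
    ∃ e : E ≃L[ℝ] (E →L[ℝ] ℝ), (e : E →L[ℝ] E →L[ℝ] ℝ) =
      (fderiv ℝ (momentum ℓ) Y).comp (inclVel E) := by
  have hinj : Function.Injective (((fderiv ℝ (momentum ℓ) Y).comp (inclVel E) :
      E →L[ℝ] E →L[ℝ] ℝ) : E →ₗ[ℝ] E →L[ℝ] ℝ) := by
    rw [injective_iff_map_eq_zero]
    exact fun a ha => hreg a fun b => DFunLike.congr_fun ha b
  have hdim : Module.finrank ℝ E = Module.finrank ℝ (E →L[ℝ] ℝ) := by
    rw [← (LinearMap.toContinuousLinearMap (𝕜 := ℝ) (E := E) (F' := ℝ)).finrank_eq]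
    exact (Subspace.dual_finrank_eq (K := ℝ) (V := E)).symm
  refine ⟨(LinearEquiv.ofInjectiveOfFinrankEq _ hinj hdim).toContinuousLinearEquiv, ?_⟩
  ext a b
  rfl

theorem IsRegularAt.isHerglotz_herglotzField (hreg : IsRegularAt ℓ Y) :
    IsHerglotz ℓ Y (herglotzField ℓ Y) := by
  obtain ⟨e, he⟩ := hreg.exists_equiv
  refine ⟨rfl, rfl, fun a => ?_⟩
  set β := ((fderiv ℝ (momentum ℓ) Y).comp (inclVel E)).inverse (herglotzForce ℓ Y) with hβ
  have h1 : fderiv ℝ (momentum ℓ) Y (inclVel E β) = herglotzForce ℓ Y := by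
    rw [← ContinuousLinearMap.comp_apply, hβ, ← he, ContinuousLinearMap.inverse_equiv]
    exact e.apply_symm_apply _
  have h2 : herglotzField ℓ Y = inclVel E β + ((Y.1.2, 0), ℓ Y) := by
    ext <;> simp [herglotzField, inclVel_apply, hβ]
  rw [h2, map_add, h1, herglotzForce, sub_add_cancel]
  rfl

theorem contDiffOn_herglotzField {O : Set ((E × E) × ℝ)} (hO : IsOpen O)
    (hℓ : ContDiffOn ℝ ∞ ℓ O) (hreg : ∀ Y ∈ O, IsRegularAt ℓ Y) :
    ContDiffOn ℝ ∞ (herglotzField ℓ) O := by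
  have : CompleteSpace E := FiniteDimensional.complete ℝ E
  have hp := contDiffOn_momentum hO hℓ
  have hdl : ContDiffOn ℝ ∞ (fderiv ℝ ℓ) O := hℓ.fderiv_of_isOpen hO (by simp)
  have hdp : ContDiffOn ℝ ∞ (fderiv ℝ (momentum ℓ)) O := hp.fderiv_of_isOpen hO (by simp)
  have hv : ContDiffOn ℝ ∞ (fun Y : (E × E) × ℝ => Y.1.2) O := contDiff_fst.snd.contDiffOn
  have hforce : ContDiffOn ℝ ∞ (herglotzForce ℓ) O :=
    ((hdl.clm_comp contDiffOn_const).add ((hdl.clm_apply contDiffOn_const).smul hp)).sub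
      (hdp.clm_apply ((hv.prodMk contDiffOn_const).prodMk hℓ))
  have hinv : ContDiffOn ℝ ∞
      (fun Y => ((fderiv ℝ (momentum ℓ) Y).comp (inclVel E)).inverse) O := by
    intro Y hY
    obtain ⟨e, he⟩ := (hreg Y hY).exists_equiv
    have h1 := contDiffAt_map_inverse (𝕜 := ℝ) (n := ∞) e
    rw [he] at h1
    exact h1.comp_contDiffWithinAt Y ((hdp.clm_comp contDiffOn_const) Y hY)
  exact (hv.prodMk (hinv.clm_apply hforce)).prodMk hℓ

section Reeb

variable {O : Set ((E × E) × ℝ)} (hO : IsOpen O) (hℓ : ContDiffOn ℝ ∞ ℓ O) (hY : Y ∈ O)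

/-- The exterior derivative `dη` of the contact form `η = dz - p dq` in coordinates. -/
def dContactForm (ℓ : (E × E) × ℝ → ℝ) (Y u w : (E × E) × ℝ) : ℝ :=
  fderiv ℝ (contactForm ℓ) Y u w - fderiv ℝ (contactForm ℓ) Y w u

include hO hℓ hY

omit [FiniteDimensional ℝ E] in
theorem dContactForm_apply (u w : (E × E) × ℝ) : dContactForm ℓ Y u w =
    fderiv ℝ (momentum ℓ) Y w u.1.1 - fderiv ℝ (momentum ℓ) Y u w.1.1 := by
  rw [dContactForm, fderiv_contactForm_apply hO hℓ hY, fderiv_contactForm_apply hO hℓ hY]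
  ring

omit [FiniteDimensional ℝ E] in
/-- A vector in the kernel of `dη` has no component along `Q`, and `p` is stationary along it. -/
theorem ker_dContactForm (hreg : IsRegularAt ℓ Y) {R : (E × E) × ℝ}
    (hR : ∀ w, dContactForm ℓ Y R w = 0) :
    R.1.1 = 0 ∧ fderiv ℝ (momentum ℓ) Y R = 0 := by
  have h1 : R.1.1 = 0 := hreg _ fun b => by
    have h := hR (inclVel E b)
    rw [dContactForm_apply hO hℓ hY] at h
    have h0 : (inclVel E b).1.1 = 0 := rfl
    rw [h0, map_zero, sub_zero] at h
    rw [fderiv_momentum_symm hO hℓ hY]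
    exact h
  refine ⟨h1, ContinuousLinearMap.ext fun a => ?_⟩
  have h := hR (inclPos E a)
  rw [dContactForm_apply hO hℓ hY, h1, map_zero, zero_sub, neg_eq_zero] at h
  exact h

/-- The Reeb field is `∂/∂z + β ∂/∂v`, where the Hessian applied to `β` is `-∂p/∂z`. -/
theorem exists_reeb (hreg : IsRegularAt ℓ Y) :
    ∃ R : (E × E) × ℝ, (∀ w, dContactForm ℓ Y R w = 0) ∧ contactForm ℓ Y R = 1 := by
  obtain ⟨e, he⟩ := hreg.exists_equiv
  set β := e.symm (-fderiv ℝ (momentum ℓ) Y (0, 1)) with hβ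
  have h1 : fderiv ℝ (momentum ℓ) Y (inclVel E β + (0, 1)) = 0 := by
    have h2 : fderiv ℝ (momentum ℓ) Y (inclVel E β) = e β := by
      rw [← ContinuousLinearMap.comp_apply, ← he]; rfl
    rw [map_add, h2, hβ, e.apply_symm_apply, neg_add_cancel]
  have h0 : (inclVel E β + ((0 : E × E), (1 : ℝ))).1.1 = 0 := by simp [inclVel_apply]
  refine ⟨inclVel E β + (0, 1), fun w => ?_, ?_⟩
  · rw [dContactForm_apply hO hℓ hY, h1, h0]
    simp
  · rw [contactForm_apply, h0]
    simp [inclVel_apply]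

omit [FiniteDimensional ℝ E] in
/-- A solution of the Herglotz equations is a solution of the equation that defines the contact
Hamiltonian field of the energy. -/
theorem IsHerglotz.contactHamiltonian {Z R : (E × E) × ℝ} (hreg : IsRegularAt ℓ Y)
    (hR : ∀ w, dContactForm ℓ Y R w = 0) (hR1 : contactForm ℓ Y R = 1)
    (hZ : IsHerglotz ℓ Y Z) (w : (E × E) × ℝ) :
    dContactForm ℓ Y Z w + contactForm ℓ Y Z * contactForm ℓ Y w =
      fderiv ℝ (localEnergy ℓ) Y w -
        (localEnergy ℓ Y + fderiv ℝ (localEnergy ℓ) Y R) * contactForm ℓ Y w := by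
  obtain ⟨h1, h2⟩ := ker_dContactForm hO hℓ hY hreg hR
  have h3 : R.2 = 1 := by
    rw [contactForm_apply, h1, map_zero, sub_zero] at hR1
    exact hR1
  rw [dContactForm_apply hO hℓ hY, fderiv_localEnergy_apply hO hℓ hY,
    fderiv_localEnergy_apply hO hℓ hY, h1, h2, h3, hZ.2.2, hZ.1]
  simp only [contactForm_apply, hZ.1, hZ.2.1, localEnergy, map_zero, _root_.zero_apply]
  ring

omit [FiniteDimensional ℝ E] in
/-- The map `♭` of the contact form is injective. -/
theorem flat_injective {Z R : (E × E) × ℝ} (hreg : IsRegularAt ℓ Y)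
    (hR : ∀ w, dContactForm ℓ Y R w = 0) (hR1 : contactForm ℓ Y R = 1)
    (hZ : ∀ w, dContactForm ℓ Y Z w + contactForm ℓ Y Z * contactForm ℓ Y w = 0) : Z = 0 := by
  have h1 : contactForm ℓ Y Z = 0 := by
    have h := hZ R
    have h2 : dContactForm ℓ Y Z R = -dContactForm ℓ Y R Z := by
      rw [dContactForm, dContactForm, neg_sub]
    rwa [h2, hR, hR1, neg_zero, zero_add, mul_one] at h
  have h2 := ker_dContactForm hO hℓ hY hreg (R := Z) fun w => by
    have h := hZ w
    rwa [h1, zero_mul, add_zero] at h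
  have h3 : Z.2 = 0 := by
    rw [contactForm_apply, h2.1, map_zero, sub_zero] at h1
    exact h1
  have h4 : Z = inclVel E Z.1.2 := by
    ext <;> simp [inclVel_apply, h2.1, h3]
  have h5 : Z.1.2 = 0 := hreg _ fun b => by rw [← h4, h2.2]; rfl
  rw [h4, h5, map_zero]

end Reeb

end LocalLagrangian

/-! ### The charts of `TQ × ℝ` -/

section PhaseCharts

set_option linter.unusedSectionVars false

variable {E : Type*} [NormedAddCommGroup E] [NormedSpace ℝ E]
  {H : Type*} [TopologicalSpace H] {I : ModelWithCorners ℝ E H}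
  {Q : Type*} [TopologicalSpace Q] [ChartedSpace H Q] [IsManifold I ∞ Q]

instance tangentBundle_t2Space [T2Space Q] : T2Space (TangentBundle I Q) := by
  have : IsManifold I 1 Q := .of_le (n := ∞) (by simp)
  refine ⟨fun p q hpq => ?_⟩
  by_cases h : p.proj = q.proj
  -- points over the same base point are separated in a trivialization, other points by their bases
  · let e := trivializationAt E (TangentSpace I) p.proj
    have hp : p ∈ e.source := e.mem_source.2 (FiberBundle.mem_baseSet_trivializationAt' p.proj)
    have hq : q ∈ e.source := by
      rw [e.mem_source, ← h]
      exact FiberBundle.mem_baseSet_trivializationAt' p.proj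
    have hne : e p ≠ e q := fun h' => hpq (e.injOn hp hq h')
    obtain ⟨u, v, hu, hv, hpu, hqv, huv⟩ := t2_separation hne
    refine ⟨e.source ∩ e ⁻¹' u, e.source ∩ e ⁻¹' v,
      e.continuousOn.isOpen_inter_preimage e.open_source hu,
      e.continuousOn.isOpen_inter_preimage e.open_source hv, ⟨hp, hpu⟩, ⟨hq, hqv⟩, ?_⟩
    exact (huv.preimage e).mono inter_subset_right inter_subset_right
  · obtain ⟨u, v, hu, hv, hpu, hqv, huv⟩ := t2_separation h
    have hc : Continuous (fun p : TangentBundle I Q => p.proj) :=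
      FiberBundle.continuous_proj E (TangentSpace I)
    exact ⟨_, _, hu.preimage hc, hv.preimage hc, hpu, hqv, huv.preimage _⟩

variable [I.Boundaryless]

/-- In the charts of `TQ`, a tangent vector is represented by its image under the derivative of the
chart of `Q`. -/
theorem extChartAt_tangent_apply {p q : TangentBundle I Q}
    (h : q.proj ∈ (extChartAt I p.proj).source) :
    extChartAt I.tangent p q = (extChartAt I p.proj q.proj, chartDeriv I p.proj q.proj q.2) := by
  have : IsManifold I 1 Q := .of_le (n := ∞) (by simp)
  rw [extChartAt_source] at h
  rw [chartDeriv, ← TangentBundle.continuousLinearMapAt_trivializationAt h]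
  have hb : q.proj ∈ (trivializationAt E (TangentSpace I) p.proj).baseSet := by
    rwa [TangentBundle.trivializationAt_baseSet]
  rw [FiberBundle.extChartAt]
  refine Prod.ext (by simp) ?_
  rw [Bundle.Trivialization.continuousLinearMapAt_apply,
    Bundle.Trivialization.coe_linearMapAt_of_mem _ hb]
  rfl

theorem extChartAt_tangent_symm_apply (p : TangentBundle I Q) {y : E}
    (h : y ∈ (extChartAt I p.proj).target) (v : E) :
    (extChartAt I.tangent p).symm (y, v) =
      ⟨(extChartAt I p.proj).symm y, chartDerivSymm I p.proj y v⟩ := by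
  have : IsManifold I 1 Q := .of_le (n := ∞) (by simp)
  have hb : (extChartAt I p.proj).symm y ∈ (chartAt H p.proj).source := by
    rw [← extChartAt_source (I := I)]; exact (extChartAt I p.proj).map_target h
  have h1 := TangentBundle.symmL_trivializationAt (I := I) hb
  rw [(extChartAt I p.proj).right_inv h, I.range_eq_univ, mfderivWithin_univ] at h1
  have hb' : (extChartAt I p.proj).symm y ∈
      (trivializationAt E (TangentSpace I) p.proj).baseSet := by
    rwa [TangentBundle.trivializationAt_baseSet]
  have h2 : chartDerivSymm I p.proj y v = (trivializationAt E (TangentSpace I) p.proj).symm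
      ((extChartAt I p.proj).symm y) v := by
    rw [← Bundle.Trivialization.symmL_apply (R := ℝ) _ hb', h1]
    rfl
  rw [h2, Bundle.Trivialization.mk_symm _ hb', FiberBundle.extChartAt]
  rfl

theorem extChartAt_tangent_source (p : TangentBundle I Q) :
    (extChartAt I.tangent p).source = {q | q.proj ∈ (extChartAt I p.proj).source} := by
  ext q
  rw [FiberBundle.extChartAt]
  simp

theorem extChartAt_tangent_target (p : TangentBundle I Q) :
    (extChartAt I.tangent p).target = {w | w.1 ∈ (extChartAt I p.proj).target} := by
  ext ⟨y, v⟩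
  rw [FiberBundle.extChartAt_target]
  simp only [TangentBundle.trivializationAt_baseSet, mem_prod, mem_inter_iff, mem_preimage,
    mem_univ, and_true, mem_ofPred_eq, and_iff_left_iff_imp]
  intro h
  rw [← extChartAt_source (I := I)]
  exact (extChartAt I p.proj).map_target h

theorem phase_source (x₀ : TangentBundle I Q × ℝ) : (extChartAt (phaseModel I) x₀).source =
    {x | x.1.proj ∈ (extChartAt I x₀.1.proj).source} := by
  ext x
  rw [extChartAt_prod, PartialEquiv.prod_source, extChartAt_tangent_source,
    extChartAt_model_space_eq_id]
  exact and_iff_left (mem_univ _)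

theorem phase_target (x₀ : TangentBundle I Q × ℝ) : (extChartAt (phaseModel I) x₀).target =
    {Y | Y.1.1 ∈ (extChartAt I x₀.1.proj).target} := by
  ext Y
  rw [extChartAt_prod, PartialEquiv.prod_target, extChartAt_tangent_target,
    extChartAt_model_space_eq_id]
  exact and_iff_left (mem_univ _)

theorem phase_apply {x₀ x : TangentBundle I Q × ℝ}
    (h : x.1.proj ∈ (extChartAt I x₀.1.proj).source) : extChartAt (phaseModel I) x₀ x =
      ((extChartAt I x₀.1.proj x.1.proj, chartDeriv I x₀.1.proj x.1.proj x.1.2), x.2) := by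
  rw [extChartAt_prod, ← extChartAt_tangent_apply h]
  rfl

theorem phase_symm_apply (x₀ : TangentBundle I Q × ℝ) {Y : (E × E) × ℝ}
    (h : Y.1.1 ∈ (extChartAt I x₀.1.proj).target) : (extChartAt (phaseModel I) x₀).symm Y =
      (⟨(extChartAt I x₀.1.proj).symm Y.1.1, chartDerivSymm I x₀.1.proj Y.1.1 Y.1.2⟩, Y.2) := by
  rw [extChartAt_prod, ← extChartAt_tangent_symm_apply x₀.1 h]
  rfl

theorem ext_apply (c₀ c : Q × ℝ) :
    extChartAt (extModel I) c₀ c = (extChartAt I c₀.1 c.1, c.2) := by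
  rw [extChartAt_prod]
  rfl

/-- The chart of `TQ × ℝ` turns the projection to `Q` into the projection to the positions, and so
the derivative of this projection into the first component of the coordinates of a vector. -/
theorem chartDeriv_mfderiv_proj {x₀ x : TangentBundle I Q × ℝ}
    (h : x.1.proj ∈ (extChartAt I x₀.1.proj).source) (v : TangentSpace (phaseModel I) x) :
    chartDeriv I x₀.1.proj x.1.proj
      (mfderiv (phaseModel I) I (fun y : TangentBundle I Q × ℝ => y.1.proj) x v) =
      (chartDeriv (phaseModel I) x₀ x v).1.1 := by
  have hx : x ∈ (extChartAt (phaseModel I) x₀).source := by rw [phase_source]; exact h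
  have hproj : ContMDiff (phaseModel I) I ∞ (fun y : TangentBundle I Q × ℝ => y.1.proj) :=
    (Bundle.contMDiff_proj (TangentSpace I)).comp contMDiff_fst
  have h1 := (hasMFDerivAt_extChartAt' I h).comp x
    (hproj.mdifferentiable (by simp) x).hasMFDerivAt
  let π : (E × E) × ℝ →L[ℝ] E := (ContinuousLinearMap.fst ℝ E E).comp (.fst ℝ (E × E) ℝ)
  have h2 := (π.hasFDerivAt (x := extChartAt (phaseModel I) x₀ x)).hasMFDerivAt.comp x
    (hasMFDerivAt_extChartAt' (phaseModel I) hx)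
  have h3 := h2.congr_of_eventuallyEq
    (f₁ := fun y => extChartAt I x₀.1.proj y.1.proj) (by
      filter_upwards [(isOpen_extChartAt_source x₀).mem_nhds hx] with y hy
      rw [phase_source] at hy
      rw [Function.comp_apply, phase_apply hy]
      rfl)
  exact DFunLike.congr_fun (hasMFDerivAt_unique h1 h3) v

theorem mfderiv_snd_phase {x₀ x : TangentBundle I Q × ℝ}
    (h : x.1.proj ∈ (extChartAt I x₀.1.proj).source) (v : TangentSpace (phaseModel I) x) :
    differential (phaseModel I) (fun y : TangentBundle I Q × ℝ => y.2) x v =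
      (chartDeriv (phaseModel I) x₀ x v).2 := by
  have hx : x ∈ (extChartAt (phaseModel I) x₀).source := by rw [phase_source]; exact h
  have h1 := ((contMDiff_snd (I := I.tangent) (J := 𝓘(ℝ, ℝ)) (M := TangentBundle I Q) (N := ℝ)
    (n := ∞)).mdifferentiable (by simp) x).hasMFDerivAt
  have h2 := ((ContinuousLinearMap.snd ℝ (E × E) ℝ).hasFDerivAt
    (x := extChartAt (phaseModel I) x₀ x)).hasMFDerivAt.comp x
    (hasMFDerivAt_extChartAt' (phaseModel I) hx)
  have h3 := h2.congr_of_eventuallyEq (f₁ := fun y => y.2) (by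
      filter_upwards [(isOpen_extChartAt_source x₀).mem_nhds hx] with y hy
      rw [phase_source] at hy
      rw [Function.comp_apply, phase_apply hy]
      rfl)
  exact DFunLike.congr_fun (hasMFDerivAt_unique h1 h3) v

end PhaseCharts

/-! ### The contact structure of `TQ × ℝ` in charts -/

section LagrangianInCharts

set_option linter.unusedSectionVars false

variable {E : Type*} [NormedAddCommGroup E] [NormedSpace ℝ E]
  {H : Type*} [TopologicalSpace H] {I : ModelWithCorners ℝ E H} [I.Boundaryless]
  {Q : Type*} [TopologicalSpace Q] [ChartedSpace H Q] [IsManifold I ∞ Q]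
  {L : TangentBundle I Q × ℝ → ℝ}

/-- The coordinate expression of `L` in the chart of `TQ × ℝ` at `x₀`. -/
def localLagrangian (L : TangentBundle I Q × ℝ → ℝ) (x₀ : TangentBundle I Q × ℝ)
    (Y : (E × E) × ℝ) : ℝ :=
  L ((extChartAt (phaseModel I) x₀).symm Y)

theorem contDiffOn_localLagrangian (hL : ContMDiff (phaseModel I) 𝓘(ℝ, ℝ) ∞ L)
    (x₀ : TangentBundle I Q × ℝ) :
    ContDiffOn ℝ ∞ (localLagrangian L x₀) (extChartAt (phaseModel I) x₀).target :=
  contMDiffOn_iff_contDiffOn.1 (hL.comp_contMDiffOn (contMDiffOn_extChartAt_symm x₀))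

theorem lagrangian_eq_localLagrangian {x₀ : TangentBundle I Q × ℝ} {q : Q}
    (h : q ∈ (extChartAt I x₀.1.proj).source) (u : TangentSpace I q) (z : ℝ) :
    L (⟨q, u⟩, z) =
      localLagrangian L x₀ ((extChartAt I x₀.1.proj q, chartDeriv I x₀.1.proj q u), z) := by
  have h1 := phase_apply (x₀ := x₀) (x := ((⟨q, u⟩ : TangentBundle I Q), z)) h
  rw [localLagrangian, ← h1, (extChartAt (phaseModel I) x₀).left_inv (by rw [phase_source]; exact h)]

theorem fiberDeriv_eq_momentum_comp (hL : ContMDiff (phaseModel I) 𝓘(ℝ, ℝ) ∞ L)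
    {x₀ : TangentBundle I Q × ℝ} {q : Q} (h : q ∈ (extChartAt I x₀.1.proj).source)
    (u : TangentSpace I q) (z : ℝ) :
    fiberDeriv I L (⟨q, u⟩, z) = (momentum (localLagrangian L x₀)
      ((extChartAt I x₀.1.proj q, chartDeriv I x₀.1.proj q u), z)).comp
        (chartDeriv I x₀.1.proj q) := by
  set B : E →L[ℝ] E := chartDeriv I x₀.1.proj q with hB
  set Y : E → (E × E) × ℝ := fun u => ((extChartAt I x₀.1.proj q, B u), z) with hYdef
  have hY : ∀ u, Y u ∈ (extChartAt (phaseModel I) x₀).target := fun u => by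
    rw [phase_target]; exact (extChartAt I x₀.1.proj).map_source h
  have h3 : ∀ u : E, HasFDerivAt (fun u : E => L ((⟨q, u⟩ : TangentBundle I Q), z))
      ((fderiv ℝ (localLagrangian L x₀) (Y u)).comp ((inclVel E).comp B)) u := fun u => by
    have h1 : HasFDerivAt (localLagrangian L x₀) (fderiv ℝ (localLagrangian L x₀) (Y u)) (Y u) :=
      (((contDiffOn_localLagrangian hL x₀).contDiffAt
        ((isOpen_extChartAt_target x₀).mem_nhds (hY u))).differentiableAt (by simp)).hasFDerivAt
    have h2 : HasFDerivAt Y ((inclVel E).comp B) u :=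
      ((((hasFDerivAt_const (extChartAt I x₀.1.proj q) u).prodMk B.hasFDerivAt).prodMk
        (hasFDerivAt_const z u)).congr_fderiv rfl :)
    have h4 := h1.comp u h2
    have h5 : (fun u : E => L ((⟨q, u⟩ : TangentBundle I Q), z)) = localLagrangian L x₀ ∘ Y :=
      funext fun u => lagrangian_eq_localLagrangian h u z
    rw [h5]
    exact h4
  exact (h3 u).fderiv

theorem fiberDeriv_apply (hL : ContMDiff (phaseModel I) 𝓘(ℝ, ℝ) ∞ L)
    {x₀ x : TangentBundle I Q × ℝ} (h : x.1.proj ∈ (extChartAt I x₀.1.proj).source)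
    (a : TangentSpace I x.1.proj) :
    fiberDeriv I L x a = momentum (localLagrangian L x₀) (extChartAt (phaseModel I) x₀ x)
      (chartDeriv I x₀.1.proj x.1.proj a) := by
  rw [phase_apply h]
  exact DFunLike.congr_fun (fiberDeriv_eq_momentum_comp hL h x.1.2 x.2) a

theorem isRegularAt_localLagrangian (hL : ContMDiff (phaseModel I) 𝓘(ℝ, ℝ) ∞ L)
    (hreg : IsRegular I L) (x₀ : TangentBundle I Q × ℝ) {Y : (E × E) × ℝ}
    (hY : Y ∈ (extChartAt (phaseModel I) x₀).target) :
    IsRegularAt (localLagrangian L x₀) Y := by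
  intro a ha
  have hY1 : Y.1.1 ∈ (extChartAt I x₀.1.proj).target := by rwa [phase_target] at hY
  set q := (extChartAt I x₀.1.proj).symm Y.1.1 with hq
  have hqs : q ∈ (extChartAt I x₀.1.proj).source := (extChartAt I x₀.1.proj).map_target hY1
  have hqY : extChartAt I x₀.1.proj q = Y.1.1 := (extChartAt I x₀.1.proj).right_inv hY1
  set B : E →L[ℝ] E := chartDeriv I x₀.1.proj q with hB
  let A : E →L[ℝ] E := chartDerivSymm I x₀.1.proj Y.1.1
  have hBA : ∀ v, B (A v) = v := fun v => mfderiv_extChartAt_symm_apply I hY1 v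
  set Z : E → (E × E) × ℝ := fun u => ((Y.1.1, B u), Y.2) with hZ
  have hZY : Z (A Y.1.2) = Y := by simp [hZ, hBA]
  have hp : HasFDerivAt (momentum (localLagrangian L x₀))
      (fderiv ℝ (momentum (localLagrangian L x₀)) Y) Y :=
    (((contDiffOn_momentum (isOpen_extChartAt_target x₀)
      (contDiffOn_localLagrangian hL x₀)).contDiffAt
      ((isOpen_extChartAt_target x₀).mem_nhds hY)).differentiableAt (by simp)).hasFDerivAt
  have h2 : HasFDerivAt Z ((inclVel E).comp B) (A Y.1.2) :=
    ((((hasFDerivAt_const Y.1.1 (A Y.1.2)).prodMk B.hasFDerivAt).prodMk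
      (hasFDerivAt_const Y.2 (A Y.1.2))).congr_fderiv rfl :)
  have h3 : HasFDerivAt (fun u : E => (momentum (localLagrangian L x₀) (Z u)).comp B)
      (((ContinuousLinearMap.compL ℝ E E ℝ).flip B).comp
        ((fderiv ℝ (momentum (localLagrangian L x₀)) Y).comp ((inclVel E).comp B)))
      (A Y.1.2) := by
    have h4 : HasFDerivAt (fun u : E => momentum (localLagrangian L x₀) (Z u))
        ((fderiv ℝ (momentum (localLagrangian L x₀)) Y).comp ((inclVel E).comp B)) (A Y.1.2) := by
      rw [← hZY] at hp
      have h5 := hp.comp (A Y.1.2) h2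
      rw [hZY] at h5
      exact h5
    exact ((ContinuousLinearMap.compL ℝ E E ℝ).flip B).hasFDerivAt.comp (A Y.1.2) h4
  have h4 : (fun v : E => (fderiv ℝ (fun u : E => L ((⟨q, u⟩ : TangentBundle I Q), Y.2)) v)) =
      fun u : E => (momentum (localLagrangian L x₀) (Z u)).comp B := by
    funext u
    have h5 := fiberDeriv_eq_momentum_comp hL hqs u Y.2
    rw [hqY] at h5
    exact h5
  have h5 : ∀ b : E, fiberHessian I L ((⟨q, A Y.1.2⟩ : TangentBundle I Q), Y.2) (A a) b =
      fderiv ℝ (momentum (localLagrangian L x₀)) Y (inclVel E (B (A a))) (B b) := by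
    intro b
    rw [← h4] at h3
    have h6 := h3.fderiv
    exact DFunLike.congr_fun (DFunLike.congr_fun h6 (A a)) b
  have h6 : (A a : E) = 0 := hreg ((⟨q, A Y.1.2⟩ : TangentBundle I Q), Y.2) (A a) fun b => by
    refine (h5 b).trans ?_
    rw [hBA]
    exact ha _
  rw [← hBA a, h6, map_zero]

theorem etaL_apply (hL : ContMDiff (phaseModel I) 𝓘(ℝ, ℝ) ∞ L)
    {x₀ x : TangentBundle I Q × ℝ} (h : x.1.proj ∈ (extChartAt I x₀.1.proj).source)
    (v : TangentSpace (phaseModel I) x) :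
    etaL I L x v = contactForm (localLagrangian L x₀) (extChartAt (phaseModel I) x₀ x)
      (chartDeriv (phaseModel I) x₀ x v) := by
  have h1 : etaL I L x v = differential (phaseModel I) (fun y : TangentBundle I Q × ℝ => y.2) x v -
    fiberDeriv I L x
      (mfderiv (phaseModel I) I (fun y : TangentBundle I Q × ℝ => y.1.proj) x v) := rfl
  rw [h1, mfderiv_snd_phase h, fiberDeriv_apply hL h, chartDeriv_mfderiv_proj h]
  rfl

theorem chartForm_etaL (hL : ContMDiff (phaseModel I) 𝓘(ℝ, ℝ) ∞ L)
    (x₀ : TangentBundle I Q × ℝ) {Y : (E × E) × ℝ}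
    (hY : Y ∈ (extChartAt (phaseModel I) x₀).target) :
    chartForm (phaseModel I) (etaL I L) x₀ Y = contactForm (localLagrangian L x₀) Y := by
  refine ContinuousLinearMap.ext fun w => ?_
  have hx := (extChartAt (phaseModel I) x₀).map_target hY
  have hx' := hx
  rw [phase_source] at hx'
  have h1 := etaL_apply hL hx' (chartDerivSymm (phaseModel I) x₀ Y w)
  have h2 : chartDeriv (phaseModel I) x₀ ((extChartAt (phaseModel I) x₀).symm Y)
    (chartDerivSymm (phaseModel I) x₀ Y w) = w := mfderiv_extChartAt_symm_apply (phaseModel I) hY w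
  rw [h2, (extChartAt (phaseModel I) x₀).right_inv hY] at h1
  exact h1

theorem chartForm_etaL_eventuallyEq (hL : ContMDiff (phaseModel I) 𝓘(ℝ, ℝ) ∞ L)
    (x₀ : TangentBundle I Q × ℝ) {Y : (E × E) × ℝ}
    (hY : Y ∈ (extChartAt (phaseModel I) x₀).target) :
    chartForm (phaseModel I) (etaL I L) x₀ =ᶠ[𝓝 Y] contactForm (localLagrangian L x₀) := by
  filter_upwards [(isOpen_extChartAt_target x₀).mem_nhds hY] with Y' hY'
  exact chartForm_etaL hL x₀ hY'

theorem differentiableAt_chartForm_etaL (hL : ContMDiff (phaseModel I) 𝓘(ℝ, ℝ) ∞ L)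
    (x₀ : TangentBundle I Q × ℝ) {Y : (E × E) × ℝ}
    (hY : Y ∈ (extChartAt (phaseModel I) x₀).target) :
    DifferentiableAt ℝ (chartForm (phaseModel I) (etaL I L) x₀) Y :=
  ((hasFDerivAt_contactForm (isOpen_extChartAt_target x₀) (contDiffOn_localLagrangian hL x₀)
    hY).congr_of_eventuallyEq (chartForm_etaL_eventuallyEq hL x₀ hY)).differentiableAt

theorem extDerivOneForm_etaL (hL : ContMDiff (phaseModel I) 𝓘(ℝ, ℝ) ∞ L)
    {x₀ x : TangentBundle I Q × ℝ} (h : x.1.proj ∈ (extChartAt I x₀.1.proj).source)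
    (u w : TangentSpace (phaseModel I) x) :
    extDerivOneForm (phaseModel I) (etaL I L) x u w =
      dContactForm (localLagrangian L x₀) (extChartAt (phaseModel I) x₀ x)
        (chartDeriv (phaseModel I) x₀ x u) (chartDeriv (phaseModel I) x₀ x w) := by
  have hx : x ∈ (extChartAt (phaseModel I) x₀).source := by rw [phase_source]; exact h
  have hY := (extChartAt (phaseModel I) x₀).map_source hx
  rw [extDerivOneForm_eq (etaL I L) hx (differentiableAt_chartForm_etaL hL x₀ hY),
    (chartForm_etaL_eventuallyEq hL x₀ hY).fderiv_eq]
  rfl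

theorem energy_eq (hL : ContMDiff (phaseModel I) 𝓘(ℝ, ℝ) ∞ L)
    {x₀ x : TangentBundle I Q × ℝ} (h : x.1.proj ∈ (extChartAt I x₀.1.proj).source) :
    energy I L x = localEnergy (localLagrangian L x₀) (extChartAt (phaseModel I) x₀ x) := by
  have hx : x ∈ (extChartAt (phaseModel I) x₀).source := by rw [phase_source]; exact h
  rw [energy, fiberDeriv_apply hL h, localEnergy, localLagrangian,
    (extChartAt (phaseModel I) x₀).left_inv hx]
  congr 2
  rw [phase_apply h]

theorem differential_energy (hL : ContMDiff (phaseModel I) 𝓘(ℝ, ℝ) ∞ L)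
    {x₀ x : TangentBundle I Q × ℝ} (h : x.1.proj ∈ (extChartAt I x₀.1.proj).source)
    (v : TangentSpace (phaseModel I) x) :
    differential (phaseModel I) (energy I L) x v =
      fderiv ℝ (localEnergy (localLagrangian L x₀)) (extChartAt (phaseModel I) x₀ x)
        (chartDeriv (phaseModel I) x₀ x v) := by
  have hx : x ∈ (extChartAt (phaseModel I) x₀).source := by rw [phase_source]; exact h
  have hY := (extChartAt (phaseModel I) x₀).map_source hx
  have h1 : HasFDerivAt (localEnergy (localLagrangian L x₀))
      (fderiv ℝ (localEnergy (localLagrangian L x₀)) (extChartAt (phaseModel I) x₀ x))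
      (extChartAt (phaseModel I) x₀ x) :=
    (((contDiffOn_localEnergy (isOpen_extChartAt_target x₀)
      (contDiffOn_localLagrangian hL x₀)).contDiffAt
      ((isOpen_extChartAt_target x₀).mem_nhds hY)).differentiableAt (by simp)).hasFDerivAt
  have h2 := h1.hasMFDerivAt.comp x (hasMFDerivAt_extChartAt' (phaseModel I) hx)
  have h3 := h2.congr_of_eventuallyEq (f₁ := energy I L) (by
    filter_upwards [(isOpen_extChartAt_source x₀).mem_nhds hx] with y hy
    rw [phase_source] at hy
    exact energy_eq hL hy)
  exact DFunLike.congr_fun h3.mfderiv v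

variable [FiniteDimensional ℝ E]

/-- In every chart, the Herglotz vector field `ξ_L` is given by the Herglotz equations. -/
theorem chartDeriv_xiL (hL : ContMDiff (phaseModel I) 𝓘(ℝ, ℝ) ∞ L) (hreg : IsRegular I L)
    {x₀ x : TangentBundle I Q × ℝ} (h : x.1.proj ∈ (extChartAt I x₀.1.proj).source) :
    chartDeriv (phaseModel I) x₀ x (xiL I L x) =
      herglotzField (localLagrangian L x₀) (extChartAt (phaseModel I) x₀ x) := by
  have hx : x ∈ (extChartAt (phaseModel I) x₀).source := by rw [phase_source]; exact h
  set ℓ := localLagrangian L x₀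
  set Y := extChartAt (phaseModel I) x₀ x with hYdef
  have hY : Y ∈ (extChartAt (phaseModel I) x₀).target := (extChartAt (phaseModel I) x₀).map_source hx
  have hO := isOpen_extChartAt_target (I := phaseModel I) x₀
  have hℓ := contDiffOn_localLagrangian hL x₀
  have hregY : IsRegularAt ℓ Y := isRegularAt_localLagrangian hL hreg x₀ hY
  let T : TangentSpace (phaseModel I) x →L[ℝ] (E × E) × ℝ := chartDeriv (phaseModel I) x₀ x
  -- the derivative of the chart is onto
  have hT : ∀ w : (E × E) × ℝ, ∃ v : TangentSpace (phaseModel I) x, T v = w := by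
    intro w
    have h1 := mfderiv_extChartAt_symm_apply (phaseModel I) hY w
    rw [(extChartAt (phaseModel I) x₀).left_inv hx] at h1
    exact ⟨_, h1⟩
  have heta : ∀ v, etaL I L x v = contactForm ℓ Y (T v) := etaL_apply hL h
  have hd : ∀ u v, extDerivOneForm (phaseModel I) (etaL I L) x u v = dContactForm ℓ Y (T u) (T v) :=
    extDerivOneForm_etaL hL h
  have hE : ∀ v, differential (phaseModel I) (energy I L) x v = fderiv ℝ (localEnergy ℓ) Y (T v) :=
    differential_energy hL h
  have hR : (∀ w, dContactForm ℓ Y (T (reebField (phaseModel I) (etaL I L) x)) w = 0) ∧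
      contactForm ℓ Y (T (reebField (phaseModel I) (etaL I L) x)) = 1 := by
    obtain ⟨R, hR, hR1⟩ := exists_reeb hO hℓ hY hregY
    obtain ⟨r, hr⟩ := hT R
    have h1 := Classical.epsilon_spec (p := fun R : TangentSpace (phaseModel I) x =>
      (∀ w, extDerivOneForm (phaseModel I) (etaL I L) x R w = 0) ∧ etaL I L x R = 1)
      ⟨r, fun w => by rw [hd, hr, hR], by rw [heta, hr, hR1]⟩
    refine ⟨fun w => ?_, ?_⟩
    · obtain ⟨v, rfl⟩ := hT w
      rw [← hd]
      exact h1.1 v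
    · rw [← heta]
      exact h1.2
  set R := reebField (phaseModel I) (etaL I L) x with hRdef
  have hherg := IsHerglotz.contactHamiltonian hO hℓ hY hregY hR.1 hR.2
    hregY.isHerglotz_herglotzField
  have hflat : ∀ u v, flat (phaseModel I) (etaL I L) x u v =
      dContactForm ℓ Y (T u) (T v) + contactForm ℓ Y (T u) * contactForm ℓ Y (T v) := fun u v => by
    rw [flat, hd, heta, heta]
  have hxi : ∀ v, flat (phaseModel I) (etaL I L) x (xiL I L x) v =
      differential (phaseModel I) (energy I L) x v - (energy I L x +
        differential (phaseModel I) (energy I L) x R) * etaL I L x v := by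
    obtain ⟨ζ, hζ⟩ := hT (herglotzField ℓ Y)
    refine Classical.epsilon_spec (p := fun Z : TangentSpace (phaseModel I) x =>
      ∀ v, flat (phaseModel I) (etaL I L) x Z v =
      differential (phaseModel I) (energy I L) x v - (energy I L x +
        differential (phaseModel I) (energy I L) x R) * etaL I L x v) ⟨ζ, fun v => ?_⟩
    rw [hflat, hζ, hE, hE, heta, energy_eq hL h]
    exact hherg (T v)
  change T (xiL I L x) = _
  rw [← sub_eq_zero]
  refine flat_injective hO hℓ hY hregY hR.1 hR.2 fun w => ?_
  obtain ⟨v, rfl⟩ := hT w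
  have h1 := hxi v
  rw [hflat, hE, hE, heta, energy_eq hL h, ← hherg (T v)] at h1
  have h2 : ∀ a b c : (E × E) × ℝ, dContactForm ℓ Y (a - b) c =
      dContactForm ℓ Y a c - dContactForm ℓ Y b c := fun a b c => by
    simp only [dContactForm, map_sub, _root_.sub_apply]
    ring
  rw [h2, map_sub]
  linarith

theorem chartField_xiL (hL : ContMDiff (phaseModel I) 𝓘(ℝ, ℝ) ∞ L) (hreg : IsRegular I L)
    (x₀ : TangentBundle I Q × ℝ) {Y : (E × E) × ℝ}
    (hY : Y ∈ (extChartAt (phaseModel I) x₀).target) :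
    chartField (phaseModel I) (xiL I L) x₀ Y = herglotzField (localLagrangian L x₀) Y := by
  have hx := (extChartAt (phaseModel I) x₀).map_target hY
  rw [phase_source] at hx
  have h := chartDeriv_xiL hL hreg hx
  rw [(extChartAt (phaseModel I) x₀).right_inv hY] at h
  exact h

theorem isHerglotz_chartField_xiL (hL : ContMDiff (phaseModel I) 𝓘(ℝ, ℝ) ∞ L)
    (hreg : IsRegular I L) (x₀ : TangentBundle I Q × ℝ) {Y : (E × E) × ℝ}
    (hY : Y ∈ (extChartAt (phaseModel I) x₀).target) :
    IsHerglotz (localLagrangian L x₀) Y (chartField (phaseModel I) (xiL I L) x₀ Y) := by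
  rw [chartField_xiL hL hreg x₀ hY]
  exact (isRegularAt_localLagrangian hL hreg x₀ hY).isHerglotz_herglotzField

theorem isSmoothField_xiL (hL : ContMDiff (phaseModel I) 𝓘(ℝ, ℝ) ∞ L) (hreg : IsRegular I L) :
    IsSmoothField (phaseModel I) (xiL I L) := fun x₀ =>
  (contDiffOn_herglotzField (isOpen_extChartAt_target x₀) (contDiffOn_localLagrangian hL x₀)
    fun _ hY => isRegularAt_localLagrangian hL hreg x₀ hY).congr
      fun _ hY => chartField_xiL hL hreg x₀ hY

/-- The Lie derivative of `η_L` along `ξ_L` is `(∂L/∂z) η_L`. -/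
theorem lieDerivProportional_etaL (hL : ContMDiff (phaseModel I) 𝓘(ℝ, ℝ) ∞ L)
    (hreg : IsRegular I L) : LieDerivProportional (xiL I L) (etaL I L) := by
  intro x₀
  have hO := isOpen_extChartAt_target (I := phaseModel I) x₀
  have hℓ := contDiffOn_localLagrangian hL x₀
  refine ⟨fun Y hY => differentiableAt_chartForm_etaL hL x₀ hY,
    fun Y => fderiv ℝ (localLagrangian L x₀) Y (0, 1),
    ((hℓ.fderiv_of_isOpen hO (m := ∞) (by simp)).clm_apply contDiffOn_const).continuousOn,
    fun Y hY w => ?_⟩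
  rw [(chartForm_etaL_eventuallyEq hL x₀ hY).fderiv_eq, chartForm_etaL hL x₀ hY]
  exact lieDeriv_contactForm hO hℓ hY (fun Y' hY' => isHerglotz_chartField_xiL hL hreg x₀ hY')
    ((((isSmoothField_xiL hL hreg) x₀).contDiffAt (hO.mem_nhds hY)).differentiableAt (by simp)) w

end LagrangianInCharts

/-! ### Chetaev's equations in coordinates -/

section LocalChetaev

variable {E : Type*} [NormedAddCommGroup E] [NormedSpace ℝ E]

/-- The lift of a curve `y = (q, z)` of the coordinate space of `Q × ℝ` to the coordinate space of
`TQ × ℝ`, namely `(q, q̇, z)`. -/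
def liftCurve (y : ℝ → E × ℝ) (s : ℝ) : (E × E) × ℝ := (((y s).1, (deriv y s).1), (y s).2)

theorem contDiffAt_liftCurve {y : ℝ → E × ℝ} {t : ℝ} (hy : ContDiffAt ℝ ∞ y t) :
    ContDiffAt ℝ ∞ (liftCurve y) t := by
  have h2 : ContDiffAt ℝ ∞ (deriv y) t :=
    (hy.fderiv_right (m := ∞) (by simp)).clm_apply contDiffAt_const
  exact (hy.fst.prodMk h2.fst).prodMk hy.snd

theorem deriv_liftCurve {y : ℝ → E × ℝ} {t : ℝ} (hy : ContDiffAt ℝ ∞ y t) :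
    (deriv (liftCurve y) t).1.1 = (deriv y t).1 ∧ (deriv (liftCurve y) t).2 = (deriv y t).2 := by
  have h1 := ((contDiffAt_liftCurve hy).differentiableAt (by simp)).hasDerivAt
  have h2 := (hy.differentiableAt (by simp)).hasDerivAt
  exact ⟨HasDerivAt.unique h1.fst.fst h2.fst, HasDerivAt.unique h1.snd h2.snd⟩

variable {ℓ : (E × E) × ℝ → ℝ} {O : Set ((E × E) × ℝ)}

theorem hasFDerivAt_along_fiber (hO : IsOpen O) (hℓ : ContDiffOn ℝ ∞ ℓ O) {q v : E} {z ż : ℝ}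
    (hY : ((q, v), z) ∈ O) :
    HasFDerivAt (fun v' : E × ℝ => ℓ ((q, v'.1), z))
      ((momentum ℓ ((q, v), z)).comp (.fst ℝ E ℝ)) (v, ż) := by
  have h1 : HasFDerivAt ℓ (fderiv ℝ ℓ ((q, v), z)) ((q, v), z) :=
    ((hℓ.contDiffAt (hO.mem_nhds hY)).differentiableAt (by simp)).hasFDerivAt
  have h2 : HasFDerivAt (fun v' : E × ℝ => ((q, v'.1), z))
      ((inclVel E).comp (.fst ℝ E ℝ)) (v, ż) :=
    ((hasFDerivAt_const q (v, ż)).prodMk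
      (ContinuousLinearMap.fst ℝ E ℝ).hasFDerivAt).prodMk (hasFDerivAt_const z (v, ż))
  exact HasFDerivAt.comp (f := fun v' : E × ℝ => ((q, v'.1), z)) (v, ż) h1 h2

theorem hasFDerivAt_along_base (hO : IsOpen O) (hℓ : ContDiffOn ℝ ∞ ℓ O) {q v : E} {z : ℝ}
    (hY : ((q, v), z) ∈ O) :
    HasFDerivAt (fun y : E × ℝ => ℓ ((y.1, v), y.2))
      ((fderiv ℝ ℓ ((q, v), z)).comp ((inclPos E).coprod (.inr ℝ (E × E) ℝ))) (q, z) := by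
  have h1 : HasFDerivAt ℓ (fderiv ℝ ℓ ((q, v), z)) ((q, v), z) :=
    ((hℓ.contDiffAt (hO.mem_nhds hY)).differentiableAt (by simp)).hasFDerivAt
  have h2 : HasFDerivAt (fun y : E × ℝ => ((y.1, v), y.2))
      ((inclPos E).coprod (.inr ℝ (E × E) ℝ)) (q, z) :=
    (((hasFDerivAt_fst (p := (q, z))).prodMk (hasFDerivAt_const v (q, z))).prodMk
      hasFDerivAt_snd).congr_fderiv (by
        refine ContinuousLinearMap.ext fun w => ?_
        simp [inclPos_apply])
  exact HasFDerivAt.comp (f := fun y : E × ℝ => ((y.1, v), y.2)) (q, z) h1 h2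

/-- In coordinates, Chetaev's equations with the constraint `ż = ℓ` are the Herglotz equations:
the `z`-component of Chetaev's equations determines the multiplier as `-∂ℓ/∂z`. -/
theorem chetaev_iff_isHerglotz (hO : IsOpen O) (hℓ : ContDiffOn ℝ ∞ ℓ O) {y : ℝ → E × ℝ} {t : ℝ}
    (hy : ContDiffAt ℝ ∞ y t) (hY : liftCurve y t ∈ O) :
    ((∃ lam : ℝ, deriv (fun s => fderiv ℝ (fun v : E × ℝ => ℓ (((y s).1, v.1), (y s).2))
            (deriv y s)) t -
          fderiv ℝ (fun y' : E × ℝ => ℓ ((y'.1, (deriv y t).1), y'.2)) (y t) =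
        lam • fderiv ℝ (fun v : E × ℝ => v.2 - ℓ (((y t).1, v.1), (y t).2)) (deriv y t)) ∧
      (deriv y t).2 - ℓ (liftCurve y t) = 0) ↔
    IsHerglotz ℓ (liftCurve y t) (deriv (liftCurve y) t) := by
  set Y := liftCurve y t with hYdef
  have hp : HasFDerivAt (momentum ℓ) (fderiv ℝ (momentum ℓ) Y) Y :=
    (((contDiffOn_momentum hO hℓ).contDiffAt (hO.mem_nhds hY)).differentiableAt
      (by simp)).hasFDerivAt
  have hY' := ((contDiffAt_liftCurve hy).differentiableAt (by simp)).hasDerivAt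
  have h1 : HasDerivAt (fun s => (momentum ℓ (liftCurve y s)).comp (.fst ℝ E ℝ))
      ((fderiv ℝ (momentum ℓ) Y (deriv (liftCurve y) t)).comp (.fst ℝ E ℝ)) t :=
    HasFDerivAt.comp_hasDerivAt (f := fun s => momentum ℓ (liftCurve y s)) t
      ((ContinuousLinearMap.compL ℝ (E × ℝ) E ℝ).flip (.fst ℝ E ℝ)).hasFDerivAt
      (HasFDerivAt.comp_hasDerivAt (f := liftCurve y) t hp hY')
  have h2 : deriv (fun s => fderiv ℝ (fun v : E × ℝ => ℓ (((y s).1, v.1), (y s).2))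
      (deriv y s)) t = (fderiv ℝ (momentum ℓ) Y (deriv (liftCurve y) t)).comp (.fst ℝ E ℝ) := by
    refine (h1.congr_of_eventuallyEq ?_).deriv
    filter_upwards [(contDiffAt_liftCurve hy).continuousAt.preimage_mem_nhds (hO.mem_nhds hY)]
      with s hs
    exact (hasFDerivAt_along_fiber hO hℓ (ż := (deriv y s).2) hs).fderiv
  have h3 := (hasFDerivAt_along_base hO hℓ hY).fderiv
  have h4 : fderiv ℝ (fun v : E × ℝ => v.2 - ℓ (((y t).1, v.1), (y t).2)) (deriv y t) =
      .snd ℝ E ℝ - (momentum ℓ Y).comp (.fst ℝ E ℝ) :=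
    ((hasFDerivAt_snd (p := deriv y t)).sub
      (hasFDerivAt_along_fiber hO hℓ (ż := (deriv y t).2) hY)).fderiv
  have h5 := deriv_liftCurve hy
  have hr : ∀ r : ℝ, fderiv ℝ ℓ Y ((0 : E × E), r) = r * fderiv ℝ ℓ Y (0, 1) := fun r => by
    rw [← smul_eq_mul, ← map_smul]
    simp
  rw [h2, h4, show fderiv ℝ (fun y' : E × ℝ => ℓ ((y'.1, (deriv y t).1), y'.2)) (y t) =
    (fderiv ℝ ℓ Y).comp ((inclPos E).coprod (.inr ℝ (E × E) ℝ)) from h3]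
  constructor
  -- Chetaev's equations for the variations `δz = 1` and `δq = a`
  · rintro ⟨⟨lam, h⟩, hc⟩
    refine ⟨h5.1, h5.2.trans (sub_eq_zero.1 hc), fun a => ?_⟩
    have e1 := DFunLike.congr_fun h ((0 : E), (1 : ℝ))
    have e2 := DFunLike.congr_fun h (a, (0 : ℝ))
    simp at e1 e2
    have := hr 0
    rw [← e1] at e2
    linarith
  · rintro ⟨h6, h7, h8⟩
    refine ⟨⟨-fderiv ℝ ℓ Y (0, 1), ContinuousLinearMap.ext fun w => ?_⟩,
      sub_eq_zero.2 (h5.2.symm.trans h7)⟩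
    have h9 := h8 w.1
    simp
    rw [hr w.2, h9]
    ring

end LocalChetaev

/-! ### Nonholonomic motions are integral curves of the Herglotz field -/

section Motions

set_option linter.unusedSectionVars false

variable {E : Type*} [NormedAddCommGroup E] [NormedSpace ℝ E]
  {H : Type*} [TopologicalSpace H] {I : ModelWithCorners ℝ E H} [I.Boundaryless]
  {Q : Type*} [TopologicalSpace Q] [ChartedSpace H Q] [IsManifold I ∞ Q]
  {L : TangentBundle I Q × ℝ → ℝ}

theorem ext_target (c₀ : Q × ℝ) :
    (extChartAt (extModel I) c₀).target = {y | y.1 ∈ (extChartAt I c₀.1).target} := by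
  ext Y
  rw [extChartAt_prod, PartialEquiv.prod_target, extChartAt_model_space_eq_id]
  exact and_iff_left (mem_univ _)

theorem ext_source (c₀ : Q × ℝ) :
    (extChartAt (extModel I) c₀).source = {c | c.1 ∈ (extChartAt I c₀.1).source} := by
  ext c
  rw [extChartAt_prod, PartialEquiv.prod_source, extChartAt_model_space_eq_id]
  exact and_iff_left (mem_univ _)

theorem ext_symm_apply (c₀ : Q × ℝ) (y : E × ℝ) :
    (extChartAt (extModel I) c₀).symm y = ((extChartAt I c₀.1).symm y.1, y.2) := by
  rw [extChartAt_prod]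
  rfl

theorem mfderiv_fst_chartDerivSymm (c₀ : Q × ℝ) {y : E × ℝ}
    (hy : y.1 ∈ (extChartAt I c₀.1).target) (v : E × ℝ) :
    mfderiv (extModel I) I Prod.fst ((extChartAt (extModel I) c₀).symm y)
      (chartDerivSymm (extModel I) c₀ y v) = chartDerivSymm I c₀.1 y.1 v.1 := by
  have hy' : y ∈ (extChartAt (extModel I) c₀).target := by rw [ext_target]; exact hy
  have h1 := (mdifferentiable_fst (I := I) (I' := 𝓘(ℝ, ℝ)) (M := Q) (M' := ℝ)
    ((extChartAt (extModel I) c₀).symm y)).hasMFDerivAt.comp y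
      (hasMFDerivAt_extChartAt_symm (extModel I) hy')
  have h2 := (hasMFDerivAt_extChartAt_symm I hy).comp y
    ((ContinuousLinearMap.fst ℝ E ℝ).hasFDerivAt (x := y)).hasMFDerivAt
  have h3 : (extChartAt I c₀.1).symm ∘ Prod.fst =
      Prod.fst ∘ (extChartAt (extModel I) c₀).symm := by
    funext y
    rw [Function.comp_apply, Function.comp_apply, ext_symm_apply]
  rw [h3] at h2
  exact DFunLike.congr_fun (hasMFDerivAt_unique h1 h2) v

theorem mfderiv_snd_chartDerivSymm (c₀ : Q × ℝ) {y : E × ℝ}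
    (hy : y.1 ∈ (extChartAt I c₀.1).target) (v : E × ℝ) :
    differential (extModel I) (fun y : Q × ℝ => y.2) ((extChartAt (extModel I) c₀).symm y)
      (chartDerivSymm (extModel I) c₀ y v) = v.2 := by
  have hy' : y ∈ (extChartAt (extModel I) c₀).target := by rw [ext_target]; exact hy
  have h1 := (mdifferentiable_snd (I := I) (I' := 𝓘(ℝ, ℝ)) (M := Q) (M' := ℝ)
    ((extChartAt (extModel I) c₀).symm y)).hasMFDerivAt.comp y
      (hasMFDerivAt_extChartAt_symm (extModel I) hy')
  have h2 := ((ContinuousLinearMap.snd ℝ E ℝ).hasFDerivAt (x := y)).hasMFDerivAt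
  have h3 : ⇑(ContinuousLinearMap.snd ℝ E ℝ) =
      Prod.snd ∘ (extChartAt (extModel I) c₀).symm := by
    funext y
    rw [Function.comp_apply, ext_symm_apply]
    rfl
  rw [h3] at h2
  exact DFunLike.congr_fun (hasMFDerivAt_unique h1 h2) v

/-- The coordinate expression of `L ∘ π`. -/
theorem inChart_comp_projTQ (x₀ : TangentBundle I Q × ℝ) (c₀ : Q × ℝ) (hc : c₀.1 = x₀.1.proj)
    {y : E × ℝ} (hy : y.1 ∈ (extChartAt I c₀.1).target) (v : E × ℝ) :
    inChart (extModel I) (L ∘ projTQ I) c₀ y v = localLagrangian L x₀ ((y.1, v.1), y.2) := by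
  have h1 := mfderiv_fst_chartDerivSymm c₀ hy v
  have h2 : projTQ I ⟨(extChartAt (extModel I) c₀).symm y, chartDerivSymm (extModel I) c₀ y v⟩ =
      (⟨(extChartAt I c₀.1).symm y.1, chartDerivSymm I c₀.1 y.1 v.1⟩, y.2) := by
    exact Prod.ext (congrArg (fun u : E => (⟨(extChartAt I c₀.1).symm y.1, u⟩ : TangentBundle I Q))
      h1) rfl
  rw [localLagrangian, phase_symm_apply x₀ (hc ▸ hy), ← hc]
  exact congrArg L h2

theorem inChart_constraint (x₀ : TangentBundle I Q × ℝ) (c₀ : Q × ℝ) (hc : c₀.1 = x₀.1.proj)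
    {y : E × ℝ} (hy : y.1 ∈ (extChartAt I c₀.1).target) (v : E × ℝ) :
    inChart (extModel I) (constraint I L) c₀ y v =
      v.2 - localLagrangian L x₀ ((y.1, v.1), y.2) :=
  congrArg₂ (· - ·) (mfderiv_snd_chartDerivSymm c₀ hy v) (inChart_comp_projTQ x₀ c₀ hc hy v)

theorem chartDeriv_mfderiv_fst (c₀ : Q × ℝ) {c : Q × ℝ} (h : c.1 ∈ (extChartAt I c₀.1).source)
    (w : TangentSpace (extModel I) c) :
    chartDeriv I c₀.1 c.1 (mfderiv (extModel I) I Prod.fst c w) =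
      (chartDeriv (extModel I) c₀ c w).1 := by
  have h' : c ∈ (extChartAt (extModel I) c₀).source := by rw [ext_source]; exact h
  have h1 := (hasMFDerivAt_extChartAt' I h).comp c
    (mdifferentiable_fst (I := I) (I' := 𝓘(ℝ, ℝ)) (M := Q) (M' := ℝ) c).hasMFDerivAt
  have h2 := ((ContinuousLinearMap.fst ℝ E ℝ).hasFDerivAt
    (x := extChartAt (extModel I) c₀ c)).hasMFDerivAt.comp c
    (hasMFDerivAt_extChartAt' (extModel I) h')
  have h3 : Prod.fst ∘ extChartAt (extModel I) c₀ = extChartAt I c₀.1 ∘ Prod.fst := by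
    funext c
    rw [Function.comp_apply, Function.comp_apply, ext_apply]
  rw [ContinuousLinearMap.coe_fst', h3] at h2
  exact DFunLike.congr_fun (hasMFDerivAt_unique h1 h2) w

theorem differential_snd (c₀ : Q × ℝ) {c : Q × ℝ} (h : c.1 ∈ (extChartAt I c₀.1).source)
    (w : TangentSpace (extModel I) c) :
    differential (extModel I) (fun y : Q × ℝ => y.2) c w =
      (chartDeriv (extModel I) c₀ c w).2 := by
  have h' : c ∈ (extChartAt (extModel I) c₀).source := by rw [ext_source]; exact h
  have h1 := (mdifferentiable_snd (I := I) (I' := 𝓘(ℝ, ℝ)) (M := Q) (M' := ℝ) c).hasMFDerivAt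
  have h2 := ((ContinuousLinearMap.snd ℝ E ℝ).hasFDerivAt
    (x := extChartAt (extModel I) c₀ c)).hasMFDerivAt.comp c
    (hasMFDerivAt_extChartAt' (extModel I) h')
  have h3 : Prod.snd ∘ extChartAt (extModel I) c₀ = Prod.snd := by
    funext c
    rw [Function.comp_apply, ext_apply]
  rw [ContinuousLinearMap.coe_snd', h3] at h2
  exact DFunLike.congr_fun (hasMFDerivAt_unique h1 h2) w

theorem hasDerivAt_extChartAt_comp {c₀ : Q × ℝ} {c : ℝ → Q × ℝ} {s : ℝ}
    (hc : MDifferentiableAt 𝓘(ℝ, ℝ) (extModel I) c s)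
    (hs : (c s).1 ∈ (extChartAt I c₀.1).source) :
    HasDerivAt (fun s => extChartAt (extModel I) c₀ (c s))
      (chartDeriv (extModel I) c₀ (c s) (mfderiv 𝓘(ℝ, ℝ) (extModel I) c s (1 : ℝ))) s := by
  have h' : c s ∈ (extChartAt (extModel I) c₀).source := by rw [ext_source]; exact hs
  have h := (hasMFDerivAt_extChartAt' (extModel I) h').comp s hc.hasMFDerivAt
  let D : ℝ →L[ℝ] E × ℝ := (mfderiv (extModel I) 𝓘(ℝ, E × ℝ) (extChartAt (extModel I) c₀)
    (c s)).comp (mfderiv 𝓘(ℝ, ℝ) (extModel I) c s)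
  have h1 : HasFDerivAt (fun s => extChartAt (extModel I) c₀ (c s)) D s :=
    hasMFDerivAt_iff_hasFDerivAt.1 h
  exact h1.hasDerivAt

/-- The chart of `TQ × ℝ` turns the velocity lift of a curve into the lift of its coordinates. -/
theorem phase_velocity {x₀ : TangentBundle I Q × ℝ} {c₀ : Q × ℝ} (h₀ : c₀.1 = x₀.1.proj)
    {c : ℝ → Q × ℝ} {s : ℝ} (hc : MDifferentiableAt 𝓘(ℝ, ℝ) (extModel I) c s)
    (hs : (c s).1 ∈ (extChartAt I c₀.1).source) :
    extChartAt (phaseModel I) x₀ (projTQ I (velocity (extModel I) c s)) =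
      liftCurve (fun s => extChartAt (extModel I) c₀ (c s)) s := by
  have h1 := chartDeriv_mfderiv_fst c₀ hs (mfderiv 𝓘(ℝ, ℝ) (extModel I) c s (1 : ℝ))
  rw [← (hasDerivAt_extChartAt_comp hc hs).deriv] at h1
  have h2 := phase_apply (x₀ := x₀) (x := projTQ I (velocity (extModel I) c s)) (h₀ ▸ hs)
  rw [h2, liftCurve, ← h1, ext_apply, h₀]
  rfl

/-- Along a curve, the constraint function `ż - L` is computed in a chart. -/
theorem constraint_velocity {x₀ : TangentBundle I Q × ℝ} {c₀ : Q × ℝ} (h₀ : c₀.1 = x₀.1.proj)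
    {c : ℝ → Q × ℝ} {s : ℝ} (hc : MDifferentiableAt 𝓘(ℝ, ℝ) (extModel I) c s)
    (hs : (c s).1 ∈ (extChartAt I c₀.1).source) :
    constraint I L (velocity (extModel I) c s) =
      (deriv (fun s => extChartAt (extModel I) c₀ (c s)) s).2 -
        localLagrangian L x₀ (liftCurve (fun s => extChartAt (extModel I) c₀ (c s)) s) := by
  rw [← phase_velocity h₀ hc hs, localLagrangian, (extChartAt (phaseModel I) x₀).left_inv
    (by rw [phase_source, ← h₀]; exact hs), (hasDerivAt_extChartAt_comp hc hs).deriv,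
    ← differential_snd c₀ hs]
  rfl

theorem contDiffAt_extChartAt_comp {c₀ : Q × ℝ} {c : ℝ → Q × ℝ} {s : ℝ}
    (hc : ContMDiffAt 𝓘(ℝ, ℝ) (extModel I) ∞ c s)
    (hs : (c s).1 ∈ (extChartAt I c₀.1).source) :
    ContDiffAt ℝ ∞ (fun s => extChartAt (extModel I) c₀ (c s)) s := by
  have h' : c s ∈ (chartAt (ModelProd H ℝ) c₀).source := by
    rw [← extChartAt_source (extModel I), ext_source]; exact hs
  exact contMDiffAt_iff_contDiffAt.1 ((contMDiffAt_extChartAt' h').comp s hc)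

/-- The equations of motion of the nonholonomic system `(L ∘ π, M_L)` along a curve, in a chart,
are the Herglotz equations for the lift of the curve. -/
theorem motion_iff_isHerglotz (hL : ContMDiff (phaseModel I) 𝓘(ℝ, ℝ) ∞ L)
    {x₀ : TangentBundle I Q × ℝ} {c : ℝ → Q × ℝ} {t : ℝ}
    (hc : ContMDiffAt 𝓘(ℝ, ℝ) (extModel I) ∞ c t) (h₀ : (c t).1 = x₀.1.proj) :
    (constraint I L (velocity (extModel I) c t) = 0 ∧
      ∃ lam : ℝ, eulerLagrange (extModel I) (L ∘ projTQ I) c t =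
        lam • constraintForce (extModel I) (constraint I L) c t) ↔
    IsHerglotz (localLagrangian L x₀)
      (liftCurve (fun s => extChartAt (extModel I) (c t) (c s)) t)
      (deriv (liftCurve (fun s => extChartAt (extModel I) (c t) (c s))) t) := by
  set y : ℝ → E × ℝ := fun s => extChartAt (extModel I) (c t) (c s) with hydef
  have hs : (c t).1 ∈ (extChartAt I (c t).1).source := mem_extChartAt_source _
  have hy : ContDiffAt ℝ ∞ y t := contDiffAt_extChartAt_comp hc hs
  have hyt : (y t).1 ∈ (extChartAt I (c t).1).target := by
    change (extChartAt (extModel I) (c t) (c t)).1 ∈ _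
    rw [ext_apply]; exact (extChartAt I (c t).1).map_source hs
  have hY : liftCurve y t ∈ (extChartAt (phaseModel I) x₀).target := by
    rw [phase_target, ← h₀]; exact hyt
  rw [← chetaev_iff_isHerglotz (isOpen_extChartAt_target x₀) (contDiffOn_localLagrangian hL x₀) hy hY,
    constraint_velocity h₀ (hc.mdifferentiableAt (by simp)) hs, and_comm]
  have hO := isOpen_extChartAt_target (I := I) (c t).1
  have h1 : deriv (fun s => fderiv ℝ (inChart (extModel I) (L ∘ projTQ I) (c t) (y s))
      (deriv y s)) t = deriv (fun s => fderiv ℝ (fun v : E × ℝ =>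
        localLagrangian L x₀ (((y s).1, v.1), (y s).2)) (deriv y s)) t := by
    refine Filter.EventuallyEq.deriv_eq ?_
    filter_upwards [hy.continuousAt.fst.preimage_mem_nhds (hO.mem_nhds hyt)] with s hs
    rw [show inChart (extModel I) (L ∘ projTQ I) (c t) (y s) = _ from
      funext fun v => inChart_comp_projTQ x₀ (c t) h₀ hs v]
  have h2 : fderiv ℝ (fun y' => inChart (extModel I) (L ∘ projTQ I) (c t) y' (deriv y t)) (y t) =
      fderiv ℝ (fun y' : E × ℝ => localLagrangian L x₀ ((y'.1, (deriv y t).1), y'.2)) (y t) := by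
    refine Filter.EventuallyEq.fderiv_eq ?_
    filter_upwards [continuous_fst.continuousAt.preimage_mem_nhds (hO.mem_nhds hyt)] with y' hy'
    exact inChart_comp_projTQ x₀ (c t) h₀ hy' _
  have h3 : inChart (extModel I) (constraint I L) (c t) (y t) =
      fun v : E × ℝ => v.2 - localLagrangian L x₀ (((y t).1, v.1), (y t).2) :=
    funext fun v => inChart_constraint x₀ (c t) h₀ hyt v
  have h4 : eulerLagrange (extModel I) (L ∘ projTQ I) c t = deriv (fun s => fderiv ℝ
      (inChart (extModel I) (L ∘ projTQ I) (c t) (y s)) (deriv y s)) t - fderiv ℝ (fun y' =>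
        inChart (extModel I) (L ∘ projTQ I) (c t) y' (deriv y t)) (y t) := rfl
  have h5 : constraintForce (extModel I) (constraint I L) c t =
      fderiv ℝ (inChart (extModel I) (constraint I L) (c t) (y t)) (deriv y t) := rfl
  rw [h4, h5, h1, h2, h3]

variable [FiniteDimensional ℝ E]

/-- The velocity lifts of the motions are, after projection to `TQ × ℝ`, integral curves of the
Herglotz vector field. -/
theorem IsNonholonomicMotion.isMIntegralCurveOn (hL : ContMDiff (phaseModel I) 𝓘(ℝ, ℝ) ∞ L)
    (hreg : IsRegular I L) {c : ℝ → Q × ℝ} {a b : ℝ}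
    (hc : IsNonholonomicMotion (extModel I) (L ∘ projTQ I) (constraint I L) c (Ioo a b)) :
    IsMIntegralCurveOn (fun t => projTQ I (velocity (extModel I) c t)) (xiL I L) (Ioo a b) := by
  intro t ht
  refine HasMFDerivAt.hasMFDerivWithinAt ?_
  have hct : ∀ s ∈ Ioo a b, ContMDiffAt 𝓘(ℝ, ℝ) (extModel I) ∞ c s := fun s hs =>
    hc.1.contMDiffAt (isOpen_Ioo.mem_nhds hs)
  set x₀ := projTQ I (velocity (extModel I) c t) with hx₀
  have h₀ : (c t).1 = x₀.1.proj := rfl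
  set y : ℝ → E × ℝ := fun s => extChartAt (extModel I) (c t) (c s) with hydef
  have hs : (c t).1 ∈ (extChartAt I (c t).1).source := mem_extChartAt_source _
  have hy : ContDiffAt ℝ ∞ y t := contDiffAt_extChartAt_comp (hct t ht) hs
  have hherg := (motion_iff_isHerglotz hL (hct t ht) h₀).1 (hc.2 t ht)
  have hx₀s : x₀ ∈ (extChartAt (phaseModel I) x₀).source := mem_extChartAt_source _
  have hYt : extChartAt (phaseModel I) x₀ x₀ = liftCurve y t :=
    phase_velocity h₀ ((hct t ht).mdifferentiableAt (by simp)) hs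
  have hYtar : liftCurve y t ∈ (extChartAt (phaseModel I) x₀).target := by
    rw [← hYt]; exact (extChartAt (phaseModel I) x₀).map_source hx₀s
  have hY' : HasDerivAt (liftCurve y) (chartField (phaseModel I) (xiL I L) x₀ (liftCurve y t)) t := by
    have h1 := ((contDiffAt_liftCurve hy).differentiableAt (by simp)).hasDerivAt
    rwa [(isRegularAt_localLagrangian hL hreg x₀ hYtar).eq_of_isHerglotz hherg
      (isHerglotz_chartField_xiL hL hreg x₀ hYtar)] at h1
  have h1 := hasMFDerivAt_extChartAt_symm_comp hYtar hY'
  have h2 : (extChartAt (phaseModel I) x₀).symm (liftCurve y t) = x₀ := by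
    rw [← hYt, (extChartAt (phaseModel I) x₀).left_inv hx₀s]
  rw [h2] at h1
  refine h1.congr_of_eventuallyEq ?_
  have hcont : ContinuousAt (fun s => (c s).1) t := (hct t ht).continuousAt.fst
  filter_upwards [isOpen_Ioo.mem_nhds ht,
    hcont.preimage_mem_nhds ((isOpen_extChartAt_source (I := I) (c t).1).mem_nhds hs)] with s hs1 hs2
  rw [← phase_velocity h₀ ((hct s hs1).mdifferentiableAt (by simp)) hs2,
    (extChartAt (phaseModel I) x₀).left_inv (by rw [phase_source]; exact hs2)]

/-- The projection to `Q × ℝ` of a smooth integral curve of the Herglotz vector field is a motion of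
the nonholonomic system, and the curve is the projection of its velocity lift. -/
theorem IsMIntegralCurveOn.isNonholonomicMotion (hL : ContMDiff (phaseModel I) 𝓘(ℝ, ℝ) ∞ L)
    (hreg : IsRegular I L) {Γ : ℝ → TangentBundle I Q × ℝ} {a b : ℝ}
    (hsmooth : ContMDiffOn 𝓘(ℝ, ℝ) (phaseModel I) ∞ Γ (Ioo a b))
    (hΓ : IsMIntegralCurveOn Γ (xiL I L) (Ioo a b)) :
    IsNonholonomicMotion (extModel I) (L ∘ projTQ I) (constraint I L)
      (fun t => ((Γ t).1.proj, (Γ t).2)) (Ioo a b) ∧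
    ∀ t ∈ Ioo a b, projTQ I (velocity (extModel I) (fun t => ((Γ t).1.proj, (Γ t).2)) t) = Γ t := by
  set c : ℝ → Q × ℝ := fun t => ((Γ t).1.proj, (Γ t).2) with hcdef
  have hproj : ContMDiff (phaseModel I) (extModel I) ∞
      (fun y : TangentBundle I Q × ℝ => (y.1.proj, y.2)) :=
    ((Bundle.contMDiff_proj (TangentSpace I)).comp contMDiff_fst).prodMk contMDiff_snd
  have hcs : ContMDiffOn 𝓘(ℝ, ℝ) (extModel I) ∞ c (Ioo a b) := hproj.comp_contMDiffOn hsmooth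
  have hct : ∀ s ∈ Ioo a b, ContMDiffAt 𝓘(ℝ, ℝ) (extModel I) ∞ c s := fun s hs =>
    hcs.contMDiffAt (isOpen_Ioo.mem_nhds hs)
  -- the Herglotz equation `q̇ = v` shows that the integral curve is the lift of its projection
  have key : ∀ t ∈ Ioo a b, ∀ s ∈ Ioo a b, (c s).1 ∈ (extChartAt I (c t).1).source →
      HasDerivAt (fun s => extChartAt (phaseModel I) (Γ t) (Γ s))
        (chartField (phaseModel I) (xiL I L) (Γ t) (extChartAt (phaseModel I) (Γ t) (Γ s))) s ∧
      extChartAt (phaseModel I) (Γ t) (Γ s) =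
        liftCurve (fun s => extChartAt (extModel I) (c t) (c s)) s := by
    intro t ht s hs hsrc
    have hsrc' : Γ s ∈ (extChartAt (phaseModel I) (Γ t)).source := by rw [phase_source]; exact hsrc
    have h1 : HasDerivAt (fun s => extChartAt (phaseModel I) (Γ t) (Γ s))
        (chartField (phaseModel I) (xiL I L) (Γ t) (extChartAt (phaseModel I) (Γ t) (Γ s))) s :=
      (hasDerivWithinAt_extChartAt_comp hsrc' (hΓ s hs)).hasDerivAt (isOpen_Ioo.mem_nhds hs)
    refine ⟨h1, ?_⟩
    have hherg := isHerglotz_chartField_xiL hL hreg (Γ t)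
      ((extChartAt (phaseModel I) (Γ t)).map_source hsrc')
    have h2 := hasDerivAt_extChartAt_comp (c₀ := c t) ((hct s hs).mdifferentiableAt (by simp)) hsrc
    have hcont : ContinuousAt (fun s => (c s).1) s := (hct s hs).continuousAt.fst
    have h3 : (fun s => (extChartAt (extModel I) (c t) (c s)).1) =ᶠ[𝓝 s]
        fun s => (extChartAt (phaseModel I) (Γ t) (Γ s)).1.1 := by
      filter_upwards [hcont.preimage_mem_nhds
        ((isOpen_extChartAt_source (I := I) (c t).1).mem_nhds hsrc)] with s hs
      rw [ext_apply, phase_apply hs]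
    have h1' : HasDerivAt (fun s => (extChartAt (phaseModel I) (Γ t) (Γ s)).1.1) _ s := h1.fst.fst
    have h4 := HasDerivAt.unique h2.fst (h1'.congr_of_eventuallyEq h3)
    rw [liftCurve, h2.deriv]
    have h5 := h4.trans hherg.1
    have h6 := phase_apply (x₀ := Γ t) (x := Γ s) hsrc
    rw [h6] at h5 ⊢
    rw [ext_apply]
    exact Prod.ext (Prod.ext rfl h5.symm) rfl
  have key2 : ∀ t ∈ Ioo a b, (fun s => extChartAt (phaseModel I) (Γ t) (Γ s)) =ᶠ[𝓝 t]
      liftCurve (fun s => extChartAt (extModel I) (c t) (c s)) := by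
    intro t ht
    have hcont : ContinuousAt (fun s => (c s).1) t := (hct t ht).continuousAt.fst
    filter_upwards [isOpen_Ioo.mem_nhds ht, hcont.preimage_mem_nhds
      ((isOpen_extChartAt_source (I := I) (c t).1).mem_nhds (mem_extChartAt_source _))] with s hs1 hs2
    exact (key t ht s hs1 hs2).2
  refine ⟨⟨hcs, fun t ht => ?_⟩, fun t ht => ?_⟩
  · refine (motion_iff_isHerglotz hL (x₀ := Γ t) (hct t ht) rfl).2 ?_
    have h1 := key t ht t ht (mem_extChartAt_source _)
    have h2 := h1.1.congr_of_eventuallyEq (key2 t ht).symm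
    rw [h2.deriv, ← h1.2]
    exact isHerglotz_chartField_xiL hL hreg (Γ t) (mem_extChartAt_target _)
  · have h1 := (key t ht t ht (mem_extChartAt_source _)).2
    rw [← phase_velocity (x₀ := Γ t) rfl ((hct t ht).mdifferentiableAt (by simp))
      (mem_extChartAt_source _)] at h1
    refine ((extChartAt (phaseModel I) (Γ t)).injOn (mem_extChartAt_source _) ?_ h1).symm
    rw [phase_source]
    exact mem_extChartAt_source (I := I) (Γ t).1.proj

end Motions

/-! ### The two exponential maps -/

section ExponentialMaps

set_option linter.unusedSectionVars false

theorem IsSmoothField.flow_eq {F : Type*} [NormedAddCommGroup F] [NormedSpace ℝ F]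
    {G : Type*} [TopologicalSpace G] {J : ModelWithCorners ℝ F G} [J.Boundaryless]
    {M : Type*} [TopologicalSpace M] [ChartedSpace G M] [IsManifold J ∞ M] [T2Space M]
    [FiniteDimensional ℝ F]
    {X : (x : M) → TangentSpace J x} (hX : IsSmoothField J X) {h : ℝ} (hh : 0 ≤ h) {γ : ℝ → M}
    (hγ : IsMIntegralCurveOn γ X (Icc 0 h)) : flow J X h (γ 0) = γ h := by
  have H : FlowDefined J X h (γ 0) := ⟨γ, rfl, hγ⟩
  rw [flow, dif_pos H]
  exact hX.eqOn_of_isMIntegralCurveOn_Icc H.choose_spec.2 hγ H.choose_spec.1 ⟨hh, le_rfl⟩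

variable {E : Type*} [NormedAddCommGroup E] [NormedSpace ℝ E] [FiniteDimensional ℝ E]
  {H : Type*} [TopologicalSpace H] {I : ModelWithCorners ℝ E H} [I.Boundaryless]
  {Q : Type*} [TopologicalSpace Q] [ChartedSpace H Q] [IsManifold I ∞ Q] [T2Space Q]
  {L : TangentBundle I Q × ℝ → ℝ}

/-- The projection `TQ × ℝ → Q × ℝ`, `(q, q̇, z) ↦ (q, z)`. -/
def toConfiguration (I : ModelWithCorners ℝ E H) {Q : Type*} [TopologicalSpace Q] [ChartedSpace H Q]
    (x : TangentBundle I Q × ℝ) : Q × ℝ := (x.1.proj, x.2)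

theorem contMDiff_toConfiguration :
    ContMDiff (phaseModel I) (extModel I) ∞ (toConfiguration I (Q := Q)) :=
  ((Bundle.contMDiff_proj (TangentSpace I)).comp contMDiff_fst).prodMk contMDiff_snd

theorem contMDiff_prTilde : ContMDiff ((extModel I).prod (extModel I)) (I.prod (I.prod 𝓘(ℝ, ℝ))) ∞
    (prTilde (Q := Q)) :=
  (contMDiff_fst.comp contMDiff_fst).prodMk
    ((contMDiff_fst.comp contMDiff_snd).prodMk (contMDiff_snd.comp contMDiff_fst))

theorem continuous_graphL (hL : ContMDiff (phaseModel I) 𝓘(ℝ, ℝ) ∞ L) :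
    Continuous (graphL I L) := by
  have : IsManifold I (1 : WithTop ℕ∞) Q := .of_le (n := ∞) (by simp)
  have h1 := (contMDiff_equivTangentBundleProd_symm (n := 0) (I := I) (M := Q) (I' := 𝓘(ℝ, ℝ))
    (M' := ℝ)).continuous
  refine h1.comp (continuous_fst.prodMk ?_)
  have h2 : Continuous fun x : TangentBundle I Q × ℝ => (x.2, L x) :=
    continuous_snd.prodMk hL.continuous
  exact (tangentBundleModelSpaceHomeomorph 𝓘(ℝ, ℝ)).symm.continuous.comp h2

theorem continuous_projTQ : Continuous (projTQ I (Q := Q)) :=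
  ((contMDiff_fst (n := 1)).continuous_tangentMap le_rfl).prodMk
    (continuous_snd.comp (FiberBundle.continuous_proj (E × ℝ) (TangentSpace (extModel I))))

theorem projTQ_image_constraintSet_inter (O : Set (TangentBundle (extModel I) (Q × ℝ))) :
    projTQ I '' (constraintSet I L ∩ O) = graphL I L ⁻¹' O := by
  ext x
  constructor
  · rintro ⟨w, ⟨hw, hwO⟩, rfl⟩
    rwa [mem_preimage, graphL_projTQ I L hw]
  · exact fun hx => ⟨graphL I L x, ⟨graphL_mem I L x, hx⟩, projTQ_graphL I L x⟩

/-- Along the constraint submanifold, the flow of the nonholonomic system is the flow of the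
Herglotz vector field. -/
theorem flowDefined_and_nhExp_eq (hL : ContMDiff (phaseModel I) 𝓘(ℝ, ℝ) ∞ L)
    (hreg : IsRegular I L) {h : ℝ} (hh : 0 < h) {x : TangentBundle I Q × ℝ}
    (hx : graphL I L x ∈ nhDomain I L h) :
    FlowDefined (phaseModel I) (xiL I L) h x ∧ nhExp I L h (graphL I L x) =
      (toConfiguration I x, toConfiguration I (flow (phaseModel I) (xiL I L) h x)) := by
  have hex := hx.2
  obtain ⟨a, b, ha, hb, hmot, hv⟩ := hex.choose_spec
  have hγ := (hmot.isMIntegralCurveOn hL hreg).mono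
    (show Icc 0 h ⊆ Ioo a b from fun t ht => ⟨ha.trans_le ht.1, ht.2.trans_lt hb⟩)
  have hγ0 : projTQ I (velocity (extModel I) hex.choose 0) = x := by
    rw [hv, projTQ_graphL]
  refine ⟨⟨_, hγ0, hγ⟩, ?_⟩
  have h1 := (isSmoothField_xiL hL hreg).flow_eq hh.le hγ
  rw [hγ0] at h1
  rw [h1]
  refine Prod.ext rfl ?_
  change (nonholonomicFlow (extModel I) (L ∘ projTQ I) (constraint I L) h (graphL I L x)).proj = _
  rw [nonholonomicFlow, dif_pos hex]
  rfl

theorem contactExp_eq (h : ℝ) (x : TangentBundle I Q × ℝ) : contactExp I L h x =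
    prTilde (toConfiguration I x, toConfiguration I (flow (phaseModel I) (xiL I L) h x)) := rfl

/-- The derivative `δ ↦ δq` of the projection of `TQ × ℝ` to `Q`. -/
def positionDeriv (x : TangentBundle I Q × ℝ) :
    TangentSpace (phaseModel I) x →L[ℝ] TangentSpace I x.1.proj :=
  mfderiv (phaseModel I) I (fun y : TangentBundle I Q × ℝ => y.1.proj) x

/-- The differential `δ ↦ δz` of the coordinate `z` of `TQ × ℝ`. -/
def actionDeriv (x : TangentBundle I Q × ℝ) : TangentSpace (phaseModel I) x →L[ℝ] ℝ :=
  differential (phaseModel I) (fun y : TangentBundle I Q × ℝ => y.2) x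

theorem etaL_eq (x : TangentBundle I Q × ℝ) (v : TangentSpace (phaseModel I) x) :
    etaL I L x v = actionDeriv x v - fiberDeriv I L x (positionDeriv x v) := rfl

theorem hasMFDerivAt_position (x : TangentBundle I Q × ℝ) : HasMFDerivAt (phaseModel I) I
    (fun y : TangentBundle I Q × ℝ => y.1.proj) x (positionDeriv x) :=
  (((Bundle.contMDiff_proj (n := ∞) (TangentSpace I (M := Q))).comp
    (contMDiff_fst (I := I.tangent) (J := 𝓘(ℝ, ℝ)) (M := TangentBundle I Q) (N := ℝ)
    (n := ∞))).mdifferentiable (by simp) x).hasMFDerivAt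

theorem hasMFDerivAt_action (x : TangentBundle I Q × ℝ) : HasMFDerivAt (phaseModel I) 𝓘(ℝ, ℝ)
    (fun y : TangentBundle I Q × ℝ => y.2) x (actionDeriv x) :=
  ((contMDiff_snd (I := I.tangent) (J := 𝓘(ℝ, ℝ)) (M := TangentBundle I Q) (N := ℝ)
    (n := ∞)).mdifferentiable (by simp) x).hasMFDerivAt

section FlowMap

variable {φ : TangentBundle I Q × ℝ → TangentBundle I Q × ℝ} {x : TangentBundle I Q × ℝ}

theorem hasMFDerivAt_endpoints (hφ : MDifferentiableAt (phaseModel I) (phaseModel I) φ x) :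
    HasMFDerivAt (phaseModel I) ((extModel I).prod (extModel I))
      (fun y => (toConfiguration I y, toConfiguration I (φ y))) x
      (((positionDeriv x).prod (actionDeriv x)).prod
        (((positionDeriv (φ x)).comp (mfderiv (phaseModel I) (phaseModel I) φ x)).prod
          ((actionDeriv (φ x)).comp (mfderiv (phaseModel I) (phaseModel I) φ x)))) :=
  ((hasMFDerivAt_position x).prodMk (hasMFDerivAt_action x)).prodMk
    (((hasMFDerivAt_position (φ x)).comp x hφ.hasMFDerivAt).prodMk
      ((hasMFDerivAt_action (φ x)).comp x hφ.hasMFDerivAt))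

theorem hasMFDerivAt_prTilde_endpoints
    (hφ : MDifferentiableAt (phaseModel I) (phaseModel I) φ x) :
    HasMFDerivAt (phaseModel I) (I.prod (I.prod 𝓘(ℝ, ℝ)))
      (fun y => prTilde (toConfiguration I y, toConfiguration I (φ y))) x
      ((positionDeriv x).prod
        (((positionDeriv (φ x)).comp (mfderiv (phaseModel I) (phaseModel I) φ x)).prod
          (actionDeriv x))) :=
  (hasMFDerivAt_position x).prodMk
    (((hasMFDerivAt_position (φ x)).comp x hφ.hasMFDerivAt).prodMk (hasMFDerivAt_action x))

/-- The kernel of the derivative of `(q₀, v₀, z₀) ↦ (q₀, q₁, z₀)` at `x`. -/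
theorem eq_zero_of_mfderiv_prTilde_endpoints
    (hφ : MDifferentiableAt (phaseModel I) (phaseModel I) φ x) {v : TangentSpace (phaseModel I) x}
    (hv : mfderiv (phaseModel I) (I.prod (I.prod 𝓘(ℝ, ℝ)))
      (fun y => prTilde (toConfiguration I y, toConfiguration I (φ y))) x v = 0) :
    positionDeriv x v = 0 ∧ actionDeriv x v = 0 ∧
      positionDeriv (φ x) (mfderiv (phaseModel I) (phaseModel I) φ x v) = 0 := by
  have h1 := (DFunLike.congr_fun (hasMFDerivAt_prTilde_endpoints hφ).mfderiv v).symm.trans hv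
  exact ⟨congrArg (fun w : E × E × ℝ => w.1) h1, congrArg (fun w : E × E × ℝ => w.2.2) h1,
    congrArg (fun w : E × E × ℝ => w.2.1) h1⟩

end FlowMap

/-- If `(q₀, v₀, z₀) ↦ (q₀, z₀, q₁, z₁)` is an immersion, so is `(q₀, v₀, z₀) ↦ (q₀, q₁, z₀)`,
because the flow of the Herglotz field preserves the kernel of the contact form `dz - p dq`: where
`δq₀ = δz₀ = 0` and `δq₁ = 0`, also `δz₁ = 0`. -/
theorem injective_mfderiv_contactExp (hL : ContMDiff (phaseModel I) 𝓘(ℝ, ℝ) ∞ L)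
    (hreg : IsRegular I L) {h : ℝ} (hh : 0 < h) {V : Set (TangentBundle I Q × ℝ)} (hV : IsOpen V)
    (hVd : V ⊆ contactDomain I L h) {x : TangentBundle I Q × ℝ} (hx : x ∈ V)
    (hinj : Function.Injective (mfderiv (phaseModel I) ((extModel I).prod (extModel I))
      (fun y => (toConfiguration I y,
        toConfiguration I (flow (phaseModel I) (xiL I L) h y))) x)) :
    Function.Injective (mfderiv (phaseModel I) (I.prod (I.prod 𝓘(ℝ, ℝ)))
      (contactExp I L h) x) := by
  have hX := isSmoothField_xiL hL hreg
  have hVd' : ∀ y ∈ V, FlowDefined (phaseModel I) (xiL I L) h y := hVd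
  unfold FlowDefined at hVd'
  choose! Ψ hΨ0 hΨ using hVd'
  have hflow : ∀ y ∈ V, flow (phaseModel I) (xiL I L) h y = Ψ y h := fun y hy => by
    have h1 := hX.flow_eq hh.le (hΨ y hy)
    rwa [hΨ0 y hy] at h1
  have hφ' := hX.mdifferentiableAt_flow (lieDerivProportional_etaL hL hreg) hV hΨ0 hΨ hx h
    ⟨hh.le, le_rfl⟩
  have heq : (fun y => flow (phaseModel I) (xiL I L) h y) =ᶠ[𝓝 x] fun y => Ψ y h := by
    filter_upwards [hV.mem_nhds hx] with y hy using hflow y hy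
  set φ := flow (phaseModel I) (xiL I L) h with hφdef
  have hφ : MDifferentiableAt (phaseModel I) (phaseModel I) φ x :=
    hφ'.1.congr_of_eventuallyEq heq
  have hker : ∀ v : TangentSpace (phaseModel I) x, etaL I L x v = 0 →
      etaL I L (φ x) (mfderiv (phaseModel I) (phaseModel I) φ x v) = 0 := by
    intro v hv
    have h2 : (mfderiv (phaseModel I) (phaseModel I) φ x v : (E × E) × ℝ) =
        mfderiv (phaseModel I) (phaseModel I) (fun y => Ψ y h) x v :=
      DFunLike.congr_fun (heq.mfderiv_eq (I := phaseModel I) (I' := phaseModel I)) v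
    have h3 : ∀ w : (E × E) × ℝ, (show (E × E) × ℝ →L[ℝ] ℝ from etaL I L (φ x)) w =
        (show (E × E) × ℝ →L[ℝ] ℝ from etaL I L (Ψ x h)) w := by
      rw [hflow x hx]
      exact fun _ => rfl
    exact (congrArg (show (E × E) × ℝ →L[ℝ] ℝ from etaL I L (φ x)) h2).trans
      ((h3 _).trans (hφ'.2 v hv))
  rw [injective_iff_map_eq_zero]
  intro v hv
  obtain ⟨h1, h2, h3⟩ := eq_zero_of_mfderiv_prTilde_endpoints hφ hv
  have h4 := hker v (by rw [etaL_eq, h1, h2, map_zero, sub_zero])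
  rw [etaL_eq, h3, map_zero, sub_zero] at h4
  refine (injective_iff_map_eq_zero _).1 hinj v ?_
  have h5 := DFunLike.congr_fun (hasMFDerivAt_endpoints hφ).mfderiv v
  exact h5.trans (Prod.ext (Prod.ext h1 h2) (Prod.ext h3 h4))

theorem finrank_phase : Module.finrank ℝ ((E × E) × ℝ) = Module.finrank ℝ (E × E × ℝ) := by
  simp only [Module.finrank_prod]
  ring

/-- Where `exp` is an embedding, the contact exponential map and the restriction of `prTilde` to the
image of `exp` are local diffeomorphisms, for arbitrary times. -/
theorem isLocalDiffeo_of_isEmbeddingDomain (hL : ContMDiff (phaseModel I) 𝓘(ℝ, ℝ) ∞ L)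
    (hreg : IsRegular I L) {h : ℝ} (hh : 0 < h) {N : Set (TangentBundle (extModel I) (Q × ℝ))}
    (hN : IsEmbeddingDomain I L h N) :
    IsLocalDiffeoOn ((extModel I).prod (extModel I)) (I.prod (I.prod 𝓘(ℝ, ℝ)))
      prTilde (nhExp I L h '' N) ∧
    IsOpen (projTQ I '' N) ∧ projTQ I '' N ⊆ contactDomain I L h ∧
    IsLocalDiffeoOn (phaseModel I) (I.prod (I.prod 𝓘(ℝ, ℝ))) (contactExp I L h)
      (projTQ I '' N) := by
  obtain ⟨O, hO, hNO⟩ := hN.isOpen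
  set V := projTQ I '' N with hVdef
  have hV' : V = graphL I L ⁻¹' O := by rw [hVdef, hNO, projTQ_image_constraintSet_inter]
  have hV : IsOpen V := hV' ▸ hO.preimage (continuous_graphL hL)
  have hmem : ∀ x ∈ V, graphL I L x ∈ N := fun x hx => by
    rw [hNO]; rw [hV'] at hx; exact ⟨graphL_mem I L x, hx⟩
  have hval := fun x hx => flowDefined_and_nhExp_eq hL hreg hh (hN.subset (hmem x hx))
  have hVd : V ⊆ contactDomain I L h := fun x hx => (hval x hx).1
  set f := nhExp I L h ∘ graphL I L with hf
  have hgf : ∀ x ∈ V, contactExp I L h x = prTilde (f x) := fun x hx => by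
    rw [hf, Function.comp_apply, (hval x hx).2, contactExp_eq]
  obtain ⟨hfs, hfi, hfe⟩ := hN.embedding
  have hgs : ContMDiffOn (phaseModel I) (I.prod (I.prod 𝓘(ℝ, ℝ))) ∞ (contactExp I L h) V :=
    (contMDiff_prTilde.comp_contMDiffOn hfs).congr hgf
  have hloc : ∀ x ∈ V, ∃ V' : Set (TangentBundle I Q × ℝ), IsOpen V' ∧ x ∈ V' ∧ V' ⊆ V ∧
      IsDiffeoOntoOpen (phaseModel I) (I.prod (I.prod 𝓘(ℝ, ℝ))) (contactExp I L h) V' := by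
    intro x hx
    refine exists_isDiffeoOntoOpen finrank_phase hV hgs hx
      (injective_mfderiv_contactExp hL hreg hh hV hVd hx ?_)
    have heq : (fun y => (toConfiguration I y,
        toConfiguration I (flow (phaseModel I) (xiL I L) h y))) =ᶠ[𝓝 x] f := by
      filter_upwards [hV.mem_nhds hx] with y hy using (hval y hy).2.symm
    have h1 := heq.mfderiv_eq (I := phaseModel I) (I' := (extModel I).prod (extModel I))
    have h2 := hfi x hx
    exact fun v w hvw => h2 ((DFunLike.congr_fun h1 v).symm.trans
      (hvw.trans (DFunLike.congr_fun h1 w)))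
  refine ⟨?_, hV, hVd, fun x hx => ?_⟩
  · rintro _ ⟨w, hw, rfl⟩
    have hwc : w ∈ constraintSet I L := by rw [hNO] at hw; exact hw.1
    obtain ⟨V', hV'o, hxV', hV'V, hdiff⟩ := hloc (projTQ I w) ⟨w, hw, rfl⟩
    obtain ⟨hs, hopen, κ, hκ, hκinv⟩ := hdiff
    -- the image of `V'` is open in `M_d`, as `exp` is an embedding
    obtain ⟨W, hW, hWV⟩ := hfe.isInducing.isOpen_iff.1 (hV'o.preimage continuous_subtype_val)
    have hS : nhExp I L h '' N ∩ W = f '' V' := by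
      ext p
      constructor
      · rintro ⟨⟨u, hu, rfl⟩, hpW⟩
        have huc : u ∈ constraintSet I L := by rw [hNO] at hu; exact hu.1
        refine ⟨projTQ I u, ?_, by rw [hf, Function.comp_apply, graphL_projTQ I L huc]⟩
        have h1 : (⟨projTQ I u, u, hu, rfl⟩ : V) ∈ V.domRestrict f ⁻¹' W := by
          change f (projTQ I u) ∈ W
          rwa [hf, Function.comp_apply, graphL_projTQ I L huc]
        rw [hWV] at h1
        exact h1
      · rintro ⟨y, hy, rfl⟩
        refine ⟨⟨graphL I L y, hmem y (hV'V hy), rfl⟩, ?_⟩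
        have h1 : (⟨y, hV'V hy⟩ : V) ∈ (Subtype.val ⁻¹' V' : Set V) := hy
        rw [← hWV] at h1
        exact h1
    have himg : prTilde '' (f '' V') = contactExp I L h '' V' := by
      rw [image_image]
      exact image_congr fun y hy => (hgf y (hV'V hy)).symm
    refine ⟨W, hW, ?_, ?_⟩
    · have h1 : f (projTQ I w) ∈ f '' V' := mem_image_of_mem _ hxV'
      rw [← hS, hf, Function.comp_apply, graphL_projTQ I L hwc] at h1
      exact h1.2
    · rw [hS]
      refine ⟨contMDiff_prTilde.contMDiffOn, himg ▸ hopen, f ∘ κ, ?_, ?_⟩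
      · rw [himg]
        refine hfs.comp hκ ?_
        rintro _ ⟨y, hy, rfl⟩
        rw [mem_preimage, hκinv hy]
        exact hV'V hy
      · rintro _ ⟨y, hy, rfl⟩
        rw [Function.comp_apply, ← hgf y (hV'V hy), hκinv hy]
  · obtain ⟨V', hV'o, hxV', hV'V, hdiff⟩ := hloc x hx
    exact ⟨V', hV'o, hxV', by rwa [inter_eq_self_of_subset_right hV'V]⟩

end ExponentialMaps

/-! ### Short times -/

theorem exists_forall_injective_of_hasDerivAt_id {E : Type*} [NormedAddCommGroup E]
    [NormedSpace ℝ E] {A : ℝ → E →L[ℝ] E} (hA : HasDerivAt A (.id ℝ E) 0) (h0 : A 0 = 0) :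
    ∃ δ > 0, ∀ t, 0 < t → t < δ → Function.Injective (A t) := by
  have h1 := (hasDerivAt_iff_isLittleO.1 hA).bound (c := 1 / 2) (by norm_num)
  obtain ⟨δ, hδ, h2⟩ := Metric.eventually_nhds_iff.1 h1
  refine ⟨δ, hδ, fun t ht htδ => (injective_iff_map_eq_zero _).2 fun v hv => ?_⟩
  have h3 := h2 (y := t) (by rw [Real.dist_eq, sub_zero, abs_of_pos ht]; exact htδ)
  rw [h0, sub_zero, sub_zero, Real.norm_of_nonneg ht.le] at h3
  have h4 := (A t - t • ContinuousLinearMap.id ℝ E).le_of_opNorm_le h3 v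
  have h5 : (A t - t • ContinuousLinearMap.id ℝ E) v = -(t • v) := by simp [hv]
  rw [h5, norm_neg, norm_smul, Real.norm_of_nonneg ht.le] at h4
  have h6 : ‖v‖ ≤ 0 := by
    have := mul_pos ht (show (0:ℝ) < 1 / 2 by norm_num)
    nlinarith [norm_nonneg v]
  exact norm_le_zero_iff.1 h6

theorem isEmbedding_domRestrict_of_leftInvOn {X Y : Type*} [TopologicalSpace X]
    [TopologicalSpace Y] {f : X → Y} {κ : Y → X} {V : Set X} (hf : ContinuousOn f V)
    (hκ : ContinuousOn κ (f '' V)) (hinv : LeftInvOn κ f V) : IsEmbedding (V.domRestrict f) := by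
  let f' : V → f '' V := fun x => ⟨f x, mem_image_of_mem f x.2⟩
  have hf' : Continuous f' := (continuousOn_iff_continuous_domRestrict.1 hf).subtype_mk _
  have h1 : IsEmbedding ((f '' V).domRestrict κ ∘ f') := by
    have h2 : (f '' V).domRestrict κ ∘ f' = Subtype.val := funext fun x => hinv x.2
    rw [h2]
    exact .subtypeVal
  exact IsEmbedding.subtypeVal.comp (h1.of_comp hf' (continuousOn_iff_continuous_domRestrict.1 hκ))

section ShortTimes

set_option linter.unusedSectionVars false

variable {E : Type*} [NormedAddCommGroup E] [NormedSpace ℝ E] [FiniteDimensional ℝ E]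

/-- For a second order equation `q̇ = v`, the derivative of the position at time `t` with respect to
the initial velocity is `t + o(t)`. -/
theorem hasDerivAt_position_velocity {X : (E × E) × ℝ → (E × E) × ℝ} {U : Set ((E × E) × ℝ)}
    (hU : IsOpen U) (hX : ContDiffOn ℝ ∞ X U) (hsecond : ∀ Y ∈ U, (X Y).1.1 = Y.1.2)
    {T : Set ℝ} (hT : IsOpen T) (h0T : (0 : ℝ) ∈ T) {W : Set ((E × E) × ℝ)} (hW : IsOpen W)
    {φ : ℝ × ((E × E) × ℝ) → (E × E) × ℝ} (hφ : ContDiffOn ℝ ∞ φ (T ×ˢ W))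
    (hφ0 : ∀ Y ∈ W, φ (0, Y) = Y)
    (hφd : ∀ t ∈ T, ∀ Y ∈ W, φ (t, Y) ∈ U ∧ HasDerivAt (fun t => φ (t, Y)) (X (φ (t, Y))) t)
    {Y : (E × E) × ℝ} (hY : Y ∈ W) :
    let A : ℝ → E →L[ℝ] E := fun t => ((ContinuousLinearMap.fst ℝ E E).comp
      (.fst ℝ (E × E) ℝ)).comp ((fderiv ℝ φ (t, Y)).comp
        ((ContinuousLinearMap.inr ℝ ℝ ((E × E) × ℝ)).comp (inclVel E)))
    HasDerivAt A (.id ℝ E) 0 ∧ A 0 = 0 := by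
  intro A
  have hO : IsOpen (T ×ˢ W) := hT.prod hW
  have hmem : ((0 : ℝ), Y) ∈ T ×ˢ W := ⟨h0T, hY⟩
  have hφat : ContDiffAt ℝ ∞ φ (0, Y) := hφ.contDiffAt (hO.mem_nhds hmem)
  have hUY : Y ∈ U := by
    have := (hφd 0 h0T Y hY).1
    rwa [hφ0 Y hY] at this
  have hid := fderiv_flow_zero hT h0T hW hφ hφ0 hY
  have hdiff : DifferentiableAt ℝ A 0 := by
    have h1 : DifferentiableAt ℝ (fderiv ℝ φ) (0, Y) :=
      (hφat.fderiv_right (m := ∞) (by simp)).differentiableAt (by simp)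
    have h2 : DifferentiableAt ℝ (fun t : ℝ => fderiv ℝ φ (t, Y)) 0 :=
      h1.comp (0 : ℝ) (differentiableAt_id.prodMk (differentiableAt_const Y))
    exact (differentiableAt_const _).clm_comp (h2.clm_comp (differentiableAt_const _))
  have hXat : HasFDerivAt X (fderiv ℝ X Y) Y :=
    ((hX.contDiffAt (hU.mem_nhds hUY)).differentiableAt (by simp)).hasFDerivAt
  have hX1 : ∀ d, (fderiv ℝ X Y d).1.1 = d.1.2 := by
    intro d
    have h1 := hXat.fst.fst
    have h2 : HasFDerivAt (fun Y : (E × E) × ℝ => (X Y).1.1)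
        ((ContinuousLinearMap.snd ℝ E E).comp (.fst ℝ (E × E) ℝ)) Y :=
      (((ContinuousLinearMap.snd ℝ E E).comp (.fst ℝ (E × E) ℝ)).hasFDerivAt).congr_of_eventuallyEq
        (by filter_upwards [hU.mem_nhds hUY] with Y' hY' using hsecond Y' hY')
    exact DFunLike.congr_fun (HasFDerivAt.unique h1 h2) d
  constructor
  · have h1 : deriv A 0 = .id ℝ E := by
      refine ContinuousLinearMap.ext fun v => ?_
      have h2 : HasDerivAt (fun t => A t v) (deriv A 0 v) 0 := by
        have := hdiff.hasDerivAt.clm_apply (hasDerivAt_const (0 : ℝ) v)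
        simpa using this
      have h3 := hasDerivAt_fderiv_flow hU hX hT hW hφ hφd h0T hY (inclVel E v)
      rw [hφ0 Y hY, hid] at h3
      have h4 : HasDerivAt (fun t => A t v) (fderiv ℝ X Y (inclVel E v)).1.1 0 := h3.fst.fst
      rw [h2.unique h4, hX1]
      rfl
    rw [← h1]
    exact hdiff.hasDerivAt
  · refine ContinuousLinearMap.ext fun v => ?_
    change (fderiv ℝ φ (0, Y) (0, inclVel E v)).1.1 = 0
    rw [hid]
    rfl

variable {H : Type*} [TopologicalSpace H] {I : ModelWithCorners ℝ E H} [I.Boundaryless]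
  {Q : Type*} [TopologicalSpace Q] [ChartedSpace H Q] [IsManifold I ∞ Q] [T2Space Q]
  {L : TangentBundle I Q × ℝ → ℝ}

/-- For short times, both exponential maps are defined and given by a smooth local flow near a
given point `x₀`, and the contact exponential map is an immersion at `x₀`. -/
theorem exists_short_time (hL : ContMDiff (phaseModel I) 𝓘(ℝ, ℝ) ∞ L) (hreg : IsRegular I L)
    (x₀ : TangentBundle I Q × ℝ) :
    ∃ h₀ > 0, ∃ D : Set (TangentBundle I Q × ℝ), IsOpen D ∧ x₀ ∈ D ∧ ∀ h, 0 < h → h < h₀ →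
      (∀ x ∈ D, graphL I L x ∈ nhDomain I L h) ∧
      ContMDiffOn (phaseModel I) (phaseModel I) ∞ (flow (phaseModel I) (xiL I L) h) D ∧
      Function.Injective (mfderiv (phaseModel I) (I.prod (I.prod 𝓘(ℝ, ℝ)))
        (contactExp I L h) x₀) := by
  have hX := isSmoothField_xiL hL hreg
  set τ := extChartAt (phaseModel I) x₀ with hτ
  have hτs : IsOpen τ.source := isOpen_extChartAt_source x₀
  have hU : IsOpen τ.target := isOpen_extChartAt_target x₀
  have hx₀ : x₀ ∈ τ.source := mem_extChartAt_source x₀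
  obtain ⟨ε, hε, W, hW, hxW, φ, hφ, hφ0, hφd⟩ := exists_local_flow hU (hX x₀) (τ.map_source hx₀)
  have h0ε : (0 : ℝ) ∈ Ioo (-ε) ε := ⟨by linarith, hε⟩
  have hlin := hasDerivAt_position_velocity hU (hX x₀)
    (fun Y hY => (isHerglotz_chartField_xiL hL hreg x₀ hY).1) isOpen_Ioo h0ε hW hφ hφ0 hφd hxW
  obtain ⟨δ, hδ, hAinj⟩ := exists_forall_injective_of_hasDerivAt_id hlin.1 hlin.2
  let D : Set (TangentBundle I Q × ℝ) := τ.source ∩ τ ⁻¹' W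
  have hD : IsOpen D := (continuousOn_extChartAt x₀).isOpen_inter_preimage hτs hW
  let F : ℝ → TangentBundle I Q × ℝ → TangentBundle I Q × ℝ := fun t x => τ.symm (φ (t, τ x))
  have hF0 : ∀ x ∈ D, F 0 x = x := fun x hx => by
    change τ.symm (φ (0, τ x)) = x
    rw [hφ0 _ hx.2, τ.left_inv hx.1]
  have hFcurve : ∀ x ∈ D, IsMIntegralCurveOn (fun t => F t x) (xiL I L) (Ioo (-ε) ε) :=
    fun x hx t ht => (hasMFDerivAt_extChartAt_symm_comp (hφd t ht _ hx.2).1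
      (hφd t ht _ hx.2).2).hasMFDerivWithinAt
  have hFsmooth : ∀ x ∈ D, ContMDiffOn 𝓘(ℝ, ℝ) (phaseModel I) ∞ (fun t => F t x) (Ioo (-ε) ε) := by
    intro x hx
    have h1 : ContDiffOn ℝ ∞ (fun t => φ (t, τ x)) (Ioo (-ε) ε) :=
      hφ.comp (contDiffOn_id.prodMk contDiffOn_const) fun t ht => ⟨ht, hx.2⟩
    exact (contMDiffOn_extChartAt_symm x₀).comp h1.contMDiffOn fun t ht => (hφd t ht _ hx.2).1
  refine ⟨min ε δ, lt_min hε hδ, D, hD, ⟨hx₀, hxW⟩, fun h hh hh₀ => ?_⟩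
  have hhε : h ∈ Ioo (-ε) ε := ⟨by linarith, hh₀.trans_le (min_le_left _ _)⟩
  have hIcc : Icc 0 h ⊆ Ioo (-ε) ε := fun t ht => ⟨by linarith [ht.1], ht.2.trans_lt hhε.2⟩
  have hflow : ∀ x ∈ D, flow (phaseModel I) (xiL I L) h x = F h x := fun x hx => by
    have h1 := hX.flow_eq hh.le ((hFcurve x hx).mono hIcc)
    rwa [hF0 x hx] at h1
  have hFs : ContMDiffOn (phaseModel I) (phaseModel I) ∞ (F h) D := by
    have h1 : ContDiffOn ℝ ∞ (fun Y => φ (h, Y)) W :=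
      hφ.comp (contDiffOn_const.prodMk contDiffOn_id) fun Y hY => ⟨hhε, hY⟩
    have h2 : ContMDiffOn (phaseModel I) 𝓘(ℝ, (E × E) × ℝ) ∞ (fun x => φ (h, τ x)) D :=
      h1.contMDiffOn.comp ((contMDiffOn_extChartAt (n := ∞)).mono (fun x hx => by
        rw [← extChartAt_source (phaseModel I)]; exact hx.1)) fun x hx => hx.2
    exact (contMDiffOn_extChartAt_symm x₀).comp h2 fun x hx => (hφd h hhε _ hx.2).1
  have hsm : ContMDiffOn (phaseModel I) (phaseModel I) ∞ (flow (phaseModel I) (xiL I L) h) D :=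
    hFs.congr hflow
  refine ⟨fun x hx => ?_, hsm, ?_⟩
  · obtain ⟨hmot, hvel⟩ := IsMIntegralCurveOn.isNonholonomicMotion hL hreg (hFsmooth x hx)
      (hFcurve x hx)
    refine ⟨graphL_mem I L x, _, -ε, ε, by linarith, hhε.2, hmot, ?_⟩
    have h1 := hvel 0 h0ε
    rw [hF0 x hx] at h1
    exact (graphL_projTQ I L (hmot.2 0 h0ε).1).symm.trans (congrArg (graphL I L) h1)
  · have hφ' : MDifferentiableAt (phaseModel I) (phaseModel I)
        (flow (phaseModel I) (xiL I L) h) x₀ :=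
      (hsm.contMDiffAt (hD.mem_nhds ⟨hx₀, hxW⟩)).mdifferentiableAt (by simp)
    rw [injective_iff_map_eq_zero]
    intro v hv
    obtain ⟨h1, h2, h3⟩ := eq_zero_of_mfderiv_prTilde_endpoints hφ' hv
    -- the coordinates of the flow map
    have hsrc : flow (phaseModel I) (xiL I L) h x₀ ∈ τ.source := by
      rw [hflow x₀ ⟨hx₀, hxW⟩]
      exact τ.map_target (hφd h hhε _ hxW).1
    have hcoord : ∀ w : TangentSpace (phaseModel I) x₀,
        chartDeriv (phaseModel I) x₀ (flow (phaseModel I) (xiL I L) h x₀)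
          (mfderiv (phaseModel I) (phaseModel I) (flow (phaseModel I) (xiL I L) h) x₀ w) =
        fderiv ℝ φ (h, τ x₀) (0, chartDeriv (phaseModel I) x₀ x₀ w) := by
      intro w
      have h4 := (hasMFDerivAt_extChartAt' (phaseModel I) hsrc).comp x₀ hφ'.hasMFDerivAt
      have h5 : HasFDerivAt (fun Y => φ (h, Y)) ((fderiv ℝ φ (h, τ x₀)).comp
          (ContinuousLinearMap.inr ℝ ℝ ((E × E) × ℝ))) (τ x₀) :=
        ((hφ.contDiffAt ((isOpen_Ioo.prod hW).mem_nhds ⟨hhε, hxW⟩)).differentiableAt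
          (by simp)).hasFDerivAt.comp (τ x₀) (hasFDerivAt_prodMk_right h (τ x₀))
      have h6 := h5.hasMFDerivAt.comp x₀ (hasMFDerivAt_extChartAt' (phaseModel I) hx₀)
      have h7 := h6.congr_of_eventuallyEq (f₁ := τ ∘ flow (phaseModel I) (xiL I L) h) (by
        filter_upwards [hD.mem_nhds ⟨hx₀, hxW⟩] with x hx
        rw [Function.comp_apply, hflow x hx]
        exact τ.right_inv (hφd h hhε _ hx.2).1)
      exact DFunLike.congr_fun (hasMFDerivAt_unique h4 h7) w
    have hsrc0 := hx₀
    have hsrc1 := hsrc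
    rw [hτ, phase_source] at hsrc0 hsrc1
    set d : (E × E) × ℝ := chartDeriv (phaseModel I) x₀ x₀ v with hd
    have hd1 : d.1.1 = 0 := by
      rw [hd, ← chartDeriv_mfderiv_proj hsrc0]
      exact (congrArg (chartDeriv I x₀.1.proj x₀.1.proj) h1).trans (map_zero _)
    have hd2 : d.2 = 0 := by
      rw [hd, ← mfderiv_snd_phase hsrc0]
      exact h2
    have hdv : d = inclVel E d.1.2 := Prod.ext (Prod.ext hd1 rfl) hd2
    have hA : (fderiv ℝ φ (h, τ x₀) (0, inclVel E d.1.2)).1.1 = 0 := by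
      rw [← hdv, hd, ← hcoord, ← chartDeriv_mfderiv_proj hsrc1]
      exact (congrArg (chartDeriv I x₀.1.proj _) h3).trans (map_zero _)
    have hv0 : d.1.2 = 0 := (injective_iff_map_eq_zero _).1
      (hAinj h hh (hh₀.trans_le (min_le_right _ _))) _ hA
    have hd0 : d = 0 := by rw [hdv, hv0, map_zero]
    have h8 := mfderiv_symm_extChartAt_apply (phaseModel I) hx₀ v
    refine h8.symm.trans ?_
    exact (congrArg (chartDerivSymm (phaseModel I) x₀ (extChartAt (phaseModel I) x₀ x₀))
      (hd.symm.trans hd0)).trans (map_zero _)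

/-- For short times, the contact exponential map is a diffeomorphism near a given point; as it is
`prTilde ∘ exp`, the nonholonomic exponential map `exp` is an embedding there. -/
theorem exists_isEmbeddingDomain (hL : ContMDiff (phaseModel I) 𝓘(ℝ, ℝ) ∞ L) (hreg : IsRegular I L)
    (x : TangentBundle I Q × ℝ) : ∃ h₀ : ℝ, 0 < h₀ ∧ ∀ h : ℝ, 0 < h → h < h₀ →
      ∃ (N : Set (TangentBundle (extModel I) (Q × ℝ))) (V : Set (TangentBundle I Q × ℝ)),
        IsEmbeddingDomain I L h N ∧ V = projTQ I '' N ∧ x ∈ V ∧ IsOpen V ∧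
        V ⊆ contactDomain I L h ∧
        IsDiffeoOntoOpen (phaseModel I) (I.prod (I.prod 𝓘(ℝ, ℝ))) (contactExp I L h) V := by
  obtain ⟨h₀, hh₀, D, hD, hxD, hshort⟩ := exists_short_time hL hreg x
  refine ⟨h₀, hh₀, fun h hh hlt => ?_⟩
  obtain ⟨hdom, hsm, hinj⟩ := hshort h hh hlt
  have hval := fun y hy => flowDefined_and_nhExp_eq hL hreg hh (hdom y hy)
  set f := nhExp I L h ∘ graphL I L with hf
  have hfD : ContMDiffOn (phaseModel I) ((extModel I).prod (extModel I)) ∞ f D :=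
    (contMDiff_toConfiguration.contMDiffOn.prodMk
      (contMDiff_toConfiguration.comp_contMDiffOn hsm)).congr fun y hy => (hval y hy).2
  have hgf : ∀ y ∈ D, contactExp I L h y = prTilde (f y) := fun y hy => by
    rw [hf, Function.comp_apply, (hval y hy).2, contactExp_eq]
  have hgs : ContMDiffOn (phaseModel I) (I.prod (I.prod 𝓘(ℝ, ℝ))) ∞ (contactExp I L h) D :=
    (contMDiff_prTilde.comp_contMDiffOn hfD).congr hgf
  obtain ⟨V, hV, hxV, hVD, hdiff⟩ := exists_isDiffeoOntoOpen finrank_phase hD hgs hxD hinj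
  have hNV : projTQ I '' (constraintSet I L ∩ projTQ I ⁻¹' V) = V := by
    rw [projTQ_image_constraintSet_inter, ← preimage_comp]
    have h1 : projTQ I ∘ graphL I L = id := funext (projTQ_graphL I L)
    rw [h1, preimage_id]
  refine ⟨constraintSet I L ∩ projTQ I ⁻¹' V, V, ⟨?_, ⟨_, hV.preimage continuous_projTQ, rfl⟩, ?_⟩,
    hNV.symm, hxV, hV, fun y hy => (hval y (hVD hy)).1, hdiff⟩
  · rintro w ⟨hw, hwV⟩
    rw [← graphL_projTQ I L hw]
    exact hdom _ (hVD hwV)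
  · rw [hNV]
    obtain ⟨hs, hopen, κ, hκ, hκinv⟩ := hdiff
    refine ⟨hfD.mono hVD, fun y hy => ?_, ?_⟩
    · have hfy : MDifferentiableAt (phaseModel I) ((extModel I).prod (extModel I)) f y :=
        ((hfD.mono hVD).contMDiffAt (hV.mem_nhds hy)).mdifferentiableAt (by simp)
      have hκy : MDifferentiableAt (I.prod (I.prod 𝓘(ℝ, ℝ))) (phaseModel I) κ (prTilde (f y)) := by
        rw [← hgf y (hVD hy)]
        exact (hκ.contMDiffAt (hopen.mem_nhds (mem_image_of_mem _ hy))).mdifferentiableAt (by simp)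
      have h1 := (hκy.hasMFDerivAt.comp (f y)
        ((contMDiff_prTilde (I := I) (Q := Q)).mdifferentiable (by simp)
          (f y)).hasMFDerivAt).comp y hfy.hasMFDerivAt
      have h2 := (hasMFDerivAt_id (I := phaseModel I) y).congr_of_eventuallyEq
        (f₁ := (κ ∘ prTilde) ∘ f) (by
          filter_upwards [hV.mem_nhds hy] with u hu
          rw [Function.comp_apply, Function.comp_apply, ← hgf u (hVD hu), hκinv hu]
          rfl)
      have h3 := hasMFDerivAt_unique h1 h2
      rw [injective_iff_map_eq_zero]
      intro v hv
      have h4 := DFunLike.congr_fun h3 v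
      exact h4.symm.trans ((congrArg ((mfderiv (I.prod (I.prod 𝓘(ℝ, ℝ))) (phaseModel I) κ
        (prTilde (f y))).comp (mfderiv ((extModel I).prod (extModel I))
          (I.prod (I.prod 𝓘(ℝ, ℝ))) prTilde (f y))) hv).trans (map_zero _))
    · refine IsEmbedding.of_comp (g := prTilde) ?_
        (contMDiff_prTilde (I := I) (Q := Q)).continuous ?_
      · exact continuousOn_iff_continuous_domRestrict.1 (hfD.mono hVD).continuousOn
      · have h1 : prTilde ∘ V.domRestrict f = V.domRestrict (contactExp I L h) :=
          funext fun y => (hgf y (hVD y.2)).symm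
        rw [h1]
        exact isEmbedding_domRestrict_of_leftInvOn hs.continuousOn hκ.continuousOn hκinv

end ShortTimes

end ContactMechanics

end

theorem mainTheorem5 {n : ℕ} {Q : Type*} [TopologicalSpace Q] [T2Space Q]
    [SecondCountableTopology Q] [ChartedSpace (EuclideanSpace ℝ (Fin n)) Q]
    [IsManifold (𝓡 n) ∞ Q] (L : TangentBundle (𝓡 n) Q × ℝ → ℝ)
    (hL : ContMDiff (ContactMechanics.phaseModel (𝓡 n)) 𝓘(ℝ, ℝ) ∞ L)
    (hreg : ContactMechanics.IsRegular (𝓡 n) L) :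
    (∀ h : ℝ, 0 < h → ∀ N : Set (TangentBundle (ContactMechanics.extModel (𝓡 n)) (Q × ℝ)),
      ContactMechanics.IsEmbeddingDomain (𝓡 n) L h N →
        ContactMechanics.IsLocalDiffeoOn
          ((ContactMechanics.extModel (𝓡 n)).prod (ContactMechanics.extModel (𝓡 n)))
          ((𝓡 n).prod ((𝓡 n).prod 𝓘(ℝ, ℝ)))
          ContactMechanics.prTilde (ContactMechanics.nhExp (𝓡 n) L h '' N) ∧
        IsOpen (ContactMechanics.projTQ (𝓡 n) '' N) ∧
        ContactMechanics.projTQ (𝓡 n) '' N ⊆ ContactMechanics.contactDomain (𝓡 n) L h ∧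
        ContactMechanics.IsLocalDiffeoOn (ContactMechanics.phaseModel (𝓡 n))
          ((𝓡 n).prod ((𝓡 n).prod 𝓘(ℝ, ℝ)))
          (ContactMechanics.contactExp (𝓡 n) L h) (ContactMechanics.projTQ (𝓡 n) '' N)) ∧
    (∀ x : TangentBundle (𝓡 n) Q × ℝ, ∃ h₀ : ℝ, 0 < h₀ ∧ ∀ h : ℝ, 0 < h → h < h₀ →
      ∃ (N : Set (TangentBundle (ContactMechanics.extModel (𝓡 n)) (Q × ℝ)))
        (V : Set (TangentBundle (𝓡 n) Q × ℝ)),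
        ContactMechanics.IsEmbeddingDomain (𝓡 n) L h N ∧
        V = ContactMechanics.projTQ (𝓡 n) '' N ∧
        x ∈ V ∧ IsOpen V ∧ V ⊆ ContactMechanics.contactDomain (𝓡 n) L h ∧
        ContactMechanics.IsDiffeoOntoOpen (ContactMechanics.phaseModel (𝓡 n))
          ((𝓡 n).prod ((𝓡 n).prod 𝓘(ℝ, ℝ)))
          (ContactMechanics.contactExp (𝓡 n) L h) V) := by
  exact ⟨fun h hh N hN => ContactMechanics.isLocalDiffeo_of_isEmbeddingDomain hL hreg hh hN,
    fun x => ContactMechanics.exists_isEmbeddingDomain hL hreg x⟩
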